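/- Let $X=[\underline x,\overline x]$ and $Y=[\underline y,\overline y]$ be compact intervals with $\underline x<\overline x$, $\underline y<\overline y$ (firm types and worker types). A *production function* is a twice continuously differentiable $v:X\times Y\to\mathbb R$ with $v_{xz}>0$ and $v_{zz}<0$ on $X\times Y$. A *firm type distribution* $F$ (resp. *worker type distribution* $G$) is a probability distribution on $X$ (resp. $Y$) with a continuous, strictly positive density; we identify distributions with their cdfs. An *assignment* is a probability distribution $J$ on $X\times Y$ (pairs of a firm type and a workforce mean skill) with $X$-marginal $F$ and $Y$-marginal $H=J_Y$ satisfying $\int_{\underline y}^{y}H(t)\,dt\le\int_{\underline y}^{y}G(t)\,dt$ for all $y\in Y$, with equality at $y=\overline y$. A *competitive equilibrium* for $(v,F,G)$ is an assignment $J$ together with Lipschitz functions $p:X\to\mathbb R$ and $q:Y\to\mathbb R$ (*prices*) such that $p(x)+q(z)=v(x,z)$ on $\operatorname{supp}(J)$, $p(x)+q(z)\ge v(x,z)$ on $X\times Y$, $q$ is convex, and $\mathbb E_{J_Y}[q]=\mathbb E_G[q]$. A function $T:X\to Y$ is an *equilibrium matching* for $(v,F,G)$ if, in some competitive equilibrium,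 each firm type $x$ hires a workforce of mean skill $T(x)$ and no other: $\operatorname{supp}(J)=\{(x,T(x)):x\in X\}$. **Theorem.** For every production function $v$ and type distributions $F,G$ there is exactly one equilibrium matching $T_{v,F,G}$. Let $(p_{v,F,G},q_{v,F,G})$ be any equilibrium prices, and write $\ge$ for pointwise inequality. 1. For firm type distributions $F,\hat F$: $T_{v,\hat F,G}\ge T_{v,F,G}$ for all $(v,G)$ if and only if $F\le\hat F$ (that is, $F$ first-order stochastically dominates $\hat F$). 2. For worker type distributions $G,\hat G$: $T_{v,F,\hat G}\ge T_{v,F,G}$ for all $(v,F)$ if and only if $\hat G\le G$ (that is, $\hat G$ first-order stochastically dominates $G$). 3. For every production function $v$ and all type distributions $F,\hat F,G,\hat G$, the price functions are differentiable on $X$ and $Y$ respectively (one-sidedly at endpoints), and $T_{v,\hat F,\hat G}\ge T_{v,F,G}$ on $X$ if and only if $p'_{v,\hat F,\hat G}\ge p'_{v,F,G}$ on $X$ if and only if $q'_{v,\hat F,\hat G}\le q'_{v,F,G}$ on $Y$. -/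

import Mathlib

open Set MeasureTheory ProbabilityTheory

namespace ManyToOne

/-- The partial derivative of `v` in its first variable, along the set `X` of firm types. -/
noncomputable def partialX (X : Set ℝ) (v : ℝ → ℝ → ℝ) (x z : ℝ) : ℝ :=
  derivWithin (fun s => v s z) X x

/-- The partial derivative of `v` in its second variable, along the set `Y` of skill levels. -/
noncomputable def partialZ (Y : Set ℝ) (v : ℝ → ℝ → ℝ) (x z : ℝ) : ℝ :=
  derivWithin (fun s => v x s) Y z

/-- A production function on `X × Y`: twice continuously differentiable (up to the boundary),
with `v_xz > 0` (strictly increasing differences) and `v_zz < 0` (strictly decreasing returns to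
skill) everywhere. Only the values of `v` on `X × Y` matter. -/
structure IsProductionFunction (X Y : Set ℝ) (v : ℝ → ℝ → ℝ) : Prop where
  contDiffOn : ContDiffOn ℝ 2 (Function.uncurry v) (X ×ˢ Y)
  increasing_differences : ∀ x ∈ X, ∀ z ∈ Y, 0 < partialZ Y (partialX X v) x z
  decreasing_returns : ∀ x ∈ X, ∀ z ∈ Y, partialZ Y (partialZ Y v) x z < 0

/-- A type distribution on the interval `X`: a probability measure that has a continuous and
strictly positive density on `X` and no mass outside `X`. -/
structure IsTypeDistribution (X : Set ℝ) (F : Measure ℝ) : Prop where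
  isProbabilityMeasure : IsProbabilityMeasure F
  exists_density : ∃ f : ℝ → ℝ, ContinuousOn f X ∧ (∀ x ∈ X, 0 < f x) ∧
    F = (volume.restrict X).withDensity (fun x => ENNReal.ofReal (f x))

/-- `H` majorizes `G` on `[c, d]` (`G` is a mean-preserving spread of `H`): the integrated cdf of
`H` lies below that of `G` on `[c, d]`, with equality at `d`. -/
def Majorizes (c d : ℝ) (H G : Measure ℝ) : Prop :=
  (∀ y ∈ Icc c d, ∫ t in c..y, cdf H t ≤ ∫ t in c..y, cdf G t) ∧
    ∫ t in c..d, cdf H t = ∫ t in c..d, cdf G t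

/-- An assignment on `[a, b] × [c, d]`: a joint distribution `J` of firm types and workforce mean
skills whose firm marginal is `F` and whose skill marginal majorizes `G`. -/
structure IsAssignment (a b c d : ℝ) (F G : Measure ℝ) (J : Measure (ℝ × ℝ)) : Prop where
  isProbabilityMeasure : IsProbabilityMeasure J
  concentrated : J (Icc a b ×ˢ Icc c d)ᶜ = 0
  fst_eq : J.fst = F
  snd_majorizes : Majorizes c d J.snd G

/-- Competitive equilibrium `(J; p, q)` for production function `v`, firm type distribution `F` on
`[a, b]` and worker type distribution `G` on `[c, d]`. -/
structure IsCompetitiveEquilibrium (a b c d : ℝ) (v : ℝ → ℝ → ℝ) (F G : Measure ℝ)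
    (J : Measure (ℝ × ℝ)) (p q : ℝ → ℝ) : Prop where
  isAssignment : IsAssignment a b c d F G J
  lipschitz_p : ∃ K, LipschitzOnWith K p (Icc a b)
  lipschitz_q : ∃ K, LipschitzOnWith K q (Icc c d)
  eq_on_support : ∀ w ∈ J.support, p w.1 + q w.2 = v w.1 w.2
  no_entry : ∀ x ∈ Icc a b, ∀ z ∈ Icc c d, v x z ≤ p x + q z
  convex_q : ConvexOn ℝ (Icc c d) q
  wages_balance : ∫ z, q z ∂J.snd = ∫ y, q y ∂G

/-- `(p, q)` are equilibrium prices. -/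
def IsEquilibriumPrices (a b c d : ℝ) (v : ℝ → ℝ → ℝ) (F G : Measure ℝ) (p q : ℝ → ℝ) : Prop :=
  ∃ J, IsCompetitiveEquilibrium a b c d v F G J p q

/-- `T : [a, b] → [c, d]` is an equilibrium matching: in some competitive equilibrium, each firm
type `x` hires a workforce of mean skill `T x` and no other, that is, the support of the
equilibrium assignment is the graph of `T`. -/
def IsEquilibriumMatching (a b c d : ℝ) (v : ℝ → ℝ → ℝ) (F G : Measure ℝ) (T : ℝ → ℝ) : Prop :=
  ∃ J p q, IsCompetitiveEquilibrium a b c d v F G J p q ∧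
    J.support = (fun x => (x, T x)) '' Icc a b

end ManyToOne

namespace ManyToOne

variable {a b c d : ℝ} {v : ℝ → ℝ → ℝ}

/-! ### Calculus of production functions: derivatives, increasing differences, concavity. -/

section Production

/-! Equilibrium is a linear programming duality. Call (p, q) dual feasible if q is convex and p(x) +
q(z) ≥ v(x, z), with cost ∫ p dF + ∫ q dG. A convex function has a smaller integral against a
majorizing distribution (`integral_le_of_majorizes`), so equilibrium prices have minimal cost, and
complementary slackness (`eq_on_support_of_dual_le`) makes every feasible pair of minimal cost
support every equilibrium assignment. Since v(x, ·) - q is strictly concave, each firm type has one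
best skill, and the matching is unique. For existence, the cost is minimized over convex wages by
compactness; the first-order condition in directions that keep wages convex
(`exists_demand_of_minimizer`) says that the demand at the minimizer clears the market.

For comparative statics, wages are described by their slope ρ, a monotone function. The net return
v_z - ρ decreases in z, so profit is v(x, c) + ∫ (v_z - ρ)⁺ and the dual cost is modular: its values
at min(ρ, ρh) and max(ρ, ρh) add up to those at ρ and ρh, and both lattice operations preserve
monotonicity, that is, convexity of wages. If ρ is optimal for (F, G) and ρh for (Fh, Gh), comparing
ρ with the maximum bounds the cost of the minimum under (F, G), and dominance carries the bound over
to (Fh, Gh). So the minimum is optimal there, Th is demand at wages no steeper than ρ, and Th ≥ T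
(`IsEquilibriumMatching.le_of_dominance`). Conversely, for v = Kxz - z²/2 with K large the matching
solves G(T(x)) = F(x) (`isEquilibriumMatching_quadratic`), so ordered matchings force ordered cdfs.

For prices, the envelope formula p'(x) = v_x(x, T(x)) and v_xz > 0 turn the order of matchings into
that of p'. Wages have no kink (`continuousAt_slope`): an interval of firms would all demand the
skill at the kink, yet majorization binds there and excludes an atom. Thus q'(T(x)) = v_z(x, T(x))
when T(x) is interior, while q is affine on either side of the range of T; this gives the order of
wage slopes (`slope_le_slope_of_demand_le`). The converse is monotone comparative statics of demand
(`IsDemand.le_of_monotoneOn_sub`). -/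

theorem IsProductionFunction.continuousOn (hv : IsProductionFunction (Icc a b) (Icc c d) v) :
    ContinuousOn (Function.uncurry v) (Icc a b ×ˢ Icc c d) :=
  hv.contDiffOn.continuousOn

theorem IsProductionFunction.hasDerivWithinAt_fst
    (hv : IsProductionFunction (Icc a b) (Icc c d) v) {x z : ℝ} (hx : x ∈ Icc a b)
    (hz : z ∈ Icc c d) :
    HasDerivWithinAt (fun s => v s z) (partialX (Icc a b) v x z) (Icc a b) x := by
  have h1 : DifferentiableWithinAt ℝ (Function.uncurry v) (Icc a b ×ˢ Icc c d) (x, z) :=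
    hv.contDiffOn.differentiableOn (by norm_num) _ ⟨hx, hz⟩
  have h2 : DifferentiableWithinAt ℝ (fun s : ℝ => (s, z)) (Icc a b) x := by fun_prop
  have h3 : DifferentiableWithinAt ℝ (fun s => v s z) (Icc a b) x :=
    h1.comp (f := fun s : ℝ => (s, z)) x h2 (fun s hs => ⟨hs, hz⟩)
  exact h3.hasDerivWithinAt

theorem IsProductionFunction.hasDerivWithinAt_snd
    (hv : IsProductionFunction (Icc a b) (Icc c d) v) {x z : ℝ} (hx : x ∈ Icc a b)
    (hz : z ∈ Icc c d) :
    HasDerivWithinAt (v x) (partialZ (Icc c d) v x z) (Icc c d) z := by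
  have h1 : DifferentiableWithinAt ℝ (Function.uncurry v) (Icc a b ×ˢ Icc c d) (x, z) :=
    hv.contDiffOn.differentiableOn (by norm_num) _ ⟨hx, hz⟩
  have h2 : DifferentiableWithinAt ℝ (fun s : ℝ => (x, s)) (Icc c d) z := by fun_prop
  have h3 : DifferentiableWithinAt ℝ (v x) (Icc c d) z :=
    h1.comp (f := fun s : ℝ => (x, s)) z h2 (fun s hs => ⟨hx, hs⟩)
  exact h3.hasDerivWithinAt

theorem IsProductionFunction.continuousOn_partialX (hab : a < b) (hcd : c < d)
    (hv : IsProductionFunction (Icc a b) (Icc c d) v) :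
    ContinuousOn (Function.uncurry (partialX (Icc a b) v)) (Icc a b ×ˢ Icc c d) := by
  have hu : UniqueDiffOn ℝ (Icc a b ×ˢ Icc c d) :=
    (uniqueDiffOn_Icc hab).prod (uniqueDiffOn_Icc hcd)
  have h := (hv.contDiffOn.continuousOn_fderivWithin hu (by norm_num)).clm_apply
    (continuousOn_const (c := ((1 : ℝ), (0 : ℝ))))
  refine h.congr ?_
  rintro ⟨x, z⟩ ⟨hx, hz⟩
  have h1 : HasFDerivWithinAt (Function.uncurry v) _ (Icc a b ×ˢ Icc c d) (x, z) :=
    (hv.contDiffOn.differentiableOn (by norm_num) _ ⟨hx, hz⟩).hasFDerivWithinAt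
  have h2 : HasDerivWithinAt (fun s : ℝ => (s, z)) ((1 : ℝ), (0 : ℝ)) (Icc a b) x :=
    (hasDerivWithinAt_id x _).prodMk (hasDerivWithinAt_const x _ z)
  have h3 := h1.comp_hasDerivWithinAt (f := fun s : ℝ => (s, z)) x h2 (fun s hs => ⟨hs, hz⟩)
  exact (uniqueDiffOn_Icc hab x hx).eq_deriv _ (hv.hasDerivWithinAt_fst hx hz) h3

theorem IsProductionFunction.continuousOn_partialZ (hab : a < b) (hcd : c < d)
    (hv : IsProductionFunction (Icc a b) (Icc c d) v) :
    ContinuousOn (Function.uncurry (partialZ (Icc c d) v)) (Icc a b ×ˢ Icc c d) := by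
  have hu : UniqueDiffOn ℝ (Icc a b ×ˢ Icc c d) :=
    (uniqueDiffOn_Icc hab).prod (uniqueDiffOn_Icc hcd)
  have h := (hv.contDiffOn.continuousOn_fderivWithin hu (by norm_num)).clm_apply
    (continuousOn_const (c := ((0 : ℝ), (1 : ℝ))))
  refine h.congr ?_
  rintro ⟨x, z⟩ ⟨hx, hz⟩
  have h1 : HasFDerivWithinAt (Function.uncurry v) _ (Icc a b ×ˢ Icc c d) (x, z) :=
    (hv.contDiffOn.differentiableOn (by norm_num) _ ⟨hx, hz⟩).hasFDerivWithinAt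
  have h2 : HasDerivWithinAt (fun s : ℝ => (x, s)) ((0 : ℝ), (1 : ℝ)) (Icc c d) z :=
    (hasDerivWithinAt_const z _ x).prodMk (hasDerivWithinAt_id z _)
  have h3 := h1.comp_hasDerivWithinAt (f := fun s : ℝ => (x, s)) z h2 (fun s hs => ⟨hx, hs⟩)
  exact (uniqueDiffOn_Icc hcd z hz).eq_deriv _ (hv.hasDerivWithinAt_snd hx hz) h3

theorem continuousOn_slice_snd {w : ℝ → ℝ → ℝ} {X Y : Set ℝ}
    (h : ContinuousOn (Function.uncurry w) (X ×ˢ Y)) {x : ℝ} (hx : x ∈ X) :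
    ContinuousOn (w x) Y :=
  h.comp (f := fun s : ℝ => (x, s)) (by fun_prop) (fun s hs => ⟨hx, hs⟩)

theorem continuousOn_slice_fst {w : ℝ → ℝ → ℝ} {X Y : Set ℝ}
    (h : ContinuousOn (Function.uncurry w) (X ×ˢ Y)) {z : ℝ} (hz : z ∈ Y) :
    ContinuousOn (fun x => w x z) X :=
  h.comp (f := fun s : ℝ => (s, z)) (by fun_prop) (fun s hs => ⟨hs, hz⟩)

/-- Differentiability comes for free: `derivWithin` is 0 where no derivative exists, so a positive
value certifies one. The sign conditions on second derivatives can therefore be used directly. -/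
theorem strictMonoOn_of_derivWithin_pos_Icc {f : ℝ → ℝ} {l r : ℝ}
    (h : ∀ t ∈ Icc l r, 0 < derivWithin f (Icc l r) t) : StrictMonoOn f (Icc l r) := by
  refine strictMonoOn_of_deriv_pos (convex_Icc l r) (fun t ht =>
    (differentiableWithinAt_of_derivWithin_ne_zero (h t ht).ne').continuousWithinAt) ?_
  intro t ht
  rw [interior_Icc] at ht
  have := h t (Ioo_subset_Icc_self ht)
  rwa [derivWithin_of_mem_nhds (Icc_mem_nhds ht.1 ht.2)] at this

theorem IsProductionFunction.strictMonoOn_partialX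
    (hv : IsProductionFunction (Icc a b) (Icc c d) v) {x : ℝ} (hx : x ∈ Icc a b) :
    StrictMonoOn (partialX (Icc a b) v x) (Icc c d) :=
  strictMonoOn_of_derivWithin_pos_Icc fun z hz => hv.increasing_differences x hx z hz

theorem IsProductionFunction.strictAntiOn_partialZ
    (hv : IsProductionFunction (Icc a b) (Icc c d) v) {x : ℝ} (hx : x ∈ Icc a b) :
    StrictAntiOn (partialZ (Icc c d) v x) (Icc c d) := by
  have : StrictMonoOn (fun z => -partialZ (Icc c d) v x z) (Icc c d) :=
    strictMonoOn_of_derivWithin_pos_Icc fun z hz => by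
      rw [derivWithin.fun_neg]
      exact neg_pos.2 (hv.decreasing_returns x hx z hz)
  intro s hs t ht hst
  exact neg_lt_neg_iff.1 (this hs ht hst)

theorem strictMonoOn_of_hasDerivWithinAt_pos {f f' : ℝ → ℝ} {l r : ℝ} (hlr : l < r)
    (hf : ∀ t ∈ Icc l r, HasDerivWithinAt f (f' t) (Icc l r) t) (h : ∀ t ∈ Icc l r, 0 < f' t) :
    StrictMonoOn f (Icc l r) :=
  strictMonoOn_of_derivWithin_pos_Icc fun t ht => by
    rw [(hf t ht).derivWithin (uniqueDiffOn_Icc hlr t ht)]; exact h t ht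

theorem IsProductionFunction.strict_increasing_differences (hab : a < b)
    (hv : IsProductionFunction (Icc a b) (Icc c d) v) {x x' z z' : ℝ} (hx : x ∈ Icc a b)
    (hx' : x' ∈ Icc a b) (hxx : x < x') (hz : z ∈ Icc c d) (hz' : z' ∈ Icc c d) (hzz : z < z') :
    v x z' - v x z < v x' z' - v x' z := by
  refine strictMonoOn_of_hasDerivWithinAt_pos (f := fun s => v s z' - v s z)
    (f' := fun s => partialX (Icc a b) v s z' - partialX (Icc a b) v s z) hab
    (fun t ht => (hv.hasDerivWithinAt_fst ht hz').sub (hv.hasDerivWithinAt_fst ht hz))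
    (fun t ht => sub_pos.2 (hv.strictMonoOn_partialX ht hz hz' hzz)) hx hx' hxx

/-- The hypothesis controls ∂z∂x v only. Increasing differences make v(x', ·) - v(x, ·) increasing,
so its derivative is nonnegative, and symmetry of second derivatives is not needed. -/
theorem IsProductionFunction.monotoneOn_partialZ (hab : a < b) (hcd : c < d)
    (hv : IsProductionFunction (Icc a b) (Icc c d) v) {z : ℝ} (hz : z ∈ Icc c d) :
    MonotoneOn (fun x => partialZ (Icc c d) v x z) (Icc a b) := by
  intro x hx x' hx' hxx
  rcases hxx.eq_or_lt with rfl | hxx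
  · exact le_rfl
  have hm : MonotoneOn (fun s => v x' s - v x s) (Icc c d) := by
    intro s hs t ht hst
    rcases hst.eq_or_lt with rfl | hst
    · exact le_rfl
    have := hv.strict_increasing_differences hab hx hx' hxx hs ht hst
    simp only; linarith
  have h1 := (hv.hasDerivWithinAt_snd hx' hz).sub (hv.hasDerivWithinAt_snd hx hz)
  have h2 := hm.derivWithin_nonneg (x := z)
  have h3 := h1.derivWithin (uniqueDiffOn_Icc hcd z hz)
  have h4 : derivWithin (fun s => v x' s - v x s) (Icc c d) z = _ := h3
  simp only
  linarith

theorem IsProductionFunction.strictConcaveOn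
    (hv : IsProductionFunction (Icc a b) (Icc c d) v) {x : ℝ} (hx : x ∈ Icc a b) :
    StrictConcaveOn ℝ (Icc c d) (v x) := by
  refine StrictAntiOn.strictConcaveOn_of_deriv (convex_Icc c d)
    (continuousOn_slice_snd hv.continuousOn hx) ?_
  rw [interior_Icc]
  have h : ∀ t ∈ Ioo c d, deriv (v x) t = partialZ (Icc c d) v x t := fun t ht =>
    ((hv.hasDerivWithinAt_snd hx (Ioo_subset_Icc_self ht)).hasDerivAt
      (Icc_mem_nhds ht.1 ht.2)).deriv
  intro s hs t ht hst
  rw [h s hs, h t ht]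
  exact hv.strictAntiOn_partialZ hx (Ioo_subset_Icc_self hs) (Ioo_subset_Icc_self ht) hst

theorem IsProductionFunction.integral_partialZ (hab : a < b) (hcd : c < d)
    (hv : IsProductionFunction (Icc a b) (Icc c d) v) {x y z : ℝ} (hx : x ∈ Icc a b)
    (hy : y ∈ Icc c d) (hz : z ∈ Icc c d) (hyz : y ≤ z) :
    ∫ t in y..z, partialZ (Icc c d) v x t = v x z - v x y := by
  have hsub : Icc y z ⊆ Icc c d := Icc_subset_Icc hy.1 hz.2
  refine intervalIntegral.integral_eq_sub_of_hasDeriv_right_of_le hyz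
    ((continuousOn_slice_snd hv.continuousOn hx).mono hsub) (fun t ht => ?_) ?_
  · exact ((hv.hasDerivWithinAt_snd hx (hsub (Ioo_subset_Icc_self ht))).hasDerivAt
      (Icc_mem_nhds (hy.1.trans_lt ht.1) (ht.2.trans_le hz.2))).hasDerivWithinAt
  · refine ContinuousOn.intervalIntegrable ?_
    rw [uIcc_of_le hyz]
    exact (continuousOn_slice_snd (hv.continuousOn_partialZ hab hcd) hx).mono hsub

theorem IsProductionFunction.tangent_inequality
    (hv : IsProductionFunction (Icc a b) (Icc c d) v) {x y z : ℝ} (hx : x ∈ Icc a b)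
    (hy : y ∈ Icc c d) (hz : z ∈ Icc c d) :
    v x z ≤ v x y + partialZ (Icc c d) v x y * (z - y) := by
  have hc := (hv.strictConcaveOn hx).concaveOn
  have hd := hv.hasDerivWithinAt_snd hx hy
  rcases lt_trichotomy y z with h | rfl | h
  · have := hc.slope_le_of_hasDerivWithinAt hy hz h hd
    rw [slope_def_field, div_le_iff₀ (by linarith)] at this
    linarith
  · simp
  · have := hc.le_slope_of_hasDerivWithinAt hz hy h hd
    rw [slope_def_field, le_div_iff₀ (by linarith)] at this
    linarith

theorem exists_bound_of_continuousOn {w : ℝ → ℝ → ℝ}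
    (h : ContinuousOn (Function.uncurry w) (Icc a b ×ˢ Icc c d)) :
    ∃ L : NNReal, ∀ x ∈ Icc a b, ∀ z ∈ Icc c d, ‖w x z‖₊ ≤ L := by
  obtain ⟨C, hC⟩ := (isCompact_Icc.prod isCompact_Icc).exists_bound_of_continuousOn h
  refine ⟨C.toNNReal, fun x hx z hz => ?_⟩
  have := hC (x, z) ⟨hx, hz⟩
  exact NNReal.coe_le_coe.1 (by simpa using Or.inl this)

theorem IsProductionFunction.exists_lipschitz (hab : a < b) (hcd : c < d)
    (hv : IsProductionFunction (Icc a b) (Icc c d) v) :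
    ∃ L : NNReal, (∀ x ∈ Icc a b, LipschitzOnWith L (v x) (Icc c d)) ∧
      ∀ z ∈ Icc c d, LipschitzOnWith L (fun x => v x z) (Icc a b) := by
  obtain ⟨L1, h1⟩ := exists_bound_of_continuousOn (hv.continuousOn_partialX hab hcd)
  obtain ⟨L2, h2⟩ := exists_bound_of_continuousOn (hv.continuousOn_partialZ hab hcd)
  refine ⟨max L1 L2, fun x hx => ?_, fun z hz => ?_⟩
  · exact (convex_Icc c d).lipschitzOnWith_of_nnnorm_hasDerivWithin_le
      (fun z hz => hv.hasDerivWithinAt_snd hx hz)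
      (fun z hz => (h2 x hx z hz).trans (le_max_right _ _))
  · exact (convex_Icc a b).lipschitzOnWith_of_nnnorm_hasDerivWithin_le
      (fun x hx => hv.hasDerivWithinAt_fst hx hz)
      (fun x hx => (h1 x hx z hz).trans (le_max_left _ _))

end Production
end ManyToOne

namespace ManyToOne

variable {a b c d : ℝ}

/-! ### Type distributions, integrated cdfs and first-order dominance. -/

section Distributions

theorem ae_mem_Icc {μ : Measure ℝ} (h : μ (Icc a b)ᶜ = 0) : ∀ᵐ x ∂μ, x ∈ Icc a b :=
  mem_ae_iff.2 h

theorem cdf_eq_zero_of_lt {μ : Measure ℝ} [IsProbabilityMeasure μ] (h : μ (Icc a b)ᶜ = 0) {x : ℝ}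
    (hx : x < a) : cdf μ x = 0 := by
  rw [cdf_eq_real, measureReal_eq_zero_iff]
  refine measure_mono_null (fun y hy => ?_) h
  exact fun hy' => absurd (hy'.1.trans hy) (not_le.2 hx)

theorem cdf_eq_one_of_le {μ : Measure ℝ} [IsProbabilityMeasure μ] (h : μ (Icc a b)ᶜ = 0) {x : ℝ}
    (hx : b ≤ x) : cdf μ x = 1 := by
  rw [cdf_eq_real, measureReal_def, (prob_compl_eq_zero_iff measurableSet_Iic).1]
  · simp
  · exact measure_mono_null (compl_subset_compl.2 fun y hy => hy.2.trans hx) h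

theorem integrable_of_continuousOn_Icc {μ : Measure ℝ} [IsFiniteMeasure μ]
    (h : μ (Icc a b)ᶜ = 0) {f : ℝ → ℝ} (hf : ContinuousOn f (Icc a b)) : Integrable f μ := by
  have hr : μ.restrict (Icc a b) = μ := Measure.restrict_eq_self_of_ae_mem (ae_mem_Icc h)
  rw [← hr]
  exact hf.integrableOn_compact isCompact_Icc

theorem cdf_sub_cdf {μ : Measure ℝ} [IsProbabilityMeasure μ] {x y : ℝ} (hxy : x ≤ y) :
    cdf μ y - cdf μ x = μ.real (Ioc x y) := by
  rw [cdf_eq_real, cdf_eq_real, ← Iic_sdiff_Iic, measureReal_sdiff (Iic_subset_Iic.2 hxy)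
    measurableSet_Iic]

theorem IsTypeDistribution.measure_compl {F : Measure ℝ} (hF : IsTypeDistribution (Icc a b) F) :
    F (Icc a b)ᶜ = 0 := by
  obtain ⟨f, -, -, rfl⟩ := hF.exists_density
  exact withDensity_absolutelyContinuous _ _ (by simp [Measure.restrict_apply measurableSet_Icc.compl])

theorem IsTypeDistribution.absolutelyContinuous {F : Measure ℝ}
    (hF : IsTypeDistribution (Icc a b) F) : F ≪ volume := by
  obtain ⟨f, -, -, rfl⟩ := hF.exists_density
  exact (withDensity_absolutelyContinuous _ _).trans Measure.restrict_le_self.absolutelyContinuous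

/-- A continuous positive density attains a positive minimum and a maximum on a compact interval.
The two constants later calibrate the complementarity parameter of the quadratic examples. -/
theorem IsTypeDistribution.exists_bounds {F : Measure ℝ} (hab : a < b)
    (hF : IsTypeDistribution (Icc a b) F) : ∃ m M : ℝ, 0 < m ∧ 0 < M ∧
      ∀ x ∈ Icc a b, ∀ y ∈ Icc a b, x ≤ y →
        m * (y - x) ≤ cdf F y - cdf F x ∧ cdf F y - cdf F x ≤ M * (y - x) := by
  have := hF.isProbabilityMeasure
  obtain ⟨f, hf, hpos, hFf⟩ := hF.exists_density
  have hne : (Icc a b).Nonempty := nonempty_Icc.2 hab.le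
  obtain ⟨x0, hx0, hmin⟩ := isCompact_Icc.exists_isMinOn hne hf
  obtain ⟨x1, hx1, hmax⟩ := isCompact_Icc.exists_isMaxOn hne hf
  refine ⟨f x0, f x1, hpos _ hx0, hpos _ hx1, fun x hx y hy hxy => ?_⟩
  have hsub : Ioc x y ⊆ Icc a b := fun t ht => ⟨hx.1.trans ht.1.le, ht.2.trans hy.2⟩
  have hF' : F (Ioc x y) = ∫⁻ t in Ioc x y, ENNReal.ofReal (f t) := by
    rw [hFf, withDensity_apply _ measurableSet_Ioc, Measure.restrict_restrict measurableSet_Ioc,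
      inter_eq_left.2 hsub]
  have hvol : volume (Ioc x y) = ENNReal.ofReal (y - x) := Real.volume_Ioc
  rw [cdf_sub_cdf hxy, measureReal_def]
  constructor
  · rw [← ENNReal.ofReal_le_iff_le_toReal (measure_ne_top _ _),
      hF', ENNReal.ofReal_mul (hpos _ hx0).le, ← hvol, ← setLIntegral_const]
    exact setLIntegral_mono' measurableSet_Ioc fun t ht =>
      ENNReal.ofReal_le_ofReal (hmin (hsub ht))
  · refine ENNReal.toReal_le_of_le_ofReal (mul_nonneg (hpos _ hx1).le (by linarith)) ?_
    rw [hF', ENNReal.ofReal_mul (hpos _ hx1).le, ← hvol, ← setLIntegral_const]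
    exact setLIntegral_mono' measurableSet_Ioc fun t ht =>
      ENNReal.ofReal_le_ofReal (hmax (hsub ht))

theorem IsTypeDistribution.cdf_left {F : Measure ℝ} (hF : IsTypeDistribution (Icc a b) F) :
    cdf F a = 0 := by
  have := hF.isProbabilityMeasure
  rw [cdf_eq_real, measureReal_eq_zero_iff]
  have h1 : F {a} = 0 := hF.absolutelyContinuous (by simp)
  refine measure_mono_null (t := {a} ∪ (Icc a b)ᶜ) (fun y hy => ?_)
    (measure_union_null h1 hF.measure_compl)
  rcases eq_or_lt_of_le (show y ≤ a from hy) with rfl | h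
  · left; rfl
  · right; exact fun h' => absurd h'.1 (not_le.2 h)

theorem IsTypeDistribution.cdf_right {F : Measure ℝ} (hF : IsTypeDistribution (Icc a b) F) :
    cdf F b = 1 := by
  have := hF.isProbabilityMeasure
  exact cdf_eq_one_of_le hF.measure_compl le_rfl

theorem IsTypeDistribution.strictMonoOn_cdf {F : Measure ℝ} (hab : a < b)
    (hF : IsTypeDistribution (Icc a b) F) : StrictMonoOn (cdf F) (Icc a b) := by
  obtain ⟨m, M, hm, -, h⟩ := hF.exists_bounds hab
  intro x hx y hy hxy
  have h1 := (h x hx y hy hxy.le).1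
  have h2 : 0 < m * (y - x) := mul_pos hm (sub_pos.2 hxy)
  linarith

theorem IsTypeDistribution.continuousOn_cdf {F : Measure ℝ} (hab : a < b)
    (hF : IsTypeDistribution (Icc a b) F) : ContinuousOn (cdf F) (Icc a b) := by
  obtain ⟨m, M, -, hM, h⟩ := hF.exists_bounds hab
  refine (LipschitzOnWith.of_le_add_mul M.toNNReal fun x hx y hy => ?_).continuousOn
  rw [Real.coe_toNNReal _ hM.le, Real.dist_eq]
  rcases le_total x y with hxy | hxy
  · have := monotone_cdf F hxy
    have := mul_nonneg hM.le (abs_nonneg (x - y))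
    linarith
  · rw [abs_of_nonneg (by linarith)]
    linarith [(h y hy x hx hxy).2]

theorem IsTypeDistribution.measure_pos {F : Measure ℝ} (hab : a < b)
    (hF : IsTypeDistribution (Icc a b) F) {x : ℝ} (hx : x ∈ Icc a b) {U : Set ℝ}
    (hU : U ∈ nhdsWithin x (Icc a b)) : 0 < F U := by
  obtain ⟨f, hf, hpos, hFf⟩ := hF.exists_density
  rw [pos_iff_ne_zero]
  intro h0
  have hac : volume.restrict (Icc a b) ≪ F := by
    rw [hFf]
    refine withDensity_absolutelyContinuous' ?_ ?_
    · exact (hf.aemeasurable measurableSet_Icc).ennreal_ofReal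
    · filter_upwards [ae_restrict_mem measurableSet_Icc] with t ht
      simpa using hpos t ht
  have h1 := hac h0
  obtain ⟨ε, hε, hball⟩ := Metric.mem_nhdsWithin_iff.1 hU
  have h2 : volume.restrict (Icc a b) (Metric.ball x ε ∩ Icc a b) = 0 := measure_mono_null hball h1
  rw [Measure.restrict_apply (Metric.isOpen_ball.measurableSet.inter measurableSet_Icc),
    inter_assoc, inter_self] at h2
  have h3 : Ioo (max a (x - ε)) (min b (x + ε)) ⊆ Metric.ball x ε ∩ Icc a b := by
    intro t ht
    rw [Real.ball_eq_Ioo]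
    have := max_lt_iff.1 ht.1
    have := lt_min_iff.1 ht.2
    exact ⟨⟨by linarith, by linarith⟩, ⟨by linarith, by linarith⟩⟩
  have h4 := measure_mono_null h3 h2
  rw [Real.volume_Ioo, ENNReal.ofReal_eq_zero] at h4
  have h5 : max a (x - ε) < min b (x + ε) :=
    max_lt (lt_min hab (by linarith [hx.1])) (lt_min (by linarith [hx.2]) (by linarith))
  linarith

/-- Layer-cake formula: the superlevel set of the hinge at height t > 0 is the ray up to k - t. This
makes majorization a comparison of integrals of the hinges (k - y)⁺. -/
theorem integral_posPart_sub {μ : Measure ℝ} [IsProbabilityMeasure μ] (h : μ (Icc c d)ᶜ = 0)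
    {k : ℝ} (hk : c ≤ k) : ∫ y, max (k - y) 0 ∂μ = ∫ t in c..k, cdf μ t := by
  have hint : Integrable (fun y => max (k - y) 0) μ :=
    integrable_of_continuousOn_Icc h (by fun_prop)
  rw [hint.integral_eq_integral_meas_le (Filter.Eventually.of_forall fun y => le_max_right _ _)]
  have h1 : ∀ t ∈ Ioi (0 : ℝ), μ.real {y | t ≤ max (k - y) 0} = cdf μ (k - t) := by
    intro t ht
    rw [cdf_eq_real]
    congr 1
    ext y
    simp only [mem_ofPred_eq, le_max_iff, mem_Iic, not_le.2 (mem_Ioi.1 ht), or_false]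
    constructor <;> intro <;> linarith
  rw [setIntegral_congr_fun measurableSet_Ioi h1,
    setIntegral_eq_of_subset_of_forall_sdiff_eq_zero (s := Ioc 0 (k - c)) measurableSet_Ioi
      Ioc_subset_Ioi_self (f := fun t => cdf μ (k - t)) ?_, ← intervalIntegral.integral_of_le (by linarith),
    intervalIntegral.integral_comp_sub_left (fun t => cdf μ t)]
  · simp
  · rintro t ⟨ht, ht'⟩
    refine cdf_eq_zero_of_lt h ?_
    by_contra hcon
    exact ht' ⟨ht, by linarith⟩

/-- By the layer-cake formula it is enough to compare superlevel sets, and those of an increasing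
continuous function are upper rays, empty, or the whole line. -/
theorem integral_le_of_cdf_le {F Fh : Measure ℝ} [IsProbabilityMeasure F]
    [IsProbabilityMeasure Fh] (hab : a ≤ b) (hF : F (Icc a b)ᶜ = 0) (hFh : Fh (Icc a b)ᶜ = 0)
    (hle : ∀ x ∈ Icc a b, cdf F x ≤ cdf Fh x) {h : ℝ → ℝ} (hc : ContinuousOn h (Icc a b))
    (hm : MonotoneOn h (Icc a b)) : ∫ x, h x ∂Fh ≤ ∫ x, h x ∂F := by
  have hle' : ∀ x, cdf F x ≤ cdf Fh x := by
    intro x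
    by_cases h1 : x < a
    · rw [cdf_eq_zero_of_lt hF h1]; exact cdf_nonneg _ _
    by_cases h2 : b ≤ x
    · rw [cdf_eq_one_of_le hFh h2]; exact cdf_le_one _ _
    · exact hle x ⟨not_lt.1 h1, (not_le.1 h2).le⟩
  -- Extending `h` by constants and subtracting its least value gives a function that is continuous,
  -- monotone and nonnegative on the whole line, as the layer-cake formula wants.
  set g : ℝ → ℝ := fun x => IccExtend hab ((Icc a b).domRestrict h) x - h a with hg
  have hgc : Continuous g := ((continuousOn_iff_continuous_domRestrict.1 hc).Icc_extend').sub
    continuous_const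
  have hgm : Monotone g := fun x y hxy => sub_le_sub_right
    (hm (projIcc a b hab x).2 (projIcc a b hab y).2 (monotone_projIcc hab hxy)) _
  have hg0 : ∀ x, 0 ≤ g x := fun x => sub_nonneg.2
    (hm (left_mem_Icc.2 hab) (projIcc a b hab x).2 (projIcc a b hab x).2.1)
  have hgh : ∀ {μ : Measure ℝ} [IsProbabilityMeasure μ], μ (Icc a b)ᶜ = 0 →
      ∫ x, h x ∂μ = ∫ x, g x ∂μ + h a := by
    intro μ _ hμ
    have h1 : ∫ x, (g x + h a) ∂μ = ∫ x, g x ∂μ + h a := by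
      rw [integral_add (integrable_of_continuousOn_Icc hμ hgc.continuousOn) (integrable_const _)]
      simp
    rw [← h1]
    refine integral_congr_ae ?_
    filter_upwards [ae_mem_Icc hμ] with x hx
    simp [hg, IccExtend_of_mem hab _ hx]
  rw [hgh hF, hgh hFh]
  gcongr 1
  rw [integral_eq_lintegral_of_nonneg_ae (Filter.Eventually.of_forall hg0)
      hgc.aestronglyMeasurable,
    integral_eq_lintegral_of_nonneg_ae (Filter.Eventually.of_forall hg0)
      hgc.aestronglyMeasurable]
  refine ENNReal.toReal_mono ?_ ?_
  · exact ((integrable_of_continuousOn_Icc hF hgc.continuousOn).lintegral_lt_top).ne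
  rw [lintegral_eq_lintegral_meas_lt _ (Filter.Eventually.of_forall hg0) hgc.aemeasurable,
    lintegral_eq_lintegral_meas_lt _ (Filter.Eventually.of_forall hg0) hgc.aemeasurable]
  refine setLIntegral_mono' measurableSet_Ioi fun t _ => ?_
  have hopen : IsOpen {x | t < g x} := isOpen_lt continuous_const hgc
  by_cases hall : ∀ x, t < g x
  · simp [hall]
  push Not at hall
  obtain ⟨x0, hx0⟩ := hall
  rcases eq_empty_or_nonempty {x | t < g x} with he | hne
  · simp [he]
  have hbdd : BddBelow {x | t < g x} := ⟨x0, fun x hx => by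
    by_contra hcon
    exact absurd (hgm (not_le.1 hcon).le) (not_le.2 (hx0.trans_lt hx))⟩
  have hset : {x | t < g x} = Ioi (sInf {x | t < g x}) := by
    ext x
    constructor
    · intro hx
      obtain ⟨ε, hε, hball⟩ := Metric.isOpen_iff.1 hopen x hx
      have : x - ε / 2 ∈ {x | t < g x} := hball (by
        rw [Real.ball_eq_Ioo]; constructor <;> linarith)
      have := csInf_le hbdd this
      rw [mem_Ioi]; linarith
    · intro hx
      obtain ⟨y, hy, hyx⟩ := exists_lt_of_csInf_lt hne hx
      exact lt_of_lt_of_le hy (hgm hyx.le)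
  rw [hset]
  have h1 : ∀ (μ : Measure ℝ) [IsProbabilityMeasure μ] (s : ℝ),
      μ (Ioi s) = ENNReal.ofReal (1 - cdf μ s) := by
    intro μ _ s
    rw [← compl_Iic, prob_compl_eq_one_sub measurableSet_Iic, ENNReal.ofReal_sub _ (cdf_nonneg _ _),
      ofReal_cdf, ENNReal.ofReal_one]
  rw [h1, h1]
  exact ENNReal.ofReal_le_ofReal (by linarith [hle' (sInf {x | t < g x})])

end Distributions
end ManyToOne

namespace ManyToOne

variable {a b c d : ℝ}

/-! ### Convex functions as primitives of monotone slopes; majorization tested on convex functions.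
-/

section Convex

theorem convexOn_of_subgradient {f m : ℝ → ℝ} {s : Set ℝ} (hs : Convex ℝ s)
    (h : ∀ y ∈ s, ∀ z ∈ s, f y + m y * (z - y) ≤ f z) : ConvexOn ℝ s f := by
  refine ⟨hs, fun u hu w hw α β hα hβ hαβ => ?_⟩
  have hy := hs hu hw hα hβ hαβ
  have h1 := h _ hy u hu
  have h2 := h _ hy w hw
  simp only [smul_eq_mul] at *
  have e : α = 1 - β := by linarith
  subst e
  nlinarith [mul_le_mul_of_nonneg_left h1 hα, mul_le_mul_of_nonneg_left h2 hβ]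

/-- A slope is a subgradient of its primitive. The sign convention of the interval integral covers
points on both sides of `y`. -/
theorem monotone_mul_sub_le_integral {ρ : ℝ → ℝ} (hρ : Monotone ρ) (y z : ℝ) :
    ρ y * (z - y) ≤ ∫ t in y..z, ρ t := by
  rcases le_total y z with h | h
  · have := intervalIntegral.integral_mono_on h
      (_root_.intervalIntegrable_const (μ := volume) (c := ρ y)) (hρ.intervalIntegrable) (fun t ht => hρ ht.1)
    simpa [mul_comm] using this
  · have := intervalIntegral.integral_mono_on h
      (hρ.intervalIntegrable) (_root_.intervalIntegrable_const (μ := volume) (c := ρ y)) (fun t ht => hρ ht.2)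
    rw [intervalIntegral.integral_symm]
    simp only [intervalIntegral.integral_const, smul_eq_mul] at this
    linarith

theorem monotone_integral_sub_integral {ρ : ℝ → ℝ} (hρ : Monotone ρ) (c y z : ℝ) :
    (∫ t in c..z, ρ t) - ∫ t in c..y, ρ t = ∫ t in y..z, ρ t :=
  intervalIntegral.integral_interval_sub_left hρ.intervalIntegrable hρ.intervalIntegrable

theorem monotone_convexOn_integral {ρ : ℝ → ℝ} (hρ : Monotone ρ) (c d : ℝ) :
    ConvexOn ℝ (Icc c d) (fun z => ∫ t in c..z, ρ t) :=
  convexOn_of_subgradient (m := ρ) (convex_Icc c d) fun y _ z _ => by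
    have h1 := monotone_mul_sub_le_integral hρ y z
    have h2 := monotone_integral_sub_integral hρ c y z
    linarith

theorem monotone_exists_lipschitzOn_integral {ρ : ℝ → ℝ} (hρ : Monotone ρ) (c d : ℝ) :
    ∃ K, LipschitzOnWith K (fun z => ∫ t in c..z, ρ t) (Icc c d) := by
  refine ⟨(max |ρ c| |ρ d|).toNNReal, LipschitzOnWith.of_le_add_mul _ fun x hx y hy => ?_⟩
  rw [Real.coe_toNNReal _ (le_max_of_le_left (abs_nonneg _)), Real.dist_eq]
  have h1 := monotone_mul_sub_le_integral hρ x y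
  have h2 := monotone_integral_sub_integral hρ c x y
  have h3 : |ρ x| ≤ max |ρ c| |ρ d| := abs_le_max_abs_abs (hρ hx.1) (hρ hx.2)
  have h4 : ρ x * (x - y) ≤ max |ρ c| |ρ d| * |x - y| :=
    (le_abs_self _).trans ((abs_mul _ _).le.trans
      (mul_le_mul_of_nonneg_right h3 (abs_nonneg _)))
  linarith

/-- The right derivative of a convex function is monotone in the interior, and the Lipschitz
constant bounds it, so it extends to a monotone function on the line. Convex wages thereby become
slopes, whose pointwise minima and maxima are again admissible. -/
theorem exists_monotone_integral {q : ℝ → ℝ} {K : NNReal} (hcd : c < d)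
    (hq : ConvexOn ℝ (Icc c d) q) (hK : LipschitzOnWith K q (Icc c d)) :
    ∃ ρ : ℝ → ℝ, Monotone ρ ∧ ∀ z ∈ Icc c d, q z = q c + ∫ t in c..z, ρ t := by
  set r : ℝ → ℝ := fun t => derivWithin q (Ioi t) t with hr
  have hmono : MonotoneOn r (Ioo c d) := by
    have := hq.monotoneOn_rightDeriv
    rwa [interior_Icc] at this
  have hint : ∀ t ∈ Ioo c d, t ∈ interior (Icc c d) := fun t ht => by rwa [interior_Icc]
  have hslope : ∀ s ∈ Icc c d, ∀ t ∈ Icc c d, s < t → |slope q s t| ≤ K := by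
    intro s hs t ht hst
    have h1 := hK.dist_le_mul t ht s hs
    rw [Real.dist_eq, Real.dist_eq] at h1
    rw [slope_def_field, abs_div, div_le_iff₀ (abs_pos.2 (by linarith))]
    exact h1
  have hup : ∀ t ∈ Ioo c d, r t ≤ K := fun t ht =>
    (hq.rightDeriv_le_slope_of_mem_interior (hint t ht) (right_mem_Icc.2 hcd.le) ht.2).trans
      (abs_le.1 (hslope t (Ioo_subset_Icc_self ht) d (right_mem_Icc.2 hcd.le) ht.2)).2
  have hlow : ∀ t ∈ Ioo c d, -(K : ℝ) ≤ r t := fun t ht =>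
    ((abs_le.1 (hslope c (left_mem_Icc.2 hcd.le) t (Ioo_subset_Icc_self ht) ht.1)).1.trans
      (hq.slope_le_leftDeriv_of_mem_interior (left_mem_Icc.2 hcd.le) (hint t ht) ht.1)).trans
      (hq.leftDeriv_le_rightDeriv_of_mem_interior (hint t ht))
  obtain ⟨ρ, hρ, hρr⟩ := hmono.exists_monotone_extension
    ⟨-(K : ℝ), by rintro _ ⟨t, ht, rfl⟩; exact hlow t ht⟩
    ⟨(K : ℝ), by rintro _ ⟨t, ht, rfl⟩; exact hup t ht⟩
  refine ⟨ρ, hρ, fun z hz => ?_⟩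
  have := intervalIntegral.integral_eq_sub_of_hasDeriv_right_of_le (f := q) (f' := ρ) hz.1
    (hK.continuousOn.mono (Icc_subset_Icc_right hz.2)) (fun t ht => ?_) hρ.intervalIntegrable
  · linarith
  · have ht' : t ∈ Ioo c d := ⟨ht.1, ht.2.trans_le hz.2⟩
    rw [← hρr ht']
    exact hq.hasDerivWithinAt_rightDeriv_of_mem_interior (hint t ht')

/-- The sum is the piecewise linear interpolant of `q` on a grid of mesh δ, written in hinge
functions. A cell to the right of `y` contributes minus its increment of `q`, which telescopes
against the leading term; a cell to the left contributes nothing; the cell containing `y` leaves two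
errors of size at most Kδ. -/
theorem interpolation_bound {q : ℝ → ℝ} {K : NNReal} {δ : ℝ} (hδ : 0 < δ) {n : ℕ}
    (hK : LipschitzOnWith K q (Icc c (c + n * δ))) (m : ℕ) (hm : m ≤ n) {y : ℝ} (hcy : c ≤ y)
    (hy : y ≤ c + m * δ) :
    |q (c + m * δ) + ∑ i ∈ Finset.range m,
      (q (c + (i + 1 : ℕ) * δ) - q (c + i * δ)) / δ *
        (max (c + i * δ - y) 0 - max (c + (i + 1 : ℕ) * δ - y) 0) - q y| ≤ 2 * K * δ := by
  have hK0 : 0 ≤ (K : ℝ) * δ := mul_nonneg K.2 hδ.le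
  induction m with
  | zero =>
    have : y = c := le_antisymm (by simpa using hy) hcy
    subst this
    simp; positivity
  | succ m ih =>
    have hmem : ∀ k : ℕ, k ≤ n → c + k * δ ∈ Icc c (c + n * δ) := fun k hk =>
      ⟨by have := mul_nonneg k.cast_nonneg hδ.le; linarith, by gcongr⟩
    have e1 : c + ((m + 1 : ℕ) : ℝ) * δ = c + m * δ + δ := by push_cast; ring
    rw [Finset.sum_range_succ]
    by_cases hym : y ≤ c + m * δ
    · have h := ih (by omega) hym
      have e2 : max (c + m * δ - y) 0 - max (c + ((m + 1 : ℕ) : ℝ) * δ - y) 0 = -δ := by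
        rw [max_eq_left (by linarith), max_eq_left (by rw [e1]; linarith), e1]; ring
      rw [e2]
      have e3 : (q (c + ((m + 1 : ℕ) : ℝ) * δ) - q (c + m * δ)) / δ * -δ
          = q (c + m * δ) - q (c + ((m + 1 : ℕ) : ℝ) * δ) := by field_simp; ring
      rw [e3]
      convert h using 2
      ring
    · have hym := not_le.1 hym
      rw [Finset.sum_eq_zero, zero_add, max_eq_right (by linarith), max_eq_left (by linarith)]
      · have h1 := hK.dist_le_mul _ (hmem (m + 1) hm) y
          ⟨hcy, hy.trans (hmem (m + 1) hm).2⟩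
        have h2 := hK.dist_le_mul _ (hmem (m + 1) hm) _ (hmem m (by omega))
        rw [Real.dist_eq, Real.dist_eq] at h1 h2
        have h3 : |c + ((m + 1 : ℕ) : ℝ) * δ - y| ≤ δ := by
          rw [abs_le]; constructor <;> linarith
        have h4 : |c + ((m + 1 : ℕ) : ℝ) * δ - (c + m * δ)| = δ := by
          rw [e1, add_sub_cancel_left, abs_of_pos hδ]
        rw [h4] at h2
        have h5 := h1.trans (mul_le_mul_of_nonneg_left h3 K.2)
        set A := q (c + ((m + 1 : ℕ) : ℝ) * δ)
        set B := q (c + m * δ)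
        have h6 : |(A - B) / δ * (0 - (c + ((m + 1 : ℕ) : ℝ) * δ - y))| ≤ K * δ := by
          rw [abs_mul, abs_div, abs_of_pos hδ, zero_sub, abs_neg]
          calc |A - B| / δ * |c + ((m + 1 : ℕ) : ℝ) * δ - y| ≤ |A - B| / δ * δ := by gcongr
            _ = |A - B| := by field_simp
            _ ≤ _ := h2
        have := abs_le.1 h5
        have := abs_le.1 h6
        rw [abs_le]; constructor <;> linarith
      · intro i hi
        have hi := Finset.mem_range.1 hi
        have h1 : ((i + 1 : ℕ) : ℝ) * δ ≤ m * δ := by gcongr; omega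
        have h2 : (i : ℝ) * δ ≤ m * δ := by gcongr
        rw [max_eq_right (by linarith), max_eq_right (by linarith)]; simp

/-- Summation by parts leaves the terms (s i - s (i - 1)) D i, which are nonnegative, and two
boundary terms, of which the one at 0 vanishes. -/
theorem abel_lower_bound {s D : ℕ → ℝ} {n : ℕ} (hs : ∀ i, i + 1 < n → s i ≤ s (i + 1))
    (hD : ∀ i ≤ n, 0 ≤ D i) (h0 : D 0 = 0) (m : ℕ) (hm : m + 1 ≤ n) :
    -(s m * D (m + 1)) ≤ ∑ i ∈ Finset.range (m + 1), s i * (D i - D (i + 1)) := by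
  induction m with
  | zero => simp [h0]
  | succ m ih =>
    rw [Finset.sum_range_succ]
    have h1 := ih (by omega)
    have h2 := mul_le_mul_of_nonneg_right (hs m (by omega)) (hD (m + 1) (by omega))
    linarith

/-- Up to a uniform error, `q` is a combination of hinges whose coefficients are its grid slopes.
Majorization orders the integrals of the hinges, convexity orders the slopes, and summation by parts
combines the two. -/
theorem integral_le_of_majorizes {H G : Measure ℝ} [IsProbabilityMeasure H]
    [IsProbabilityMeasure G] (hcd : c < d) (hH : H (Icc c d)ᶜ = 0) (hG : G (Icc c d)ᶜ = 0)
    (hmaj : Majorizes c d H G) {q : ℝ → ℝ} {K : NNReal} (hq : ConvexOn ℝ (Icc c d) q)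
    (hK : LipschitzOnWith K q (Icc c d)) : ∫ z, q z ∂H ≤ ∫ z, q z ∂G := by
  refine le_of_forall_pos_le_add fun ε hε => ?_
  obtain ⟨n, hn⟩ := exists_nat_gt (4 * K * (d - c) / ε)
  have hn0 : (0 : ℝ) < n := lt_of_le_of_lt
    (div_nonneg (mul_nonneg (mul_nonneg (by norm_num) K.2) (by linarith)) hε.le) hn
  set δ : ℝ := (d - c) / n with hδdef
  have hδ : 0 < δ := div_pos (by linarith) hn0
  have hnd : c + n * δ = d := by rw [hδdef]; field_simp; ring
  have hKδ : 4 * K * δ ≤ ε := by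
    rw [hδdef, ← mul_div_assoc, div_le_iff₀ hn0]
    rw [div_lt_iff₀ hε] at hn
    linarith
  set s : ℕ → ℝ := fun i => (q (c + (i + 1 : ℕ) * δ) - q (c + i * δ)) / δ with hs
  set e : ℕ → ℝ → ℝ := fun i y => max (c + i * δ - y) 0 with he
  set Q : ℝ → ℝ := fun y => q d + ∑ i ∈ Finset.range n, s i * (e i y - e (i + 1) y) with hQ
  have hbound : ∀ y ∈ Icc c d, |Q y - q y| ≤ 2 * K * δ := by
    intro y hy
    have := interpolation_bound (q := q) (K := K) (c := c) hδ (n := n) (by rwa [hnd]) n le_rfl hy.1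
      (by rw [hnd]; exact hy.2)
    rw [hnd] at this
    exact this
  have hec : ∀ i, Continuous (e i) := fun i => by fun_prop
  have hQc : Continuous Q := by fun_prop
  have hqc : ContinuousOn q (Icc c d) := hK.continuousOn
  have hmem : ∀ k : ℕ, k ≤ n → c + k * δ ∈ Icc c d := fun k hk => by
    rw [← hnd]
    exact ⟨by have := mul_nonneg k.cast_nonneg hδ.le; linarith, by gcongr⟩
  have hQint : ∀ (μ : Measure ℝ) [IsProbabilityMeasure μ], μ (Icc c d)ᶜ = 0 →
      ∫ y, Q y ∂μ = q d + ∑ i ∈ Finset.range n, s i * (∫ y, e i y ∂μ - ∫ y, e (i + 1) y ∂μ) := by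
    intro μ _ hμ
    have hei : ∀ i, Integrable (e i) μ := fun i =>
      integrable_of_continuousOn_Icc hμ (hec i).continuousOn
    have hterm : ∀ i, Integrable (fun y => s i * (e i y - e (i + 1) y)) μ := fun i =>
      ((hei i).sub (hei (i + 1))).const_mul _
    simp only [hQ]
    rw [integral_add (integrable_const _) (integrable_finsetSum _ fun i _ => hterm i),
      integral_finsetSum _ fun i _ => hterm i]
    simp only [integral_const, probReal_univ, one_smul]
    congr 1
    refine Finset.sum_congr rfl fun i _ => ?_
    rw [integral_const_mul, integral_sub (hei i) (hei (i + 1))]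
  have hclose : ∀ (μ : Measure ℝ) [IsProbabilityMeasure μ], μ (Icc c d)ᶜ = 0 →
      |∫ y, Q y ∂μ - ∫ y, q y ∂μ| ≤ 2 * K * δ := by
    intro μ _ hμ
    rw [← integral_sub (integrable_of_continuousOn_Icc hμ hQc.continuousOn)
      (integrable_of_continuousOn_Icc hμ hqc)]
    have := norm_integral_le_of_norm_le_const (μ := μ) (f := fun y => Q y - q y)
      (C := 2 * K * δ) (by filter_upwards [ae_mem_Icc hμ] with y hy using hbound y hy)
    simpa using this
  set D : ℕ → ℝ := fun i => ∫ y, e i y ∂G - ∫ y, e i y ∂H with hD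
  have hDeq : ∀ i ≤ n, D i = (∫ t in c..(c + i * δ), cdf G t) - ∫ t in c..(c + i * δ), cdf H t := by
    intro i hi
    simp only [hD, he]
    rw [integral_posPart_sub hG (hmem i hi).1, integral_posPart_sub hH (hmem i hi).1]
  have hD0 : ∀ i ≤ n, 0 ≤ D i := fun i hi => by
    rw [hDeq i hi]; linarith [hmaj.1 _ (hmem i hi)]
  have hDz : D 0 = 0 := by rw [hDeq 0 (Nat.zero_le _)]; simp
  have hDn : D n = 0 := by rw [hDeq n le_rfl, hnd, hmaj.2, sub_self]
  have hsm : ∀ i, i + 1 < n → s i ≤ s (i + 1) := by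
    intro i hi
    have e1 : c + ((i + 1 : ℕ) : ℝ) * δ = c + i * δ + δ := by push_cast; ring
    have e2 : c + ((i + 1 + 1 : ℕ) : ℝ) * δ = c + i * δ + δ + δ := by push_cast; ring
    have := hq.slope_mono_adjacent (x := c + i * δ) (y := c + (i + 1 : ℕ) * δ)
      (z := c + (i + 1 + 1 : ℕ) * δ) (hmem i (by omega)) (hmem (i + 1 + 1) (by omega))
      (by rw [e1]; linarith) (by rw [e1, e2]; linarith)
    rw [e1, e2] at this
    simp only [hs, e1, e2]
    simpa [add_sub_cancel_left] using this
  have hfin : ∫ y, Q y ∂H ≤ ∫ y, Q y ∂G := by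
    rw [hQint H hH, hQint G hG]
    obtain ⟨m, rfl⟩ : ∃ m, n = m + 1 := Nat.exists_eq_succ_of_ne_zero (by
      rintro rfl; simp at hn0)
    have := abel_lower_bound hsm hD0 hDz m le_rfl
    rw [hDn, mul_zero, neg_zero] at this
    have h2 : ∑ i ∈ Finset.range (m + 1), s i * (D i - D (i + 1)) =
        ∑ i ∈ Finset.range (m + 1), s i * (∫ y, e i y ∂G - ∫ y, e (i + 1) y ∂G) -
        ∑ i ∈ Finset.range (m + 1), s i * (∫ y, e i y ∂H - ∫ y, e (i + 1) y ∂H) := by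
      rw [← Finset.sum_sub_distrib]
      refine Finset.sum_congr rfl fun i _ => ?_
      simp only [hD]; ring
    linarith
  have h1 := abs_le.1 (hclose H hH)
  have h2 := abs_le.1 (hclose G hG)
  linarith

end Convex
end ManyToOne

namespace ManyToOne

variable {a b c d : ℝ} {v : ℝ → ℝ → ℝ} {F G : Measure ℝ} {J : Measure (ℝ × ℝ)} {p q T : ℝ → ℝ}

/-! ### Duality, complementary slackness and demand. -/

section Duality

theorem integrable_of_continuousOn_box {J : Measure (ℝ × ℝ)} [IsFiniteMeasure J]
    (h : J (Icc a b ×ˢ Icc c d)ᶜ = 0) {f : ℝ × ℝ → ℝ}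
    (hf : ContinuousOn f (Icc a b ×ˢ Icc c d)) : Integrable f J := by
  have hr : J.restrict (Icc a b ×ˢ Icc c d) = J :=
    Measure.restrict_eq_self_of_ae_mem (mem_ae_iff.2 h)
  rw [← hr]
  exact hf.integrableOn_compact (isCompact_Icc.prod isCompact_Icc)

theorem IsAssignment.support_subset (hJ : IsAssignment a b c d F G J) :
    J.support ⊆ Icc a b ×ˢ Icc c d :=
  Measure.support_subset_of_isClosed (isClosed_Icc.prod isClosed_Icc)
    (mem_ae_iff.2 hJ.concentrated)

theorem IsAssignment.isProbabilityMeasure_snd (hJ : IsAssignment a b c d F G J) :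
    IsProbabilityMeasure J.snd := by
  have := hJ.isProbabilityMeasure
  infer_instance

theorem IsAssignment.snd_compl (hJ : IsAssignment a b c d F G J) : J.snd (Icc c d)ᶜ = 0 := by
  rw [Measure.snd_apply measurableSet_Icc.compl]
  exact measure_mono_null (fun w hw (hw' : w ∈ Icc a b ×ˢ Icc c d) => hw hw'.2) hJ.concentrated

theorem IsAssignment.fst_compl (hJ : IsAssignment a b c d F G J) : F (Icc a b)ᶜ = 0 := by
  rw [← hJ.fst_eq, Measure.fst_apply measurableSet_Icc.compl]
  exact measure_mono_null (fun w hw (hw' : w ∈ Icc a b ×ˢ Icc c d) => hw hw'.1) hJ.concentrated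

theorem IsAssignment.integral_fst_add_snd (hJ : IsAssignment a b c d F G J)
    (hp : ContinuousOn p (Icc a b)) (hq : ContinuousOn q (Icc c d)) :
    ∫ w, (p w.1 + q w.2) ∂J = ∫ x, p x ∂F + ∫ z, q z ∂J.snd := by
  have := hJ.isProbabilityMeasure
  have hFp : IsFiniteMeasure J.fst := inferInstance
  have h1 : Integrable (fun w : ℝ × ℝ => p w.1) J :=
    integrable_of_continuousOn_box hJ.concentrated
      (hp.comp continuousOn_fst fun w hw => hw.1)
  have h2 : Integrable (fun w : ℝ × ℝ => q w.2) J :=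
    integrable_of_continuousOn_box hJ.concentrated
      (hq.comp continuousOn_snd fun w hw => hw.2)
  rw [integral_add h1 h2]
  congr 1
  · have hm : AEStronglyMeasurable p J.fst :=
      (integrable_of_continuousOn_Icc (by rw [hJ.fst_eq]; exact hJ.fst_compl) hp).1
    conv_rhs => rw [← hJ.fst_eq]
    exact (integral_map measurable_fst.aemeasurable hm).symm
  · have hm : AEStronglyMeasurable q J.snd :=
      (integrable_of_continuousOn_Icc hJ.snd_compl hq).1
    exact (integral_map measurable_snd.aemeasurable hm).symm

theorem IsCompetitiveEquilibrium.integral_production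
    (hE : IsCompetitiveEquilibrium a b c d v F G J p q) :
    ∫ w, v w.1 w.2 ∂J = ∫ x, p x ∂F + ∫ y, q y ∂G := by
  obtain ⟨K, hK⟩ := hE.lipschitz_p
  obtain ⟨K', hK'⟩ := hE.lipschitz_q
  rw [← hE.wages_balance, ← hE.isAssignment.integral_fst_add_snd hK.continuousOn hK'.continuousOn]
  refine integral_congr_ae ?_
  filter_upwards [Measure.support_mem_ae (μ := J)] with w hw using (hE.eq_on_support w hw).symm

/-- Total output equals the cost of the equilibrium prices. Replacing `J.snd` by `G` in the integral
of the convex wage `q₂` can only raise it, which is the one source of inequality. -/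
theorem IsCompetitiveEquilibrium.integral_gap_le (hcd : c < d)
    (hv : IsProductionFunction (Icc a b) (Icc c d) v) (hG : IsTypeDistribution (Icc c d) G)
    (hE : IsCompetitiveEquilibrium a b c d v F G J p q) {p₂ q₂ : ℝ → ℝ} {K : NNReal}
    (hp : ContinuousOn p₂ (Icc a b)) (hq : ConvexOn ℝ (Icc c d) q₂)
    (hK : LipschitzOnWith K q₂ (Icc c d)) :
    ∫ w, (p₂ w.1 + q₂ w.2 - v w.1 w.2) ∂J ≤
      (∫ x, p₂ x ∂F + ∫ y, q₂ y ∂G) - (∫ x, p x ∂F + ∫ y, q y ∂G) := by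
  have hJ := hE.isAssignment
  have := hJ.isProbabilityMeasure
  have := hG.isProbabilityMeasure
  have h1 : Integrable (fun w : ℝ × ℝ => v w.1 w.2) J :=
    integrable_of_continuousOn_box hJ.concentrated hv.continuousOn
  have h2 : Integrable (fun w : ℝ × ℝ => p₂ w.1 + q₂ w.2) J :=
    integrable_of_continuousOn_box hJ.concentrated
      ((hp.comp continuousOn_fst fun w hw => hw.1).add
        (hK.continuousOn.comp continuousOn_snd fun w hw => hw.2))
  rw [integral_sub h2 h1, hE.integral_production, hJ.integral_fst_add_snd hp hK.continuousOn]
  have := integral_le_of_majorizes hcd hJ.snd_compl hG.measure_compl hJ.snd_majorizes hq hK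
  linarith

theorem IsCompetitiveEquilibrium.dual_le (hcd : c < d)
    (hv : IsProductionFunction (Icc a b) (Icc c d) v) (hG : IsTypeDistribution (Icc c d) G)
    (hE : IsCompetitiveEquilibrium a b c d v F G J p q) {p₂ q₂ : ℝ → ℝ} {K : NNReal}
    (hp : ContinuousOn p₂ (Icc a b)) (hq : ConvexOn ℝ (Icc c d) q₂)
    (hK : LipschitzOnWith K q₂ (Icc c d))
    (hf : ∀ x ∈ Icc a b, ∀ z ∈ Icc c d, v x z ≤ p₂ x + q₂ z) :
    ∫ x, p x ∂F + ∫ y, q y ∂G ≤ ∫ x, p₂ x ∂F + ∫ y, q₂ y ∂G := by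
  have h := hE.integral_gap_le hcd hv hG hp hq hK
  have h0 : 0 ≤ ∫ w, (p₂ w.1 + q₂ w.2 - v w.1 w.2) ∂J := by
    refine integral_nonneg_of_ae ?_
    filter_upwards [mem_ae_iff.2 hE.isAssignment.concentrated] with w hw
    have := hf w.1 hw.1 w.2 hw.2
    simp only [Pi.zero_apply]; linarith
  linarith

/-- The gap p₂ + q₂ - v is continuous and nonnegative on the box and has integral zero, so it cannot
be positive at a point of the support. -/
theorem IsCompetitiveEquilibrium.eq_on_support_of_dual_le (hcd : c < d)
    (hv : IsProductionFunction (Icc a b) (Icc c d) v) (hG : IsTypeDistribution (Icc c d) G)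
    (hE : IsCompetitiveEquilibrium a b c d v F G J p q) {p₂ q₂ : ℝ → ℝ} {K : NNReal}
    (hp : ContinuousOn p₂ (Icc a b)) (hq : ConvexOn ℝ (Icc c d) q₂)
    (hK : LipschitzOnWith K q₂ (Icc c d))
    (hf : ∀ x ∈ Icc a b, ∀ z ∈ Icc c d, v x z ≤ p₂ x + q₂ z)
    (hle : ∫ x, p₂ x ∂F + ∫ y, q₂ y ∂G ≤ ∫ x, p x ∂F + ∫ y, q y ∂G) :
    ∀ w ∈ J.support, p₂ w.1 + q₂ w.2 = v w.1 w.2 := by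
  have hJ := hE.isAssignment
  have := hJ.isProbabilityMeasure
  have h := hE.integral_gap_le hcd hv hG hp hq hK
  set g : ℝ × ℝ → ℝ := fun w => p₂ w.1 + q₂ w.2 - v w.1 w.2 with hg
  have hgc : ContinuousOn g (Icc a b ×ˢ Icc c d) :=
    ((hp.comp continuousOn_fst fun w hw => hw.1).add
      (hK.continuousOn.comp continuousOn_snd fun w hw => hw.2)).sub hv.continuousOn
  have hg0 : 0 ≤ᵐ[J] g := by
    filter_upwards [mem_ae_iff.2 hJ.concentrated] with w hw
    have := hf w.1 hw.1 w.2 hw.2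
    simp only [Pi.zero_apply, hg]; linarith
  have hgi : Integrable g J := integrable_of_continuousOn_box hJ.concentrated hgc
  have hz : ∫ w, g w ∂J = 0 := le_antisymm (by linarith) (integral_nonneg_of_ae hg0)
  have hae := (integral_eq_zero_iff_of_nonneg_ae hg0 hgi).1 hz
  intro w hw
  have hwb := hJ.support_subset hw
  by_contra hne
  have hgw : 0 < g w := by
    have := hf w.1 hwb.1 w.2 hwb.2
    exact lt_of_le_of_ne (by simp only [hg]; linarith) fun h => hne (by simp only [hg] at h; linarith)
  have hU : g ⁻¹' Ioi 0 ∈ nhdsWithin w (Icc a b ×ˢ Icc c d) :=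
    hgc w hwb (Ioi_mem_nhds hgw)
  obtain ⟨O, hO, hOsub⟩ := mem_nhdsWithin_iff_exists_mem_nhds_inter.1 hU
  have hpos := (Measure.mem_support_iff_forall w).1 hw O hO
  refine hpos.ne' (measure_mono_null (t := (Icc a b ×ˢ Icc c d)ᶜ ∪ {w | ¬ g w = 0}) ?_
    (measure_union_null hJ.concentrated (by simpa using ae_iff.1 hae)))
  intro u hu
  by_cases hub : u ∈ Icc a b ×ˢ Icc c d
  · exact Or.inr (ne_of_gt (hOsub ⟨hu, hub⟩))
  · exact Or.inl hub

/-- `T` picks, for each firm type, a skill level in `Y` that maximizes profit at wages `q`. -/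
def IsDemand (X Y : Set ℝ) (v : ℝ → ℝ → ℝ) (q T : ℝ → ℝ) : Prop :=
  ∀ x ∈ X, T x ∈ Y ∧ ∀ z ∈ Y, v x z - q z ≤ v x (T x) - q (T x)

theorem IsProductionFunction.eq_of_isMaxOn
    (hv : IsProductionFunction (Icc a b) (Icc c d) v) (hq : ConvexOn ℝ (Icc c d) q) {x y z : ℝ}
    (hx : x ∈ Icc a b) (hy : y ∈ Icc c d) (hz : z ∈ Icc c d)
    (hmy : ∀ s ∈ Icc c d, v x s - q s ≤ v x y - q y)
    (hmz : ∀ s ∈ Icc c d, v x s - q s ≤ v x z - q z) : y = z :=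
  ((hv.strictConcaveOn hx).sub_convexOn hq).eq_of_isMaxOn (fun s hs => hmy s hs)
    (fun s hs => hmz s hs) hy hz

theorem IsDemand.eqOn (hv : IsProductionFunction (Icc a b) (Icc c d) v)
    (hq : ConvexOn ℝ (Icc c d) q) {T' : ℝ → ℝ} (hT : IsDemand (Icc a b) (Icc c d) v q T)
    (hT' : IsDemand (Icc a b) (Icc c d) v q T') : EqOn T T' (Icc a b) := fun x hx =>
  hv.eq_of_isMaxOn hq hx (hT x hx).1 (hT' x hx).1 (hT x hx).2 (hT' x hx).2

/-- Revealed preference: if two firm types chose in the opposite order, adding their optimality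
conditions would contradict strictly increasing differences. -/
theorem IsDemand.monotoneOn (hab : a < b) (hv : IsProductionFunction (Icc a b) (Icc c d) v)
    (hT : IsDemand (Icc a b) (Icc c d) v q T) : MonotoneOn T (Icc a b) := by
  intro x hx x' hx' hxx
  rcases hxx.eq_or_lt with rfl | hxx
  · exact le_rfl
  by_contra hcon
  have h1 := hv.strict_increasing_differences hab hx hx' hxx (hT x' hx').1 (hT x hx).1
    (not_le.1 hcon)
  have h2 := (hT x hx).2 _ (hT x' hx').1
  have h3 := (hT x' hx').2 _ (hT x hx).1
  linarith

/-- If T(x) > T'(x), moving from T'(x) to T(x) pays at wages `q` and costs no more at `q'`, so T(x)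
is optimal at `q'` too, against uniqueness of the optimum. -/
theorem IsDemand.le_of_monotoneOn_sub (hv : IsProductionFunction (Icc a b) (Icc c d) v)
    {q' T' : ℝ → ℝ} (hq : ConvexOn ℝ (Icc c d) q')
    (hT : IsDemand (Icc a b) (Icc c d) v q T) (hT' : IsDemand (Icc a b) (Icc c d) v q' T')
    (hm : MonotoneOn (fun z => q z - q' z) (Icc c d)) : ∀ x ∈ Icc a b, T x ≤ T' x := by
  intro x hx
  by_contra hcon
  have h1 := hm (hT' x hx).1 (hT x hx).1 (not_le.1 hcon).le
  have h2 := (hT x hx).2 _ (hT' x hx).1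
  refine hcon (hv.eq_of_isMaxOn hq hx (hT x hx).1 (hT' x hx).1 (fun s hs => ?_)
    (hT' x hx).2).le
  have h3 := (hT' x hx).2 s hs
  simp only at h1
  linarith

theorem IsEquilibriumMatching.mapsTo (hT : IsEquilibriumMatching a b c d v F G T) :
    ∀ x ∈ Icc a b, T x ∈ Icc c d := by
  obtain ⟨J, p, q, hE, hs⟩ := hT
  intro x hx
  have : (x, T x) ∈ J.support := by rw [hs]; exact ⟨x, hx, rfl⟩
  exact (hE.isAssignment.support_subset this).2

/-- An equilibrium matching is supported by every dual feasible price pair of minimal cost. -/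
theorem IsEquilibriumMatching.eq_of_dual_le (hcd : c < d)
    (hv : IsProductionFunction (Icc a b) (Icc c d) v) (hG : IsTypeDistribution (Icc c d) G)
    (hT : IsEquilibriumMatching a b c d v F G T) (hpq : IsEquilibriumPrices a b c d v F G p q)
    {p₂ q₂ : ℝ → ℝ} {K : NNReal}
    (hp : ContinuousOn p₂ (Icc a b)) (hq : ConvexOn ℝ (Icc c d) q₂)
    (hK : LipschitzOnWith K q₂ (Icc c d))
    (hf : ∀ x ∈ Icc a b, ∀ z ∈ Icc c d, v x z ≤ p₂ x + q₂ z)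
    (hle : ∫ x, p₂ x ∂F + ∫ y, q₂ y ∂G ≤ ∫ x, p x ∂F + ∫ y, q y ∂G) :
    ∀ x ∈ Icc a b, p₂ x + q₂ (T x) = v x (T x) := by
  obtain ⟨J, p₁, q₁, hE, hs⟩ := hT
  obtain ⟨J', hE'⟩ := hpq
  obtain ⟨K₁, hK₁⟩ := hE.lipschitz_q
  obtain ⟨K₁', hK₁'⟩ := hE.lipschitz_p
  have h1 := hE'.dual_le hcd hv hG hK₁'.continuousOn hE.convex_q hK₁ hE.no_entry
  intro x hx
  have hmem : (x, T x) ∈ J.support := by rw [hs]; exact ⟨x, hx, rfl⟩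
  exact hE.eq_on_support_of_dual_le hcd hv hG hp hq hK hf (hle.trans h1) _ hmem

theorem isDemand_of_eq {p₂ q₂ : ℝ → ℝ} (hT : ∀ x ∈ Icc a b, T x ∈ Icc c d)
    (hf : ∀ x ∈ Icc a b, ∀ z ∈ Icc c d, v x z ≤ p₂ x + q₂ z)
    (heq : ∀ x ∈ Icc a b, p₂ x + q₂ (T x) = v x (T x)) :
    IsDemand (Icc a b) (Icc c d) v q₂ T := fun x hx =>
  ⟨hT x hx, fun z hz => by linarith [hf x hx z hz, heq x hx]⟩

theorem IsEquilibriumMatching.eq_of_prices (hcd : c < d)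
    (hv : IsProductionFunction (Icc a b) (Icc c d) v) (hG : IsTypeDistribution (Icc c d) G)
    (hT : IsEquilibriumMatching a b c d v F G T) (hpq : IsEquilibriumPrices a b c d v F G p q) :
    ∀ x ∈ Icc a b, p x + q (T x) = v x (T x) := by
  have hpq' := hpq
  obtain ⟨J', hE'⟩ := hpq'
  obtain ⟨K, hK⟩ := hE'.lipschitz_q
  obtain ⟨K', hK'⟩ := hE'.lipschitz_p
  exact hT.eq_of_dual_le hcd hv hG hpq hK'.continuousOn hE'.convex_q hK hE'.no_entry le_rfl

theorem IsEquilibriumMatching.isDemand (hcd : c < d)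
    (hv : IsProductionFunction (Icc a b) (Icc c d) v) (hG : IsTypeDistribution (Icc c d) G)
    (hT : IsEquilibriumMatching a b c d v F G T) (hpq : IsEquilibriumPrices a b c d v F G p q) :
    IsDemand (Icc a b) (Icc c d) v q T := by
  obtain ⟨J', hE'⟩ := id hpq
  exact isDemand_of_eq hT.mapsTo hE'.no_entry (hT.eq_of_prices hcd hv hG hpq)

theorem IsEquilibriumMatching.exists_prices (hT : IsEquilibriumMatching a b c d v F G T) :
    ∃ p q, IsEquilibriumPrices a b c d v F G p q := by
  obtain ⟨J, p, q, hE, -⟩ := hT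
  exact ⟨p, q, J, hE⟩

theorem IsEquilibriumMatching.eqOn (hcd : c < d)
    (hv : IsProductionFunction (Icc a b) (Icc c d) v) (hG : IsTypeDistribution (Icc c d) G)
    {T' : ℝ → ℝ} (hT : IsEquilibriumMatching a b c d v F G T)
    (hT' : IsEquilibriumMatching a b c d v F G T') : EqOn T T' (Icc a b) := by
  obtain ⟨p, q, J, hE⟩ := hT.exists_prices
  exact (hT.isDemand hcd hv hG ⟨J, hE⟩).eqOn hv hE.convex_q (hT'.isDemand hcd hv hG ⟨J, hE⟩)

/-- The profit function is an upper envelope of L-Lipschitz functions of the firm type. -/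
theorem lipschitzOnWith_value {L : NNReal} {p q T : ℝ → ℝ}
    (hL : ∀ z ∈ Icc c d, LipschitzOnWith L (fun x => v x z) (Icc a b))
    (hT : ∀ x ∈ Icc a b, T x ∈ Icc c d)
    (hf : ∀ x ∈ Icc a b, ∀ z ∈ Icc c d, v x z ≤ p x + q z)
    (heq : ∀ x ∈ Icc a b, p x + q (T x) = v x (T x)) : LipschitzOnWith L p (Icc a b) := by
  refine LipschitzOnWith.of_le_add_mul _ fun x hx y hy => ?_
  have h1 := hf y hy _ (hT x hx)
  have h2 := heq x hx
  have h3 := (hL _ (hT x hx)).dist_le_mul x hx y hy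
  rw [Real.dist_eq] at h3
  have := (abs_le.1 h3).2
  linarith

/-- Continuous demand that clears the market is an equilibrium matching. -/
theorem isEquilibriumMatching_of_isDemand (hab : a < b) (hcd : c < d)
    (hv : IsProductionFunction (Icc a b) (Icc c d) v) (hF : IsTypeDistribution (Icc a b) F)
    (hTc : Continuous T) (hTm : ∀ x, T x ∈ Icc c d) {K : NNReal}
    (hq : ConvexOn ℝ (Icc c d) q) (hK : LipschitzOnWith K q (Icc c d))
    (hT : IsDemand (Icc a b) (Icc c d) v q T) (hmaj : Majorizes c d (F.map T) G)
    (hbal : ∫ x, q (T x) ∂F = ∫ y, q y ∂G) : IsEquilibriumMatching a b c d v F G T := by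
  have := hF.isProbabilityMeasure
  have hgr : Continuous fun x => (x, T x) := by fun_prop
  set J : Measure (ℝ × ℝ) := F.map fun x => (x, T x) with hJ
  have hJp : IsProbabilityMeasure J := Measure.isProbabilityMeasure_map hgr.aemeasurable
  have hfst : J.fst = F := by
    rw [Measure.fst, hJ, Measure.map_map measurable_fst hgr.measurable]
    exact Measure.map_id
  have hsnd : J.snd = F.map T := by
    rw [Measure.snd, hJ, Measure.map_map measurable_snd hgr.measurable]
    rfl
  have hcomp : IsCompact ((fun x => (x, T x)) '' Icc a b) := isCompact_Icc.image hgr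
  have hsupp : J.support = (fun x => (x, T x)) '' Icc a b := by
    apply Subset.antisymm
    · refine Measure.support_subset_of_isClosed hcomp.isClosed (mem_ae_iff.2 ?_)
      rw [hJ, Measure.map_apply hgr.measurable hcomp.isClosed.measurableSet.compl]
      exact measure_mono_null (fun x hx hx' => hx ⟨x, hx', rfl⟩) hF.measure_compl
    -- A neighbourhood of a point of the graph pulls back to a neighbourhood of `x`, to which `F`
    -- gives mass because its density is positive.
    · rintro _ ⟨x, hx, rfl⟩
      refine (Measure.mem_support_iff_forall _).2 fun U hU => ?_
      obtain ⟨O, hOU, hO, hxO⟩ := mem_nhds_iff.1 hU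
      refine lt_of_lt_of_le ?_ (measure_mono hOU)
      rw [hJ, Measure.map_apply hgr.measurable hO.measurableSet]
      exact hF.measure_pos hab hx (mem_nhdsWithin_of_mem_nhds
        (hgr.continuousAt.preimage_mem_nhds (hO.mem_nhds hxO)))
  have hqm : AEStronglyMeasurable q (F.map T) :=
    (integrable_of_continuousOn_Icc (a := c) (b := d) (by
      rw [Measure.map_apply hTc.measurable measurableSet_Icc.compl]
      rw [show T ⁻¹' (Icc c d)ᶜ = ∅ from eq_empty_of_forall_notMem fun x hx => hx (hTm x)]
      simp) hK.continuousOn).1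
  obtain ⟨L, -, hL⟩ := hv.exists_lipschitz hab hcd
  have hfeas : ∀ x ∈ Icc a b, ∀ z ∈ Icc c d, v x z ≤ (v x (T x) - q (T x)) + q z :=
    fun x hx z hz => by linarith [(hT x hx).2 z hz]
  refine ⟨J, fun x => v x (T x) - q (T x), q, ⟨⟨hJp, ?_, hfst, hsnd ▸ hmaj⟩, ⟨L, ?_⟩, ⟨K, hK⟩,
    ?_, hfeas, hq, ?_⟩, hsupp⟩
  · rw [hJ, Measure.map_apply hgr.measurable (measurableSet_Icc.prod measurableSet_Icc).compl]
    exact measure_mono_null (fun x hx hx' => hx ⟨hx', hTm x⟩) hF.measure_compl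
  · exact lipschitzOnWith_value hL (fun x hx => hTm x) hfeas fun x _ => by ring
  · rw [hsupp]
    rintro _ ⟨x, hx, rfl⟩
    ring
  · rw [hsnd, integral_map hTc.aemeasurable hqm, hbal]

end Duality

/-! ### Continuity of unique maximizers. -/

section Argmax

/-- The graph of the argmax correspondence is closed, and projection along a compact factor is a
closed map, so preimages of closed sets are closed. -/
theorem continuous_of_unique_argmax {P Z : Type*} [TopologicalSpace P] [TopologicalSpace Z]
    [CompactSpace Z] {u : P → Z → ℝ} (hu : Continuous (Function.uncurry u)) {τ : P → Z}
    (hmax : ∀ p z, u p z ≤ u p (τ p))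
    (huniq : ∀ p z, (∀ z', u p z' ≤ u p z) → z = τ p) : Continuous τ := by
  rw [continuous_iff_isClosed]
  intro C hC
  have h1 : IsClosed {w : P × Z | ∀ z', u w.1 z' ≤ u w.1 w.2} := by
    rw [ofPred_forall]
    refine isClosed_iInter fun z' => isClosed_le ?_ ?_
    · exact hu.comp (by fun_prop : Continuous fun w : P × Z => (w.1, z'))
    · exact hu
  have h2 : τ ⁻¹' C = Prod.fst '' ({w : P × Z | ∀ z', u w.1 z' ≤ u w.1 w.2} ∩ Prod.snd ⁻¹' C) := by
    ext p
    constructor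
    · intro hp
      exact ⟨(p, τ p), ⟨hmax p, hp⟩, rfl⟩
    · rintro ⟨⟨p', z⟩, ⟨hw, hz⟩, rfl⟩
      rw [mem_preimage, ← huniq p' z hw]
      exact hz
  rw [h2]
  exact isClosedMap_fst_of_compactSpace _ (h1.inter (hC.preimage continuous_snd))

theorem IsDemand.continuousOn (hv : IsProductionFunction (Icc a b) (Icc c d) v)
    (hq : ConvexOn ℝ (Icc c d) q) (hqc : ContinuousOn q (Icc c d))
    (hT : IsDemand (Icc a b) (Icc c d) v q T) : ContinuousOn T (Icc a b) := by
  rw [continuousOn_iff_continuous_domRestrict]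
  have := continuous_of_unique_argmax (P := Icc a b) (Z := Icc c d)
    (u := fun x z => v x z - q z) (τ := fun x => ⟨T x, (hT x x.2).1⟩) ?_
    (fun x z => (hT x x.2).2 z z.2) (fun x z h => Subtype.ext
      (hv.eq_of_isMaxOn hq x.2 z.2 (hT x x.2).1 (fun s hs => h ⟨s, hs⟩) (hT x x.2).2))
  · exact continuous_subtype_val.comp this
  · refine Continuous.sub ?_ ?_
    · exact hv.continuousOn.comp_continuous (f := fun w : Icc a b × Icc c d => ((w.1 : ℝ), (w.2 : ℝ)))
        (by fun_prop) (fun w => ⟨w.1.2, w.2.2⟩)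
    · exact hqc.comp_continuous (f := fun w : Icc a b × Icc c d => (w.2 : ℝ)) (by fun_prop)
        (fun w => w.2.2)

end Argmax
end ManyToOne

namespace ManyToOne

variable {a b c d : ℝ} {v : ℝ → ℝ → ℝ} {F G : Measure ℝ} {p q T ρ : ℝ → ℝ}

/-! ### Comparative statics through the lattice of wage slopes. -/

section ComparativeStatics

/-- The profit of firm type `x` when the wage schedule starts at `0` and has slope `ρ`. -/
noncomputable def slopeProfit (c d : ℝ) (v : ℝ → ℝ → ℝ) (ρ : ℝ → ℝ) (x : ℝ) : ℝ :=
  v x c + ∫ t in c..d, max (partialZ (Icc c d) v x t - ρ t) 0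

theorem IsProductionFunction.antitoneOn_net
    (hv : IsProductionFunction (Icc a b) (Icc c d) v) (hρ : Monotone ρ) {x : ℝ}
    (hx : x ∈ Icc a b) : AntitoneOn (fun t => partialZ (Icc c d) v x t - ρ t) (Icc c d) :=
  fun _ hs _ ht hst => sub_le_sub ((hv.strictAntiOn_partialZ hx).antitoneOn hs ht hst) (hρ hst)

theorem IsProductionFunction.intervalIntegrable_net
    (hv : IsProductionFunction (Icc a b) (Icc c d) v) (hρ : Monotone ρ) {x y z : ℝ}
    (hx : x ∈ Icc a b) (hy : y ∈ Icc c d) (hz : z ∈ Icc c d) :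
    IntervalIntegrable (fun t => partialZ (Icc c d) v x t - ρ t) volume y z :=
  ((hv.antitoneOn_net hρ hx).mono (ordConnected_Icc.uIcc_subset hy hz)).intervalIntegrable

theorem IsProductionFunction.intervalIntegrable_posPart_net
    (hv : IsProductionFunction (Icc a b) (Icc c d) v) (hρ : Monotone ρ) {x y z : ℝ}
    (hx : x ∈ Icc a b) (hy : y ∈ Icc c d) (hz : z ∈ Icc c d) :
    IntervalIntegrable (fun t => max (partialZ (Icc c d) v x t - ρ t) 0) volume y z := by
  have : AntitoneOn (fun t => max (partialZ (Icc c d) v x t - ρ t) 0) (Icc c d) :=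
    fun _ hs _ ht hst => max_le_max (hv.antitoneOn_net hρ hx hs ht hst) le_rfl
  exact (this.mono (ordConnected_Icc.uIcc_subset hy hz)).intervalIntegrable

theorem IsProductionFunction.integral_net (hab : a < b) (hcd : c < d)
    (hv : IsProductionFunction (Icc a b) (Icc c d) v) (hρ : Monotone ρ) {x z : ℝ}
    (hx : x ∈ Icc a b) (hz : z ∈ Icc c d) :
    ∫ t in c..z, (partialZ (Icc c d) v x t - ρ t) = v x z - v x c - ∫ t in c..z, ρ t := by
  have hc : c ∈ Icc c d := left_mem_Icc.2 hcd.le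
  rw [intervalIntegral.integral_sub _ hρ.intervalIntegrable,
    hv.integral_partialZ hab hcd hx hc hz hz.1]
  refine ContinuousOn.intervalIntegrable ?_
  exact (continuousOn_slice_snd (hv.continuousOn_partialZ hab hcd) hx).mono
    (ordConnected_Icc.uIcc_subset hc hz)

theorem IsProductionFunction.le_slopeProfit (hab : a < b) (hcd : c < d)
    (hv : IsProductionFunction (Icc a b) (Icc c d) v) (hρ : Monotone ρ) {x z : ℝ}
    (hx : x ∈ Icc a b) (hz : z ∈ Icc c d) :
    v x z ≤ slopeProfit c d v ρ x + ∫ t in c..z, ρ t := by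
  have hc : c ∈ Icc c d := left_mem_Icc.2 hcd.le
  have hd : d ∈ Icc c d := right_mem_Icc.2 hcd.le
  have h1 := hv.integral_net hab hcd hρ hx hz
  have h2 := intervalIntegral.integral_mono_on hz.1 (hv.intervalIntegrable_net hρ hx hc hz)
    (hv.intervalIntegrable_posPart_net hρ hx hc hz) (fun t _ => le_max_left _ 0)
  have h3 := intervalIntegral.integral_add_adjacent_intervals
    (hv.intervalIntegrable_posPart_net hρ hx hc hz) (hv.intervalIntegrable_posPart_net hρ hx hz hd)
  have h4 : 0 ≤ ∫ t in z..d, max (partialZ (Icc c d) v x t - ρ t) 0 :=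
    intervalIntegral.integral_nonneg hz.2 fun t _ => le_max_right _ _
  unfold slopeProfit
  linarith

/-- The net return v_z - ρ is decreasing, so stopping where it changes sign collects exactly the
integral of its positive part. -/
theorem IsProductionFunction.exists_eq_slopeProfit (hab : a < b) (hcd : c < d)
    (hv : IsProductionFunction (Icc a b) (Icc c d) v) (hρ : Monotone ρ) {x : ℝ}
    (hx : x ∈ Icc a b) :
    ∃ z ∈ Icc c d, slopeProfit c d v ρ x + ∫ t in c..z, ρ t = v x z := by
  have hc : c ∈ Icc c d := left_mem_Icc.2 hcd.le
  have hd : d ∈ Icc c d := right_mem_Icc.2 hcd.le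
  set k : ℝ → ℝ := fun t => partialZ (Icc c d) v x t - ρ t with hk
  have hanti : AntitoneOn k (Icc c d) := hv.antitoneOn_net hρ hx
  -- Adding `c` keeps the set nonempty when the net return is never positive; the best choice is
  -- then the corner `c`.
  set S : Set ℝ := insert c {t | t ∈ Icc c d ∧ 0 < k t} with hS
  have hSsub : S ⊆ Icc c d := insert_subset hc fun t ht => ht.1
  have hbdd : BddAbove S := bddAbove_Icc.mono hSsub
  have hne : S.Nonempty := ⟨c, mem_insert _ _⟩
  have hz : sSup S ∈ Icc c d := ⟨le_csSup hbdd (mem_insert _ _), csSup_le hne fun t ht => (hSsub ht).2⟩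
  set z := sSup S with hzdef
  refine ⟨z, hz, ?_⟩
  have h1 := hv.integral_net hab hcd hρ hx hz
  have h3 := intervalIntegral.integral_add_adjacent_intervals
    (hv.intervalIntegrable_posPart_net hρ hx hc hz) (hv.intervalIntegrable_posPart_net hρ hx hz hd)
  have h4 : ∫ t in z..d, max (k t) 0 = 0 := by
    rw [intervalIntegral.integral_congr_Ioo_of_le (g := fun _ => 0) hz.2]
    · simp
    · intro t ht
      have : ¬ 0 < k t := fun hpos => absurd
        (le_csSup hbdd (mem_insert_of_mem _ ⟨⟨hz.1.trans ht.1.le, ht.2.le⟩, hpos⟩))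
        (not_le.2 ht.1)
      exact max_eq_right (not_lt.1 this)
  have h5 : ∫ t in c..z, max (k t) 0 = ∫ t in c..z, k t := by
    refine intervalIntegral.integral_congr_Ioo_of_le hz.1 fun t ht => ?_
    obtain ⟨s, hs, hts⟩ := exists_lt_of_lt_csSup hne ht.2
    rcases mem_insert_iff.1 hs with rfl | hs
    · exact absurd hts (not_lt.2 ht.1.le)
    · exact max_eq_left (hs.2.le.trans (hanti ⟨ht.1.le, hts.le.trans hs.1.2⟩ hs.1 hts.le))
  unfold slopeProfit
  simp only [hk] at h4 h5
  linarith

theorem IsProductionFunction.continuousOn_slopeProfit (hab : a < b) (hcd : c < d)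
    (hv : IsProductionFunction (Icc a b) (Icc c d) v) (hρ : Monotone ρ) :
    ContinuousOn (slopeProfit c d v ρ) (Icc a b) := by
  obtain ⟨L, -, hL⟩ := hv.exists_lipschitz hab hcd
  choose! T hT hTeq using fun x (hx : x ∈ Icc a b) => hv.exists_eq_slopeProfit hab hcd hρ hx
  exact (lipschitzOnWith_value (q := fun z => ∫ t in c..z, ρ t) hL hT
    (fun x hx z hz => hv.le_slopeProfit hab hcd hρ hx hz) hTeq).continuousOn

/-- At each skill level the minimum and the maximum are the two slopes in some order, and the
integrand depends on the slope at that level only. This modularity drives the comparative statics.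
-/
theorem IsProductionFunction.slopeProfit_min_add_max (hcd : c < d)
    (hv : IsProductionFunction (Icc a b) (Icc c d) v) {ρ' : ℝ → ℝ} (hρ : Monotone ρ)
    (hρ' : Monotone ρ') {x : ℝ} (hx : x ∈ Icc a b) :
    slopeProfit c d v (fun t => min (ρ t) (ρ' t)) x + slopeProfit c d v (fun t => max (ρ t) (ρ' t)) x
      = slopeProfit c d v ρ x + slopeProfit c d v ρ' x := by
  have hc : c ∈ Icc c d := left_mem_Icc.2 hcd.le
  have hd : d ∈ Icc c d := right_mem_Icc.2 hcd.le
  have h : ∀ {σ : ℝ → ℝ}, Monotone σ → IntervalIntegrable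
      (fun t => max (partialZ (Icc c d) v x t - σ t) 0) volume c d :=
    fun hσ => hv.intervalIntegrable_posPart_net hσ hx hc hd
  have e : (∫ t in c..d, max (partialZ (Icc c d) v x t - min (ρ t) (ρ' t)) 0) +
      (∫ t in c..d, max (partialZ (Icc c d) v x t - max (ρ t) (ρ' t)) 0) =
      (∫ t in c..d, max (partialZ (Icc c d) v x t - ρ t) 0) +
      ∫ t in c..d, max (partialZ (Icc c d) v x t - ρ' t) 0 := by
    rw [← intervalIntegral.integral_add (h (hρ.min hρ')) (h (hρ.max hρ')),
      ← intervalIntegral.integral_add (h hρ) (h hρ')]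
    congr 1
    ext t
    rcases le_total (ρ t) (ρ' t) with h | h
    · rw [min_eq_left h, max_eq_right h]
    · rw [min_eq_right h, max_eq_left h, add_comm]
  unfold slopeProfit
  linarith

theorem integral_min_add_max {ρ' : ℝ → ℝ} (hρ : Monotone ρ) (hρ' : Monotone ρ') (c z : ℝ) :
    (∫ t in c..z, min (ρ t) (ρ' t)) + (∫ t in c..z, max (ρ t) (ρ' t)) =
      (∫ t in c..z, ρ t) + ∫ t in c..z, ρ' t := by
  rw [← intervalIntegral.integral_add (hρ.min hρ').intervalIntegrable
    (hρ.max hρ').intervalIntegrable, ← intervalIntegral.integral_add hρ.intervalIntegrable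
    hρ'.intervalIntegrable]
  simp only [min_add_max]

theorem monotoneOn_integral_sub {ρ' : ℝ → ℝ} (hρ : Monotone ρ) (hρ' : Monotone ρ')
    (hle : ∀ t ∈ Icc c d, ρ' t ≤ ρ t) :
    MonotoneOn (fun z => (∫ t in c..z, ρ t) - ∫ t in c..z, ρ' t) (Icc c d) := by
  intro y hy z hz hyz
  have h1 := monotone_integral_sub_integral hρ c y z
  have h2 := monotone_integral_sub_integral hρ' c y z
  have h3 := intervalIntegral.integral_mono_on hyz hρ'.intervalIntegrable hρ.intervalIntegrable
    (μ := volume) (fun t ht => hle t ⟨hy.1.trans ht.1, ht.2.trans hz.2⟩)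
  simp only
  linarith

/-- For r' ≤ r the function w ↦ (w - r')⁺ - (w - r)⁺ is increasing, and w = v_z(x, t) increases in
x. Better firms gain more from flatter wages. -/
theorem IsProductionFunction.monotoneOn_slopeProfit_sub (hab : a < b) (hcd : c < d)
    (hv : IsProductionFunction (Icc a b) (Icc c d) v) {ρ' : ℝ → ℝ} (hρ : Monotone ρ)
    (hρ' : Monotone ρ') (hle : ∀ t, ρ' t ≤ ρ t) :
    MonotoneOn (fun x => slopeProfit c d v ρ' x - slopeProfit c d v ρ x) (Icc a b) := by
  intro x hx y hy hxy
  have hc : c ∈ Icc c d := left_mem_Icc.2 hcd.le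
  have hd : d ∈ Icc c d := right_mem_Icc.2 hcd.le
  have h : ∀ {σ : ℝ → ℝ} {x : ℝ}, Monotone σ → x ∈ Icc a b → IntervalIntegrable
      (fun t => max (partialZ (Icc c d) v x t - σ t) 0) volume c d :=
    fun hσ hx => hv.intervalIntegrable_posPart_net hσ hx hc hd
  have key := intervalIntegral.integral_mono_on hcd.le ((h hρ' hx).sub (h hρ hx))
    ((h hρ' hy).sub (h hρ hy)) (fun t ht => by
      have h1 := hv.monotoneOn_partialZ hab hcd ht hx hy hxy
      have h2 := hle t
      simp only at h1
      rcases max_cases (partialZ (Icc c d) v x t - ρ' t) 0 with h3 | h3 <;>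
      rcases max_cases (partialZ (Icc c d) v x t - ρ t) 0 with h4 | h4 <;>
      rcases max_cases (partialZ (Icc c d) v y t - ρ' t) 0 with h5 | h5 <;>
      rcases max_cases (partialZ (Icc c d) v y t - ρ t) 0 with h6 | h6 <;> linarith)
  rw [intervalIntegral.integral_sub (h hρ' hx) (h hρ hx),
    intervalIntegral.integral_sub (h hρ' hy) (h hρ hy)] at key
  simp only [slopeProfit]
  linarith

/-- Prices written through a slope function. -/
theorem IsEquilibriumMatching.exists_slope (hab : a < b) (hcd : c < d)
    (hv : IsProductionFunction (Icc a b) (Icc c d) v) (hG : IsTypeDistribution (Icc c d) G)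
    (hT : IsEquilibriumMatching a b c d v F G T) (hpq : IsEquilibriumPrices a b c d v F G p q) :
    ∃ ρ : ℝ → ℝ, Monotone ρ ∧ (∀ z ∈ Icc c d, q z = q c + ∫ t in c..z, ρ t) ∧
      ∀ x ∈ Icc a b, p x = slopeProfit c d v ρ x - q c := by
  obtain ⟨J, hE⟩ := id hpq
  obtain ⟨K, hK⟩ := hE.lipschitz_q
  obtain ⟨ρ, hρ, hqρ⟩ := exists_monotone_integral hcd hE.convex_q hK
  refine ⟨ρ, hρ, hqρ, fun x hx => le_antisymm ?_ ?_⟩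
  · have h1 := hT.eq_of_prices hcd hv hG hpq x hx
    have h2 := hv.le_slopeProfit hab hcd hρ hx (hT.mapsTo x hx)
    have h3 := hqρ _ (hT.mapsTo x hx)
    linarith
  · obtain ⟨z, hz, h1⟩ := hv.exists_eq_slopeProfit hab hcd hρ hx
    have h2 := hE.no_entry x hx z hz
    have h3 := hqρ z hz
    linarith

theorem integral_eq_add_const_of_eqOn {μ : Measure ℝ} [IsProbabilityMeasure μ]
    (h : μ (Icc a b)ᶜ = 0) {f g : ℝ → ℝ} {k : ℝ} (hg : ContinuousOn g (Icc a b))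
    (hfg : ∀ x ∈ Icc a b, f x = g x + k) : ∫ x, f x ∂μ = ∫ x, g x ∂μ + k := by
  have : ∫ x, f x ∂μ = ∫ x, (g x + k) ∂μ := by
    refine integral_congr_ae ?_
    filter_upwards [ae_mem_Icc h] with x hx using hfg x hx
  rw [this, integral_add (integrable_of_continuousOn_Icc h hg) (integrable_const _)]
  simp

theorem integral_add_eq_of_eqOn {μ : Measure ℝ} [IsProbabilityMeasure μ]
    (h : μ (Icc a b)ᶜ = 0) {f g f' g' : ℝ → ℝ} (hf : ContinuousOn f (Icc a b))
    (hg : ContinuousOn g (Icc a b)) (hf' : ContinuousOn f' (Icc a b))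
    (hg' : ContinuousOn g' (Icc a b)) (hfg : ∀ x ∈ Icc a b, f x + g x = f' x + g' x) :
    ∫ x, f x ∂μ + ∫ x, g x ∂μ = ∫ x, f' x ∂μ + ∫ x, g' x ∂μ := by
  rw [← integral_add (integrable_of_continuousOn_Icc h hf) (integrable_of_continuousOn_Icc h hg),
    ← integral_add (integrable_of_continuousOn_Icc h hf') (integrable_of_continuousOn_Icc h hg')]
  refine integral_congr_ae ?_
  filter_upwards [ae_mem_Icc h] with x hx using hfg x hx

/-- Stochastically worse firms and better workers raise the equilibrium matching. -/
theorem IsEquilibriumMatching.le_of_dominance (hab : a < b) (hcd : c < d)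
    (hv : IsProductionFunction (Icc a b) (Icc c d) v) {Fh Gh : Measure ℝ} {Th : ℝ → ℝ}
    (hF : IsTypeDistribution (Icc a b) F) (hFh : IsTypeDistribution (Icc a b) Fh)
    (hG : IsTypeDistribution (Icc c d) G) (hGh : IsTypeDistribution (Icc c d) Gh)
    (hFF : ∀ x ∈ Icc a b, cdf F x ≤ cdf Fh x) (hGG : ∀ y ∈ Icc c d, cdf Gh y ≤ cdf G y)
    (hT : IsEquilibriumMatching a b c d v F G T) (hTh : IsEquilibriumMatching a b c d v Fh Gh Th) :
    ∀ x ∈ Icc a b, T x ≤ Th x := by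
  have := hF.isProbabilityMeasure
  have := hFh.isProbabilityMeasure
  have := hG.isProbabilityMeasure
  have := hGh.isProbabilityMeasure
  obtain ⟨p, q, hpq⟩ := hT.exists_prices
  obtain ⟨ph, qh, hpqh⟩ := hTh.exists_prices
  obtain ⟨ρ, hρ, hq, hp⟩ := hT.exists_slope hab hcd hv hG hpq
  obtain ⟨ρh, hρh, hqh, hph⟩ := hTh.exists_slope hab hcd hv hGh hpqh
  set m : ℝ → ℝ := fun t => min (ρ t) (ρh t) with hm
  set M : ℝ → ℝ := fun t => max (ρ t) (ρh t) with hM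
  have hmm : Monotone m := hρ.min hρh
  have hMm : Monotone M := hρ.max hρh
  have hPc : ∀ {σ : ℝ → ℝ}, Monotone σ → ContinuousOn (slopeProfit c d v σ) (Icc a b) :=
    fun hσ => hv.continuousOn_slopeProfit hab hcd hσ
  have hWL : ∀ {σ : ℝ → ℝ}, Monotone σ →
      ∃ K, LipschitzOnWith K (fun z => ∫ t in c..z, σ t) (Icc c d) :=
    fun hσ => monotone_exists_lipschitzOn_integral hσ c d
  have hWc : ∀ {σ : ℝ → ℝ}, Monotone σ → ContinuousOn (fun z => ∫ t in c..z, σ t) (Icc c d) :=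
    fun hσ => let ⟨_, hK⟩ := hWL hσ; hK.continuousOn
  obtain ⟨KM, hKM⟩ := hWL hMm
  obtain ⟨Km, hKm⟩ := hWL hmm
  obtain ⟨J, hE⟩ := id hpq
  -- The maximum of the two slopes is feasible for the problem (F, G), where ρ is optimal. By
  -- modularity this bounds the cost of the minimum by that of ρh, still under (F, G).
  have hdual := hE.dual_le hcd hv hG (hPc hMm) (monotone_convexOn_integral hMm c d) hKM
    (fun x hx z hz => hv.le_slopeProfit hab hcd hMm hx hz)
  rw [integral_eq_add_const_of_eqOn hF.measure_compl (f := p) (hPc hρ) (k := -q c)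
      (fun x hx => by rw [hp x hx]; ring),
    integral_eq_add_const_of_eqOn hG.measure_compl (f := q) (hWc hρ) (k := q c)
      (fun z hz => by rw [hq z hz]; ring)] at hdual
  have hmodF := integral_add_eq_of_eqOn hF.measure_compl (hPc hmm) (hPc hMm) (hPc hρ) (hPc hρh)
    (fun x hx => hv.slopeProfit_min_add_max hcd hρ hρh hx)
  have hmodG := integral_add_eq_of_eqOn hG.measure_compl (hWc hmm) (hWc hMm) (hWc hρ) (hWc hρh)
    (fun z _ => integral_min_add_max hρ hρh c z)
  -- Passing from ρh down to the minimum raises profits by an increasing function of x and lowers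
  -- wages by an increasing function of z, so dominance moves the bound from (F, G) to (Fh, Gh).
  have hdomF := integral_le_of_cdf_le hab.le hF.measure_compl hFh.measure_compl hFF
    ((hPc hmm).sub (hPc hρh))
    (hv.monotoneOn_slopeProfit_sub hab hcd hρh hmm fun t => min_le_right _ _)
  have hdomG := integral_le_of_cdf_le hcd.le hGh.measure_compl hG.measure_compl hGG
    ((hWc hρh).sub (hWc hmm)) (monotoneOn_integral_sub hρh hmm fun t _ => min_le_right _ _)
  have hi : ∀ {μ : Measure ℝ} [IsProbabilityMeasure μ] {σ : ℝ → ℝ}, μ (Icc a b)ᶜ = 0 →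
      Monotone σ → Integrable (slopeProfit c d v σ) μ :=
    fun hμ hσ => integrable_of_continuousOn_Icc hμ (hPc hσ)
  have hj : ∀ {μ : Measure ℝ} [IsProbabilityMeasure μ] {σ : ℝ → ℝ}, μ (Icc c d)ᶜ = 0 →
      Monotone σ → Integrable (fun z => ∫ t in c..z, σ t) μ :=
    fun hμ hσ => integrable_of_continuousOn_Icc hμ (hWc hσ)
  simp only [Pi.sub_apply] at hdomF hdomG
  rw [integral_sub (hi hFh.measure_compl hmm) (hi hFh.measure_compl hρh),
    integral_sub (hi hF.measure_compl hmm) (hi hF.measure_compl hρh)] at hdomF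
  rw [integral_sub (hj hG.measure_compl hρh) (hj hG.measure_compl hmm),
    integral_sub (hj hGh.measure_compl hρh) (hj hGh.measure_compl hmm)] at hdomG
  have hle : ∫ x, slopeProfit c d v m x ∂Fh + ∫ z, (∫ t in c..z, m t) ∂Gh ≤
      ∫ x, ph x ∂Fh + ∫ z, qh z ∂Gh := by
    rw [integral_eq_add_const_of_eqOn hFh.measure_compl (f := ph) (hPc hρh) (k := -qh c)
        (fun x hx => by rw [hph x hx]; ring),
      integral_eq_add_const_of_eqOn hGh.measure_compl (f := qh) (hWc hρh) (k := qh c)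
        (fun z hz => by rw [hqh z hz]; ring)]
    linarith
  have hfeas : ∀ x ∈ Icc a b, ∀ z ∈ Icc c d, v x z ≤ slopeProfit c d v m x + ∫ t in c..z, m t :=
    fun x hx z hz => hv.le_slopeProfit hab hcd hmm hx hz
  have heq := hTh.eq_of_dual_le hcd hv hGh hpqh (hPc hmm) (monotone_convexOn_integral hmm c d) hKm
    hfeas hle
  -- The minimum is now optimal for (Fh, Gh), so `Th` is demand at its wages; these are no steeper
  -- than those of ρ.
  refine IsDemand.le_of_monotoneOn_sub hv (monotone_convexOn_integral hmm c d)
    (hT.isDemand hcd hv hG hpq) (isDemand_of_eq hTh.mapsTo hfeas heq) ?_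
  intro y hy z hz hyz
  have := monotoneOn_integral_sub hρ hmm (fun t _ => min_le_left _ _) hy hz hyz
  simp only at this ⊢
  rw [hq y hy, hq z hz]
  linarith

end ComparativeStatics
end ManyToOne

namespace ManyToOne

variable {a b c d : ℝ} {v : ℝ → ℝ → ℝ} {F G : Measure ℝ} {p q T : ℝ → ℝ}

/-! ### Existence: minimizing the dual cost and its first-order condition. -/

section Existence

/-- The maximal profit of firm type `x` at wages `q`. -/
noncomputable def maxProfit (Y : Set ℝ) (v : ℝ → ℝ → ℝ) (q : ℝ → ℝ) (x : ℝ) : ℝ :=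
  sSup ((fun z => v x z - q z) '' Y)

/-- The dual objective: total profits plus total wages. -/
noncomputable def dualCost (Y : Set ℝ) (v : ℝ → ℝ → ℝ) (F G : Measure ℝ) (q : ℝ → ℝ) : ℝ :=
  ∫ x, maxProfit Y v q x ∂F + ∫ y, q y ∂G

theorem IsProductionFunction.exists_maxProfit_eq (hcd : c < d)
    (hv : IsProductionFunction (Icc a b) (Icc c d) v) (hq : ContinuousOn q (Icc c d)) {x : ℝ}
    (hx : x ∈ Icc a b) : ∃ z ∈ Icc c d, maxProfit (Icc c d) v q x + q z = v x z ∧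
      ∀ s ∈ Icc c d, v x s - q s ≤ v x z - q z := by
  obtain ⟨z, hz, h1, h2⟩ := isCompact_Icc.exists_sSup_image_eq_and_ge (nonempty_Icc.2 hcd.le)
    ((continuousOn_slice_snd hv.continuousOn hx).sub hq)
  refine ⟨z, hz, ?_, h2⟩
  have h1 : maxProfit (Icc c d) v q x = v x z - q z := h1
  linarith

theorem IsProductionFunction.le_maxProfit (hcd : c < d)
    (hv : IsProductionFunction (Icc a b) (Icc c d) v) (hq : ContinuousOn q (Icc c d)) {x z : ℝ}
    (hx : x ∈ Icc a b) (hz : z ∈ Icc c d) : v x z ≤ maxProfit (Icc c d) v q x + q z := by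
  obtain ⟨z', -, h1, h2⟩ := hv.exists_maxProfit_eq hcd hq hx
  linarith [h2 z hz]

theorem IsProductionFunction.continuousOn_maxProfit (hab : a < b) (hcd : c < d)
    (hv : IsProductionFunction (Icc a b) (Icc c d) v) (hq : ContinuousOn q (Icc c d)) :
    ContinuousOn (maxProfit (Icc c d) v q) (Icc a b) := by
  obtain ⟨L, -, hL⟩ := hv.exists_lipschitz hab hcd
  choose! T hT hTeq _ using fun x (hx : x ∈ Icc a b) => hv.exists_maxProfit_eq hcd hq hx
  exact (lipschitzOnWith_value hL hT (fun x hx z hz => hv.le_maxProfit hcd hq hx hz)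
    hTeq).continuousOn

theorem IsProductionFunction.maxProfit_le_add (hcd : c < d)
    (hv : IsProductionFunction (Icc a b) (Icc c d) v) (hq : ContinuousOn q (Icc c d))
    {q' : ℝ → ℝ} (hq' : ContinuousOn q' (Icc c d)) {x k : ℝ} (hx : x ∈ Icc a b)
    (hk : ∀ z ∈ Icc c d, q' z ≤ q z + k) :
    maxProfit (Icc c d) v q x ≤ maxProfit (Icc c d) v q' x + k := by
  obtain ⟨z, hz, h1, -⟩ := hv.exists_maxProfit_eq hcd hq hx
  linarith [hv.le_maxProfit hcd hq' hx hz, hk z hz]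

theorem integral_le_add_const {μ : Measure ℝ} [IsProbabilityMeasure μ] (h : μ (Icc a b)ᶜ = 0)
    {f g : ℝ → ℝ} {k : ℝ} (hf : ContinuousOn f (Icc a b)) (hg : ContinuousOn g (Icc a b))
    (hfg : ∀ x ∈ Icc a b, f x ≤ g x + k) : ∫ x, f x ∂μ ≤ ∫ x, g x ∂μ + k := by
  rw [← integral_eq_add_const_of_eqOn h hg (f := fun x => g x + k) fun x _ => rfl]
  refine integral_mono_ae (integrable_of_continuousOn_Icc h hf)
    (integrable_of_continuousOn_Icc h (hg.add continuousOn_const)) ?_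
  filter_upwards [ae_mem_Icc h] with x hx using hfg x hx

theorem dualCost_le_add (hab : a < b) (hcd : c < d)
    (hv : IsProductionFunction (Icc a b) (Icc c d) v) (hF : IsTypeDistribution (Icc a b) F)
    (hG : IsTypeDistribution (Icc c d) G) (hq : ContinuousOn q (Icc c d))
    {q' : ℝ → ℝ} (hq' : ContinuousOn q' (Icc c d)) {k : ℝ}
    (hk : ∀ z ∈ Icc c d, |q z - q' z| ≤ k) :
    dualCost (Icc c d) v F G q ≤ dualCost (Icc c d) v F G q' + 2 * k := by
  have := hF.isProbabilityMeasure
  have := hG.isProbabilityMeasure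
  have h1 := integral_le_add_const hF.measure_compl (hv.continuousOn_maxProfit hab hcd hq)
    (hv.continuousOn_maxProfit hab hcd hq') (k := k) (fun x hx =>
      hv.maxProfit_le_add hcd hq hq' hx fun z hz => by linarith [(abs_le.1 (hk z hz)).1])
  have h2 := integral_le_add_const hG.measure_compl hq hq' (k := k)
    fun z hz => by linarith [(abs_le.1 (hk z hz)).2]
  unfold dualCost
  linarith

/-- A constant added to wages comes off every profit, and both distributions have mass one. Wages
may hence be normalized to vanish at `c`. -/
theorem dualCost_le_of_shift (hab : a < b) (hcd : c < d)
    (hv : IsProductionFunction (Icc a b) (Icc c d) v) (hF : IsTypeDistribution (Icc a b) F)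
    (hG : IsTypeDistribution (Icc c d) G) (hq : ContinuousOn q (Icc c d))
    {q' : ℝ → ℝ} (hq' : ContinuousOn q' (Icc c d)) {k : ℝ}
    (hk : ∀ z ∈ Icc c d, q z = q' z + k) :
    dualCost (Icc c d) v F G q ≤ dualCost (Icc c d) v F G q' := by
  have := hF.isProbabilityMeasure
  have := hG.isProbabilityMeasure
  have h1 := integral_le_add_const hF.measure_compl (hv.continuousOn_maxProfit hab hcd hq)
    (hv.continuousOn_maxProfit hab hcd hq') (k := -k) (fun x hx =>
      hv.maxProfit_le_add hcd hq hq' hx fun z hz => by linarith [hk z hz])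
  have h2 := integral_le_add_const hG.measure_compl hq hq' (k := k)
    fun z hz => (hk z hz).le
  unfold dualCost
  linarith

-- Normalized convex L-Lipschitz wages form a compact set by Arzelà–Ascoli, on which the dual cost
-- is 2-Lipschitz in the uniform norm.
open BoundedContinuousFunction in
theorem exists_minimizer_lipschitz (hab : a < b) (hcd : c < d)
    (hv : IsProductionFunction (Icc a b) (Icc c d) v) (hF : IsTypeDistribution (Icc a b) F)
    (hG : IsTypeDistribution (Icc c d) G) (L : NNReal) :
    ∃ q : ℝ → ℝ, ConvexOn ℝ (Icc c d) q ∧ LipschitzOnWith L q (Icc c d) ∧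
      ∀ q' : ℝ → ℝ, ConvexOn ℝ (Icc c d) q' → LipschitzOnWith L q' (Icc c d) →
        dualCost (Icc c d) v F G q ≤ dualCost (Icc c d) v F G q' := by
  set e : (Icc c d →ᵇ ℝ) → ℝ → ℝ := fun g => IccExtend hcd.le g with he
  have hec : ∀ g, ContinuousOn (e g) (Icc c d) := fun g => g.continuous.Icc_extend'.continuousOn
  have heval : ∀ g, ∀ z (hz : z ∈ Icc c d), e g z = g ⟨z, hz⟩ := fun g z hz =>
    IccExtend_of_mem hcd.le _ hz
  have hcmem : c ∈ Icc c d := left_mem_Icc.2 hcd.le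
  set A : Set (Icc c d →ᵇ ℝ) :=
    {g | ConvexOn ℝ (Icc c d) (e g) ∧ LipschitzWith L g ∧ g ⟨c, hcmem⟩ = 0} with hA
  have hbound : ∀ (g : Icc c d →ᵇ ℝ) (x : Icc c d), g ∈ A →
      g x ∈ Icc (-(L * (d - c))) (L * (d - c)) := by
    intro g x hg
    have h := hg.2.1.dist_le_mul x ⟨c, hcmem⟩
    rw [hg.2.2, Real.dist_eq, sub_zero] at h
    have h1 : dist x ⟨c, hcmem⟩ ≤ d - c := by
      rw [Subtype.dist_eq, Real.dist_eq]
      change |(x : ℝ) - c| ≤ d - c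
      rw [abs_of_nonneg (by linarith [x.2.1])]
      linarith [x.2.2]
    exact abs_le.1 (h.trans (mul_le_mul_of_nonneg_left h1 L.coe_nonneg))
  have hev : ∀ x : Icc c d, Continuous fun g : Icc c d →ᵇ ℝ => g x := fun x =>
    continuous_eval_const x
  have hclosed : IsClosed A := by
    have h1 : IsClosed {g : Icc c d →ᵇ ℝ | ConvexOn ℝ (Icc c d) (e g)} := by
      have : {g : Icc c d →ᵇ ℝ | ConvexOn ℝ (Icc c d) (e g)} =
          ⋂ (u : ℝ) (_ : u ∈ Icc c d) (w : ℝ) (_ : w ∈ Icc c d) (α : ℝ) (β : ℝ) (_ : 0 ≤ α)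
            (_ : 0 ≤ β) (_ : α + β = 1),
            {g | e g (α • u + β • w) ≤ α • e g u + β • e g w} := by
        ext g
        simp only [mem_iInter]
        exact ⟨fun h u hu w hw α β hα hβ hαβ => h.2 hu hw hα hβ hαβ,
          fun h => ⟨convex_Icc c d, fun u hu w hw α β hα hβ hαβ => h u hu w hw α β hα hβ hαβ⟩⟩
      rw [this]
      refine isClosed_iInter fun u => isClosed_iInter fun hu => isClosed_iInter fun w =>
        isClosed_iInter fun hw => isClosed_iInter fun α => isClosed_iInter fun β =>
        isClosed_iInter fun hα => isClosed_iInter fun hβ => isClosed_iInter fun hαβ => ?_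
      exact isClosed_le (hev _) (((hev _).const_smul α).add ((hev _).const_smul β))
    have h2 : IsClosed {g : Icc c d →ᵇ ℝ | LipschitzWith L g} := by
      have : {g : Icc c d →ᵇ ℝ | LipschitzWith L g} =
          ⋂ (x : Icc c d) (y : Icc c d), {g | dist (g x) (g y) ≤ L * dist x y} := by
        ext g
        simp only [mem_iInter]
        exact lipschitzWith_iff_dist_le_mul
      rw [this]
      exact isClosed_iInter fun x => isClosed_iInter fun y =>
        isClosed_le ((hev x).dist (hev y)) continuous_const
    have h3 : IsClosed {g : Icc c d →ᵇ ℝ | g ⟨c, hcmem⟩ = 0} :=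
      isClosed_eq (hev _) continuous_const
    exact h1.inter (h2.inter h3)
  have hcomp : IsCompact A := by
    refine arzela_ascoli₂ _ isCompact_Icc A hclosed hbound ?_
    exact (LipschitzWith.uniformEquicontinuous _ L fun g => g.2.2.1).equicontinuous
  have hne : A.Nonempty := ⟨0, by
    refine ⟨?_, LipschitzWith.const' 0, rfl⟩
    have : e 0 = fun _ => 0 := by ext x; rfl
    rw [this]
    exact convexOn_const 0 (convex_Icc c d)⟩
  have hcont : Continuous fun g => dualCost (Icc c d) v F G (e g) := by
    refine (LipschitzWith.of_le_add_mul (2 : NNReal) fun g g' => ?_).continuous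
    refine dualCost_le_add hab hcd hv hF hG (hec g) (hec g') fun z hz => ?_
    rw [heval g z hz, heval g' z hz, ← Real.dist_eq]
    exact BoundedContinuousFunction.dist_coe_le_dist _
  obtain ⟨g, hg, hmin⟩ := hcomp.exists_isMinOn hne hcont.continuousOn
  refine ⟨e g, hg.1, ?_, fun q' hq' hL' => ?_⟩
  · intro x hx y hy
    rw [heval g x hx, heval g y hy]
    exact hg.2.1 ⟨x, hx⟩ ⟨y, hy⟩
  · have hq'c := hL'.continuousOn
    set g' : Icc c d →ᵇ ℝ := BoundedContinuousFunction.mkOfCompact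
      ⟨fun z => q' z - q' c, (continuousOn_iff_continuous_domRestrict.1 hq'c).sub
        continuous_const⟩ with hg'
    have heg' : ∀ z ∈ Icc c d, e g' z = q' z + -q' c := fun z hz => by
      rw [heval g' z hz]
      exact sub_eq_add_neg _ _
    have hmem : g' ∈ A := by
      refine ⟨?_, ?_, ?_⟩
      · exact (hq'.add (convexOn_const (-q' c) (convex_Icc c d))).congr
          fun z hz => (heg' z hz).symm
      · refine LipschitzWith.of_dist_le_mul fun x y => ?_
        have := hL'.dist_le_mul x x.2 y y.2
        rw [Real.dist_eq] at this ⊢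
        have e1 : g' x - g' y = q' x - q' y := by
          change (q' x - q' c) - (q' y - q' c) = _
          ring
        rw [e1]
        exact this
      · change q' c - q' c = 0
        ring
    exact (hmin hmem).trans (dualCost_le_of_shift hab hcd hv hF hG (hec g') hq'c heg')

/-- The inf-convolution of `q` with `L |·|` on the interval `[c, d]`. -/
noncomputable def infConv (L c d : ℝ) (q : ℝ → ℝ) (z : ℝ) : ℝ :=
  sInf ((fun y => q y + L * |z - y|) '' Icc c d)

theorem exists_infConv_eq {L : ℝ} (hcd : c < d) (hq : ContinuousOn q (Icc c d)) (z : ℝ) :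
    ∃ y ∈ Icc c d, infConv L c d q z = q y + L * |z - y| ∧
      ∀ s ∈ Icc c d, infConv L c d q z ≤ q s + L * |z - s| := by
  obtain ⟨y, hy, h1, h2⟩ := isCompact_Icc.exists_sInf_image_eq_and_le (nonempty_Icc.2 hcd.le)
    (hq.add (by fun_prop : ContinuousOn (fun y => L * |z - y|) (Icc c d)))
  exact ⟨y, hy, h1, fun s hs => h1.le.trans (h2 s hs)⟩

theorem lipschitzWith_infConv {L : NNReal} (hcd : c < d) (hq : ContinuousOn q (Icc c d)) :
    LipschitzWith L (infConv L c d q) := by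
  refine LipschitzWith.of_le_add_mul _ fun x y => ?_
  obtain ⟨s, hs, h1, -⟩ := exists_infConv_eq (L := L) hcd hq y
  obtain ⟨-, -, -, h2⟩ := exists_infConv_eq (L := L) hcd hq x
  have h3 := h2 s hs
  have h4 : |x - s| ≤ |y - s| + |x - y| := by
    have := abs_sub_le x y s; linarith
  have h5 := mul_le_mul_of_nonneg_left h4 L.2
  rw [Real.dist_eq]
  simp only [NNReal.val_eq_coe] at h5
  linarith

theorem convexOn_infConv {L : ℝ} (hL : 0 ≤ L) (hcd : c < d) (hqc : ContinuousOn q (Icc c d))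
    (hq : ConvexOn ℝ (Icc c d) q) : ConvexOn ℝ (Icc c d) (infConv L c d q) := by
  refine ⟨convex_Icc c d, fun u _ w _ α β hα hβ hαβ => ?_⟩
  obtain ⟨s, hs, h1, -⟩ := exists_infConv_eq (L := L) hcd hqc u
  obtain ⟨t, ht, h2, -⟩ := exists_infConv_eq (L := L) hcd hqc w
  obtain ⟨-, -, -, h3⟩ := exists_infConv_eq (L := L) hcd hqc (α • u + β • w)
  have h4 := h3 _ (convex_Icc c d hs ht hα hβ hαβ)
  have h5 := hq.2 hs ht hα hβ hαβ
  simp only [smul_eq_mul] at *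
  have h6 : |α * u + β * w - (α * s + β * t)| ≤ α * |u - s| + β * |w - t| := by
    have : α * u + β * w - (α * s + β * t) = α * (u - s) + β * (w - t) := by ring
    rw [this]
    refine (abs_add_le _ _).trans ?_
    rw [abs_mul, abs_mul, abs_of_nonneg hα, abs_of_nonneg hβ]
  have h7 := mul_le_mul_of_nonneg_left h6 hL
  rw [h1, h2]
  linarith

/-- With L a Lipschitz constant of v in the skill, inf-convolution with L|·| lowers wages without
raising profits: wherever it attains q(y) + L|z - y| at z, hiring y instead loses at most L|z - y|
of output. The Lipschitz constraint on competitors is thus harmless. -/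
theorem exists_minimizer (hab : a < b) (hcd : c < d)
    (hv : IsProductionFunction (Icc a b) (Icc c d) v) (hF : IsTypeDistribution (Icc a b) F)
    (hG : IsTypeDistribution (Icc c d) G) :
    ∃ (q : ℝ → ℝ) (L : NNReal), ConvexOn ℝ (Icc c d) q ∧ LipschitzOnWith L q (Icc c d) ∧
      ∀ q' : ℝ → ℝ, ConvexOn ℝ (Icc c d) q' → ContinuousOn q' (Icc c d) →
        dualCost (Icc c d) v F G q ≤ dualCost (Icc c d) v F G q' := by
  have := hF.isProbabilityMeasure
  have := hG.isProbabilityMeasure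
  obtain ⟨L, hL, -⟩ := hv.exists_lipschitz hab hcd
  obtain ⟨q, hq, hqL, hmin⟩ := exists_minimizer_lipschitz hab hcd hv hF hG L
  refine ⟨q, L, hq, hqL, fun q' hq' hqc' => ?_⟩
  have hlip := (lipschitzWith_infConv (L := L) hcd hqc').lipschitzOnWith (s := Icc c d)
  refine (hmin _ (convexOn_infConv L.coe_nonneg hcd hqc' hq') hlip).trans ?_
  have h1 := integral_le_add_const hF.measure_compl (k := 0)
    (hv.continuousOn_maxProfit hab hcd hlip.continuousOn)
    (hv.continuousOn_maxProfit hab hcd hqc') (fun x hx => by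
      obtain ⟨z, hz, h1, -⟩ := hv.exists_maxProfit_eq hcd hlip.continuousOn hx
      obtain ⟨y, hy, h2, -⟩ := exists_infConv_eq (L := L) hcd hqc' z
      have h3 := hv.le_maxProfit hcd hqc' hx hy
      have h4 := (hL x hx).dist_le_mul z hz y hy
      rw [Real.dist_eq, Real.dist_eq] at h4
      have h5 := (abs_le.1 h4).2
      linarith)
  have h2 := integral_le_add_const hG.measure_compl (k := 0) hlip.continuousOn hqc'
    (fun z hz => by
      obtain ⟨-, -, -, h2⟩ := exists_infConv_eq (L := L) hcd hqc' z
      have := h2 z hz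
      simpa using this)
  unfold dualCost
  linarith

theorem convexOn_posPart_sub (k : ℝ) : ConvexOn ℝ (Icc c d) fun y => max (k - y) 0 := by
  have h : ConvexOn ℝ (Icc c d) fun y => k - y :=
    (convexOn_const k (convex_Icc c d)).sub (concaveOn_id (convex_Icc c d))
  exact h.sup (convexOn_const 0 (convex_Icc c d))

/-- First-order condition for a minimizer of the dual objective. -/
theorem exists_demand_of_minimizer (hab : a < b) (hcd : c < d)
    (hv : IsProductionFunction (Icc a b) (Icc c d) v) (hF : IsTypeDistribution (Icc a b) F)
    (hG : IsTypeDistribution (Icc c d) G) (hq : ConvexOn ℝ (Icc c d) q)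
    (hqc : ContinuousOn q (Icc c d))
    (hmin : ∀ q' : ℝ → ℝ, ConvexOn ℝ (Icc c d) q' → ContinuousOn q' (Icc c d) →
        dualCost (Icc c d) v F G q ≤ dualCost (Icc c d) v F G q') :
    ∃ T : ℝ → ℝ, Continuous T ∧ (∀ x, T x ∈ Icc c d) ∧ IsDemand (Icc a b) (Icc c d) v q T ∧
      ∀ h : ℝ → ℝ, ContinuousOn h (Icc c d) →
        (∀ ε ∈ Icc (0 : ℝ) 1, ConvexOn ℝ (Icc c d) fun z => q z + ε * h z) →
        ∫ x, h (T x) ∂F ≤ ∫ y, h y ∂G := by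
  have := hF.isProbabilityMeasure
  have := hG.isProbabilityMeasure
  have hdem : ∃ T : ℝ → ℝ, IsDemand (Icc a b) (Icc c d) v q T := by
    choose! T hT _ hTm using fun x (hx : x ∈ Icc a b) => hv.exists_maxProfit_eq hcd hqc hx
    exact ⟨T, fun x hx => ⟨hT x hx, hTm x hx⟩⟩
  obtain ⟨T₀, hT₀⟩ := hdem
  have hT₀c := hT₀.continuousOn hv hq hqc
  -- Extending the demand by constants outside [a, b] makes it continuous on the line, so the image
  -- of `F` under it is well behaved.
  refine ⟨fun x => T₀ (projIcc a b hab.le x), ?_, fun x => (hT₀ _ (projIcc a b hab.le x).2).1, ?_, ?_⟩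
  · exact hT₀c.comp_continuous (by fun_prop) fun x => (projIcc a b hab.le x).2
  · intro x hx
    simp only [projIcc_of_mem hab.le hx]
    exact hT₀ x hx
  intro h hc hconv
  have hpc : ∀ ε : ℝ, ContinuousOn (fun z => q z + ε * h z) (Icc c d) := fun ε =>
    hqc.add (continuousOn_const.mul hc)
  have hex : ∀ w : Icc a b × Icc (0 : ℝ) 1, ∃ z : Icc c d, ∀ s : Icc c d,
      v w.1 s - (q s + w.2 * h s) ≤ v w.1 z - (q z + w.2 * h z) := by
    intro w
    obtain ⟨z, hz, -, h2⟩ := hv.exists_maxProfit_eq hcd (hpc w.2) w.1.2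
    exact ⟨⟨z, hz⟩, fun s => h2 s s.2⟩
  -- The maximizer at wages q + εh, jointly in firm type and ε. Convexity of every perturbed wage
  -- makes it unique and therefore continuous in both.
  choose τ hτ using hex
  have hτc : Continuous τ := by
    refine continuous_of_unique_argmax
      (u := fun (w : Icc a b × Icc (0 : ℝ) 1) (z : Icc c d) => v w.1 z - (q z + w.2 * h z))
      ?_ hτ fun w z hz => Subtype.ext ?_
    · refine Continuous.sub ?_ (Continuous.add ?_ (Continuous.mul (by fun_prop) ?_))
      · exact hv.continuousOn.comp_continuous
          (f := fun w : (Icc a b × Icc (0 : ℝ) 1) × Icc c d => ((w.1.1 : ℝ), (w.2 : ℝ)))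
          (by fun_prop) (fun w => ⟨w.1.1.2, w.2.2⟩)
      · exact hqc.comp_continuous (f := fun w : (Icc a b × Icc (0 : ℝ) 1) × Icc c d => (w.2 : ℝ))
          (by fun_prop) (fun w => w.2.2)
      · exact hc.comp_continuous (f := fun w : (Icc a b × Icc (0 : ℝ) 1) × Icc c d => (w.2 : ℝ))
          (by fun_prop) (fun w => w.2.2)
    · exact hv.eq_of_isMaxOn (hconv w.2 w.2.2) w.1.2 z.2 (τ w).2 (fun s hs => hz ⟨s, hs⟩)
        (fun s hs => hτ w ⟨s, hs⟩)
  set k : ℝ → ℝ → ℝ := fun ε x =>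
    h (τ (projIcc a b hab.le x, projIcc 0 1 zero_le_one ε)) with hk
  have hkc : Continuous (Function.uncurry k) := by
    refine hc.comp_continuous (f := fun w : ℝ × ℝ =>
      ((τ (projIcc a b hab.le w.2, projIcc 0 1 zero_le_one w.1) : Icc c d) : ℝ)) ?_
      (fun w => (τ _).2)
    exact continuous_subtype_val.comp (hτc.comp
      ((continuous_projIcc.comp continuous_snd).prodMk (continuous_projIcc.comp continuous_fst)))
  have hkx : ∀ ε, Continuous (k ε) := fun ε =>
    hkc.comp (by fun_prop : Continuous fun x : ℝ => (ε, x))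
  -- The perturbed profit is at most the old profit minus ε times h at the perturbed choice.
  -- Minimality of `q` and division by ε give the inequality; letting ε tend to 0 replaces that
  -- choice by the demand at `q`.
  have hpos : ∀ ε ∈ Ioc (0 : ℝ) 1, ∫ x, k ε x ∂F ≤ ∫ y, h y ∂G := by
    intro ε hε
    have hεm : ε ∈ Icc (0 : ℝ) 1 := Ioc_subset_Icc_self hε
    have h1 := hmin _ (hconv ε hεm) (hpc ε)
    have h2 : ∫ x, maxProfit (Icc c d) v (fun z => q z + ε * h z) x ∂F ≤
        ∫ x, (maxProfit (Icc c d) v q x - ε * k ε x) ∂F := by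
      refine integral_mono_ae (integrable_of_continuousOn_Icc hF.measure_compl
          (hv.continuousOn_maxProfit hab hcd (hpc ε)))
        (integrable_of_continuousOn_Icc hF.measure_compl
          ((hv.continuousOn_maxProfit hab hcd hqc).sub
            (continuousOn_const.mul (hkx ε).continuousOn))) ?_
      filter_upwards [ae_mem_Icc hF.measure_compl] with x hx
      have h3 := hτ (⟨x, hx⟩, ⟨ε, hεm⟩)
      set z := τ (⟨x, hx⟩, ⟨ε, hεm⟩)
      have h4 : k ε x = h z := by simp only [hk, projIcc_of_mem _ hx, projIcc_of_mem _ hεm, z]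
      obtain ⟨s, hs, h5, -⟩ := hv.exists_maxProfit_eq hcd (hpc ε) hx
      have h6 := h3 ⟨s, hs⟩
      have h7 := hv.le_maxProfit hcd hqc hx z.2
      rw [h4]
      simp only at h6
      linarith
    rw [integral_sub (integrable_of_continuousOn_Icc hF.measure_compl
        (hv.continuousOn_maxProfit hab hcd hqc))
      ((integrable_of_continuousOn_Icc hF.measure_compl (hkx ε).continuousOn).const_mul ε),
      integral_const_mul] at h2
    unfold dualCost at h1
    rw [integral_add (integrable_of_continuousOn_Icc hG.measure_compl hqc)
      ((integrable_of_continuousOn_Icc hG.measure_compl hc).const_mul ε),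
      integral_const_mul] at h1
    refine le_of_mul_le_mul_left ?_ hε.1
    linarith
  have h0 : ∫ x, h (T₀ (projIcc a b hab.le x)) ∂F = ∫ x, k 0 x ∂F := by
    congr 1
    ext x
    have h1 := hτ (projIcc a b hab.le x, ⟨0, by simp⟩)
    have h2 := hT₀ _ (projIcc a b hab.le x).2
    simp only [hk, projIcc_of_mem zero_le_one (show (0 : ℝ) ∈ Icc (0 : ℝ) 1 by simp)]
    congr 1
    refine hv.eq_of_isMaxOn hq (projIcc a b hab.le x).2 h2.1 (τ _).2 h2.2 fun s hs => ?_
    simpa using h1 ⟨s, hs⟩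
  rw [h0]
  obtain ⟨C, hC⟩ := isCompact_Icc.exists_bound_of_continuousOn hc
  have hlim : Filter.Tendsto (fun n : ℕ => ∫ x, k (1 / ((n : ℝ) + 1)) x ∂F) Filter.atTop
      (nhds (∫ x, k 0 x ∂F)) := by
    refine tendsto_integral_of_dominated_convergence (fun _ => C)
      (fun n => (hkx _).aestronglyMeasurable) (integrable_const _)
      (fun n => Filter.Eventually.of_forall fun x => hC _ (τ _).2)
      (Filter.Eventually.of_forall fun x => ?_)
    have : Continuous fun ε => k ε x := hkc.comp (by fun_prop : Continuous fun ε : ℝ => (ε, x))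
    exact (this.tendsto 0).comp tendsto_one_div_add_atTop_nhds_zero_nat
  refine le_of_tendsto' hlim fun n => hpos _ ⟨by positivity, ?_⟩
  rw [div_le_one (by positivity)]
  linarith [n.cast_nonneg (α := ℝ)]

/-- Each clearing condition is the first-order condition in one direction: q and -q balance the wage
bill, hinges give majorization, and an increasing affine function gives equality of means. -/
theorem exists_isEquilibriumMatching (hab : a < b) (hcd : c < d)
    (hv : IsProductionFunction (Icc a b) (Icc c d) v) (hF : IsTypeDistribution (Icc a b) F)
    (hG : IsTypeDistribution (Icc c d) G) : ∃ T, IsEquilibriumMatching a b c d v F G T := by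
  have := hF.isProbabilityMeasure
  have := hG.isProbabilityMeasure
  obtain ⟨q, L, hq, hL, hmin⟩ := exists_minimizer hab hcd hv hF hG
  obtain ⟨T, hTc, hTm, hT, hfoc⟩ :=
    exists_demand_of_minimizer hab hcd hv hF hG hq hL.continuousOn hmin
  have hscale : ∀ s : ℝ, 0 ≤ s → ConvexOn ℝ (Icc c d) fun z => s * q z := fun s hs => by
    simpa using hq.smul hs
  have hbal : ∫ x, q (T x) ∂F = ∫ y, q y ∂G := by
    refine le_antisymm (hfoc q hL.continuousOn fun ε hε => ?_) ?_
    · exact (hscale (1 + ε) (by linarith [hε.1])).congr fun z _ => by simp only; ring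
    -- The perturbed wage is (1 - ε)q, convex because ε ≤ 1; this is why perturbations are confined
    -- to [0, 1].
    · have := hfoc (fun z => -q z) hL.continuousOn.neg fun ε hε =>
        (hscale (1 - ε) (by linarith [hε.2])).congr fun z _ => by simp only; ring
      rw [integral_neg, integral_neg] at this
      linarith
  have hmp : IsProbabilityMeasure (F.map T) := Measure.isProbabilityMeasure_map hTc.aemeasurable
  have hmc : F.map T (Icc c d)ᶜ = 0 := by
    rw [Measure.map_apply hTc.measurable measurableSet_Icc.compl,
      show T ⁻¹' (Icc c d)ᶜ = ∅ from eq_empty_of_forall_notMem fun x hx => hx (hTm x)]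
    simp
  have hcdf : ∀ k, c ≤ k → ∫ t in c..k, cdf (F.map T) t = ∫ x, max (k - T x) 0 ∂F := by
    intro k hk
    rw [← integral_posPart_sub hmc hk, integral_map hTc.aemeasurable]
    exact (by fun_prop : Continuous fun y : ℝ => max (k - y) 0).aestronglyMeasurable
  have hle : ∀ y ∈ Icc c d, ∫ t in c..y, cdf (F.map T) t ≤ ∫ t in c..y, cdf G t := by
    intro y hy
    rw [hcdf y hy.1, ← integral_posPart_sub hG.measure_compl hy.1]
    refine hfoc (fun z => max (y - z) 0) (by fun_prop) fun ε hε => hq.add ?_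
    simpa using (convexOn_posPart_sub (c := c) (d := d) y).smul hε.1
  refine ⟨T, isEquilibriumMatching_of_isDemand hab hcd hv hF hTc hTm hq hL hT
    ⟨hle, le_antisymm (hle d (right_mem_Icc.2 hcd.le)) ?_⟩ hbal⟩
  have h1 := hfoc (fun z => -(d - z)) (by fun_prop) fun ε hε => hq.add ?_
  · rw [hcdf d hcd.le, ← integral_posPart_sub hG.measure_compl hcd.le]
    rw [integral_neg, integral_neg] at h1
    have e1 : ∫ x, max (d - T x) 0 ∂F = ∫ x, (d - T x) ∂F :=
      integral_congr_ae (Filter.Eventually.of_forall fun x =>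
        max_eq_left (by linarith [(hTm x).2]))
    have e2 : ∫ y, max (d - y) 0 ∂G = ∫ y, (d - y) ∂G := by
      refine integral_congr_ae ?_
      filter_upwards [ae_mem_Icc hG.measure_compl] with y hy
      exact max_eq_left (by linarith [hy.2])
    rw [e1, e2]
    linarith
  · refine convexOn_of_subgradient (m := fun _ => ε) (convex_Icc c d) fun y _ z _ => ?_
    linarith

end Existence
end ManyToOne

namespace ManyToOne

variable {a b c d : ℝ} {F G : Measure ℝ} {T : ℝ → ℝ}

/-! ### Quadratic examples for the converse implications. -/

section Quadratic

/-- A quadratic production function with complementarity parameter `K`. -/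
noncomputable def quadraticProduction (K x z : ℝ) : ℝ := K * x * z - z ^ 2 / 2

theorem partialX_quadraticProduction (hab : a < b) (K : ℝ) {x : ℝ} (hx : x ∈ Icc a b) (z : ℝ) :
    partialX (Icc a b) (quadraticProduction K) x z = K * z := by
  have h : HasDerivAt (fun s => quadraticProduction K s z) (K * 1 * z) x :=
    (((hasDerivAt_id x).const_mul K).mul_const z).sub_const _
  rw [partialX, h.hasDerivWithinAt.derivWithin (uniqueDiffOn_Icc hab x hx), mul_one]

theorem partialZ_quadraticProduction (hcd : c < d) (K x : ℝ) {z : ℝ} (hz : z ∈ Icc c d) :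
    partialZ (Icc c d) (quadraticProduction K) x z = K * x - z := by
  have h : HasDerivAt (fun s => quadraticProduction K x s) (K * x * 1 - 2 * z ^ 1 * 1 / 2) z :=
    ((hasDerivAt_id z).const_mul (K * x)).sub (((hasDerivAt_id z).pow 2).div_const 2)
  rw [partialZ, h.hasDerivWithinAt.derivWithin (uniqueDiffOn_Icc hcd z hz)]
  ring

theorem isProductionFunction_quadratic (hab : a < b) (hcd : c < d) {K : ℝ} (hK : 0 < K) :
    IsProductionFunction (Icc a b) (Icc c d) (quadraticProduction K) where
  contDiffOn := by
    have : ContDiff ℝ 2 (Function.uncurry (quadraticProduction K)) := by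
      unfold Function.uncurry quadraticProduction
      fun_prop
    exact this.contDiffOn
  increasing_differences x hx z hz := by
    have h : HasDerivAt (fun s => K * s) (K * 1) z := (hasDerivAt_id z).const_mul K
    rw [partialZ, derivWithin_congr (fun s _ => partialX_quadraticProduction hab K hx s)
      (partialX_quadraticProduction hab K hx z),
      h.hasDerivWithinAt.derivWithin (uniqueDiffOn_Icc hcd z hz)]
    linarith
  decreasing_returns x hx z hz := by
    have h : HasDerivAt (fun s => K * x - s) (-1) z := (hasDerivAt_id z).const_sub (K * x)
    rw [partialZ, derivWithin_congr (fun s hs => partialZ_quadraticProduction hcd K x hs)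
      (partialZ_quadraticProduction hcd K x hz),
      h.hasDerivWithinAt.derivWithin (uniqueDiffOn_Icc hcd z hz)]
    norm_num

theorem IsTypeDistribution.exists_cdf_eq {F : Measure ℝ} (hab : a < b)
    (hF : IsTypeDistribution (Icc a b) F) {r : ℝ} (hr : r ∈ Icc (0 : ℝ) 1) :
    ∃ x ∈ Icc a b, cdf F x = r := by
  have := intermediate_value_Icc hab.le (hF.continuousOn_cdf hab)
  rw [hF.cdf_left, hF.cdf_right] at this
  exact this hr

/-- If complementarities are strong enough, positive assortative matching without segregation of
skills within firms is an equilibrium matching. -/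
theorem isEquilibriumMatching_quadratic (hab : a < b) (hcd : c < d)
    (hF : IsTypeDistribution (Icc a b) F) (hG : IsTypeDistribution (Icc c d) G) {K : ℝ}
    (hK : 0 < K) (hTm : ∀ x ∈ Icc a b, T x ∈ Icc c d)
    (hcdf : ∀ x ∈ Icc a b, cdf G (T x) = cdf F x)
    (hlip : ∀ x ∈ Icc a b, ∀ y ∈ Icc a b, x ≤ y → T y - T x ≤ K * (y - x)) :
    IsEquilibriumMatching a b c d (quadraticProduction K) F G T := by
  have := hF.isProbabilityMeasure
  have := hG.isProbabilityMeasure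
  have hFm := hF.strictMonoOn_cdf hab
  have hGm := hG.strictMonoOn_cdf hcd
  have hmono : MonotoneOn T (Icc a b) := by
    intro x hx y hy hxy
    rw [← hGm.le_iff_le (hTm x hx) (hTm y hy), hcdf x hx, hcdf y hy]
    exact monotone_cdf F hxy
  have hTc : ContinuousOn T (Icc a b) := by
    refine (LipschitzOnWith.of_le_add_mul K.toNNReal fun x hx y hy => ?_).continuousOn
    rw [Real.coe_toNNReal _ hK.le, Real.dist_eq]
    rcases le_total x y with hxy | hxy
    · have := hmono hx hy hxy
      have := mul_nonneg hK.le (abs_nonneg (x - y))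
      linarith
    · rw [abs_of_nonneg (by linarith)]
      linarith [hlip y hy x hx hxy]
  -- The inverse of the matching: ξ(t) is the firm type with the same rank as worker type t.
  choose! ξ hξ hξF using fun t (_ : t ∈ Icc c d) =>
    hF.exists_cdf_eq hab ⟨cdf_nonneg G t, cdf_le_one G t⟩
  have hTξ : ∀ t ∈ Icc c d, T (ξ t) = t := fun t ht =>
    hGm.injOn (hTm _ (hξ t ht)) ht (by rw [hcdf _ (hξ t ht), hξF t ht])
  have hξT : ∀ x ∈ Icc a b, ξ (T x) = x := fun x hx =>
    hFm.injOn (hξ _ (hTm x hx)) hx (by rw [hξF _ (hTm x hx), hcdf x hx])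
  have hξm : MonotoneOn ξ (Icc c d) := by
    intro s hs t ht hst
    rw [← hFm.le_iff_le (hξ s hs) (hξ t ht), hξF s hs, hξF t ht]
    exact monotone_cdf G hst
  -- Forced by the first-order condition ρ(t) = v_z(ξ(t), t). It is monotone precisely because `T`
  -- grows at rate at most K.
  set ρ : ℝ → ℝ := fun t => K * ξ (projIcc c d hcd.le t) - projIcc c d hcd.le t with hρ
  have hρm : Monotone ρ := by
    intro s t hst
    have hst' : (projIcc c d hcd.le s : ℝ) ≤ projIcc c d hcd.le t := monotone_projIcc hcd.le hst
    have hs := (projIcc c d hcd.le s).2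
    have ht := (projIcc c d hcd.le t).2
    have h := hlip _ (hξ _ hs) _ (hξ _ ht) (hξm hs ht hst')
    rw [hTξ _ hs, hTξ _ ht] at h
    simp only [hρ]
    linarith
  set T' : ℝ → ℝ := fun x => T (projIcc a b hab.le x) with hT'
  have hT'c : Continuous T' :=
    hTc.comp_continuous (by fun_prop) fun x => (projIcc a b hab.le x).2
  have hT'm : ∀ x, T' x ∈ Icc c d := fun x => hTm _ (projIcc a b hab.le x).2
  have hT'T : ∀ x ∈ Icc a b, T' x = T x := fun x hx => by simp only [hT', projIcc_of_mem hab.le hx]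
  have hmap : F.map T' = G := by
    have hmp : IsProbabilityMeasure (F.map T') :=
      Measure.isProbabilityMeasure_map hT'c.aemeasurable
    refine Measure.eq_of_cdf _ _ ?_
    ext y
    have hy' : cdf (F.map T') y = F.real (T' ⁻¹' Iic y) := by
      rw [cdf_eq_real, measureReal_def, measureReal_def,
        Measure.map_apply hT'c.measurable measurableSet_Iic]
    rw [hy']
    by_cases hyc : y < c
    · rw [cdf_eq_zero_of_lt hG.measure_compl hyc,
        show T' ⁻¹' Iic y = ∅ from eq_empty_of_forall_notMem fun x hx =>
          absurd ((hT'm x).1.trans hx) (not_le.2 hyc)]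
      simp
    by_cases hyd : d ≤ y
    · rw [cdf_eq_one_of_le hG.measure_compl hyd,
        show T' ⁻¹' Iic y = univ from eq_univ_of_forall fun x => (hT'm x).2.trans hyd]
      simp
    have hy : y ∈ Icc c d := ⟨not_lt.1 hyc, (not_le.1 hyd).le⟩
    rw [← hξF y hy, cdf_eq_real, measureReal_def, measureReal_def]
    congr 1
    refine measure_congr ?_
    filter_upwards [ae_mem_Icc hF.measure_compl] with x hx
    refine propext ?_
    change T' x ≤ y ↔ x ≤ ξ y
    rw [hT'T x hx, ← hGm.le_iff_le (hTm x hx) hy, hcdf x hx, ← hξF y hy,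
      hFm.le_iff_le hx (hξ y hy)]
  obtain ⟨L, hL⟩ := monotone_exists_lipschitzOn_integral hρm c d
  have hdem : IsDemand (Icc a b) (Icc c d) (quadraticProduction K) (fun z => ∫ t in c..z, ρ t) T' := by
    intro x hx
    refine ⟨hT'm x, fun z hz => ?_⟩
    have h1 := monotone_mul_sub_le_integral hρm (T x) z
    have h2 := monotone_integral_sub_integral hρm c (T x) z
    have h3 : ρ (T x) = K * x - T x := by
      simp only [hρ, projIcc_of_mem hcd.le (hTm x hx), hξT x hx]
    rw [hT'T x hx]
    rw [h3] at h1
    simp only [quadraticProduction]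
    -- Here v(x, z) - v(x, Tx) = (Kx - Tx)(z - Tx) - (z - Tx)²/2, and the linear part is at most the
    -- change in wages.
    nlinarith [sq_nonneg (z - T x)]
  have hres : IsEquilibriumMatching a b c d (quadraticProduction K) F G T' := by
    refine isEquilibriumMatching_of_isDemand hab hcd (isProductionFunction_quadratic hab hcd hK) hF
      hT'c hT'm (monotone_convexOn_integral hρm c d) hL hdem ?_ ?_
    · rw [hmap]
      exact ⟨fun y _ => le_rfl, rfl⟩
    · conv_rhs => rw [← hmap]
      refine (integral_map (f := fun z => ∫ t in c..z, ρ t) hT'c.aemeasurable ?_).symm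
      rw [hmap]
      exact (integrable_of_continuousOn_Icc hG.measure_compl hL.continuousOn).1
  obtain ⟨J, p, q, hE, hs⟩ := hres
  exact ⟨J, p, q, hE, hs.trans (image_congr fun x hx => by rw [hT'T x hx])⟩

/-- The uniform distribution on `[a, b]`. -/
noncomputable def uniformDistribution (a b : ℝ) : Measure ℝ :=
  (volume.restrict (Icc a b)).withDensity fun _ => ENNReal.ofReal (1 / (b - a))

theorem uniformDistribution_apply {s : Set ℝ} (a b : ℝ) (hs : MeasurableSet s) :
    uniformDistribution a b s = ENNReal.ofReal (1 / (b - a)) * volume (s ∩ Icc a b) := by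
  rw [uniformDistribution, withDensity_const, Measure.smul_apply, Measure.restrict_apply hs,
    smul_eq_mul]

theorem isTypeDistribution_uniform (hab : a < b) :
    IsTypeDistribution (Icc a b) (uniformDistribution a b) where
  isProbabilityMeasure := ⟨by
    have h : 0 < b - a := sub_pos.2 hab
    rw [uniformDistribution_apply a b MeasurableSet.univ, univ_inter, Real.volume_Icc,
      ← ENNReal.ofReal_mul (by positivity), one_div, inv_mul_cancel₀ h.ne', ENNReal.ofReal_one]⟩
  exists_density := ⟨fun _ => 1 / (b - a), continuousOn_const,
    fun _ _ => by have h : 0 < b - a := sub_pos.2 hab; positivity, rfl⟩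

theorem cdf_uniformDistribution (hab : a < b) {x : ℝ} (hx : x ∈ Icc a b) :
    cdf (uniformDistribution a b) x = (x - a) / (b - a) := by
  have h : 0 < b - a := sub_pos.2 hab
  have := (isTypeDistribution_uniform hab).isProbabilityMeasure
  have e : Iic x ∩ Icc a b = Icc a x := by
    ext t
    exact ⟨fun ht => ⟨ht.2.1, ht.1⟩, fun ht => ⟨ht.2, ht.1, ht.2.trans hx.2⟩⟩
  rw [cdf_eq_real, measureReal_def, uniformDistribution_apply a b measurableSet_Iic, e,
    Real.volume_Icc, ← ENNReal.ofReal_mul (by positivity), ENNReal.toReal_ofReal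
      (mul_nonneg (by positivity) (by linarith [hx.1])), one_div, inv_mul_eq_div]

/-- Against uniform workers the assortative matching is an affine increasing function of the firms'
cdf, so comparing matchings compares cdfs. -/
theorem cdf_le_of_forall_matching_le (hab : a < b) (hcd : c < d) {Fh : Measure ℝ}
    (hF : IsTypeDistribution (Icc a b) F) (hFh : IsTypeDistribution (Icc a b) Fh)
    (h : ∀ (v : ℝ → ℝ → ℝ) (G : Measure ℝ) (T Th : ℝ → ℝ),
      IsProductionFunction (Icc a b) (Icc c d) v → IsTypeDistribution (Icc c d) G →
      IsEquilibriumMatching a b c d v F G T → IsEquilibriumMatching a b c d v Fh G Th →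
        ∀ x ∈ Icc a b, T x ≤ Th x) :
    ∀ x ∈ Icc a b, cdf F x ≤ cdf Fh x := by
  obtain ⟨_, M, _, hM, hFM⟩ := hF.exists_bounds hab
  obtain ⟨_, Mh, _, _, hFhM⟩ := hFh.exists_bounds hab
  have hdc : 0 < d - c := sub_pos.2 hcd
  -- The growth rate of c + (d - c)F is at most (d - c) times the bound on the density; one K must
  -- serve both distributions.
  set K : ℝ := (d - c) * max M Mh with hKdef
  have hK : 0 < K := mul_pos hdc (lt_max_of_lt_left hM)
  have key : ∀ (F : Measure ℝ) (M' : ℝ), IsTypeDistribution (Icc a b) F → M' ≤ max M Mh →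
      (∀ x ∈ Icc a b, ∀ y ∈ Icc a b, x ≤ y → cdf F y - cdf F x ≤ M' * (y - x)) →
      IsEquilibriumMatching a b c d (quadraticProduction K) F (uniformDistribution c d)
        fun x => c + (d - c) * cdf F x := by
    intro F M' hF hM' hb
    have hm : ∀ x, c + (d - c) * cdf F x ∈ Icc c d := fun x =>
      ⟨by linarith [mul_nonneg hdc.le (cdf_nonneg F x)],
        by linarith [mul_le_mul_of_nonneg_left (cdf_le_one F x) hdc.le]⟩
    refine isEquilibriumMatching_quadratic hab hcd hF (isTypeDistribution_uniform hcd) hK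
      (fun x _ => hm x) (fun x _ => ?_) fun x hx y hy hxy => ?_
    · rw [cdf_uniformDistribution hcd (hm x)]
      field_simp
      ring
    · have h1 := (hb x hx y hy hxy).trans
        (mul_le_mul_of_nonneg_right hM' (sub_nonneg.2 hxy))
      have h2 := mul_le_mul_of_nonneg_left h1 hdc.le
      rw [hKdef]
      linarith
  intro x hx
  have h1 := h _ _ _ _ (isProductionFunction_quadratic hab hcd hK) (isTypeDistribution_uniform hcd)
    (key F M hF (le_max_left _ _) fun x hx y hy hxy => (hFM x hx y hy hxy).2)
    (key Fh Mh hFh (le_max_right _ _) fun x hx y hy hxy => (hFhM x hx y hy hxy).2) x hx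
  exact le_of_mul_le_mul_left (by linarith) hdc

/-- With uniform firms the assortative matchings are the quantile functions of `G` and `Gh`, up to
rescaling the firm type. -/
theorem cdf_ge_of_forall_matching_le (hab : a < b) (hcd : c < d) {Gh : Measure ℝ}
    (hG : IsTypeDistribution (Icc c d) G) (hGh : IsTypeDistribution (Icc c d) Gh)
    (h : ∀ (v : ℝ → ℝ → ℝ) (F : Measure ℝ) (T Th : ℝ → ℝ),
      IsProductionFunction (Icc a b) (Icc c d) v → IsTypeDistribution (Icc a b) F →
      IsEquilibriumMatching a b c d v F G T → IsEquilibriumMatching a b c d v F Gh Th →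
        ∀ x ∈ Icc a b, T x ≤ Th x) :
    ∀ y ∈ Icc c d, cdf Gh y ≤ cdf G y := by
  obtain ⟨m, _, hm, _, hGm⟩ := hG.exists_bounds hcd
  obtain ⟨mh, _, hmh, _, hGhm⟩ := hGh.exists_bounds hcd
  have hba : 0 < b - a := sub_pos.2 hab
  have hmm : 0 < min m mh := lt_min hm hmh
  -- Quantile functions grow at most at the inverse of the smallest density, here rescaled by b - a,
  -- the length of the interval of firm types.
  set K : ℝ := 1 / ((b - a) * min m mh) with hKdef
  have hK : 0 < K := by positivity
  have hU := isTypeDistribution_uniform hab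
  have key : ∀ (G : Measure ℝ) (m' : ℝ), IsTypeDistribution (Icc c d) G → min m mh ≤ m' →
      (∀ x ∈ Icc c d, ∀ y ∈ Icc c d, x ≤ y → m' * (y - x) ≤ cdf G y - cdf G x) →
      ∃ T : ℝ → ℝ, IsEquilibriumMatching a b c d (quadraticProduction K)
        (uniformDistribution a b) G T ∧ (∀ x ∈ Icc a b, T x ∈ Icc c d) ∧
        ∀ x ∈ Icc a b, cdf G (T x) = cdf (uniformDistribution a b) x := by
    intro G m' hG hm' hb
    choose T hTm hT using fun x =>
      hG.exists_cdf_eq hcd ⟨cdf_nonneg (uniformDistribution a b) x, cdf_le_one _ x⟩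
    refine ⟨T, ?_, fun x _ => hTm x, fun x _ => hT x⟩
    refine isEquilibriumMatching_quadratic hab hcd hU hG hK (fun x _ => hTm x)
      (fun x _ => hT x) fun x hx y hy hxy => ?_
    have hTxy : T x ≤ T y := by
      rw [← (hG.strictMonoOn_cdf hcd).le_iff_le (hTm x) (hTm y), hT, hT]
      exact monotone_cdf _ hxy
    have h1 := hb _ (hTm x) _ (hTm y) hTxy
    rw [hT, hT, cdf_uniformDistribution hab hx, cdf_uniformDistribution hab hy, ← sub_div,
      le_div_iff₀ hba] at h1
    have h2 := mul_le_mul_of_nonneg_right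
      (mul_le_mul_of_nonneg_right hm' (sub_nonneg.2 hTxy)) hba.le
    rw [hKdef, one_div, inv_mul_eq_div, le_div_iff₀ (by positivity)]
    linarith
  obtain ⟨T, hT, hTm, hTG⟩ := key G m hG (min_le_left _ _)
    fun x hx y hy hxy => (hGm x hx y hy hxy).1
  obtain ⟨Th, hTh, hThm, hThG⟩ := key Gh mh hGh (min_le_right _ _)
    fun x hx y hy hxy => (hGhm x hx y hy hxy).1
  intro y hy
  obtain ⟨x, hx, hxy⟩ := hU.exists_cdf_eq hab ⟨cdf_nonneg G y, cdf_le_one G y⟩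
  have h1 := h _ _ _ _ (isProductionFunction_quadratic hab hcd hK) hU hT hTh x hx
  have h2 : T x = y :=
    (hG.strictMonoOn_cdf hcd).injOn (hTm x hx) hy (by rw [hTG x hx, hxy])
  rw [h2] at h1
  calc cdf Gh y ≤ cdf Gh (Th x) := monotone_cdf Gh h1
    _ = cdf G y := by rw [hThG x hx, hxy]

end Quadratic
end ManyToOne

namespace ManyToOne

variable {a b c d : ℝ} {v : ℝ → ℝ → ℝ} {F G : Measure ℝ} {J : Measure (ℝ × ℝ)} {p q T ρ : ℝ → ℝ}

/-! ### Envelope formula and absence of kinks in wages. -/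

section Prices

/-- Envelope theorem for the profit function. -/
theorem IsDemand.hasDerivWithinAt_profit (hab : a < b) (hcd : c < d)
    (hv : IsProductionFunction (Icc a b) (Icc c d) v) (hT : ∀ x ∈ Icc a b, T x ∈ Icc c d)
    (hTc : ContinuousOn T (Icc a b))
    (hf : ∀ x ∈ Icc a b, ∀ z ∈ Icc c d, v x z ≤ p x + q z)
    (heq : ∀ x ∈ Icc a b, p x + q (T x) = v x (T x)) {x : ℝ} (hx : x ∈ Icc a b) :
    HasDerivWithinAt p (partialX (Icc a b) v x (T x)) (Icc a b) x := by
  set A := partialX (Icc a b) v x (T x) with hA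
  rw [hasDerivWithinAt_iff_isLittleO, Asymptotics.isLittleO_iff]
  intro ε hε
  have hcx := hv.continuousOn_partialX hab hcd (x, T x) ⟨hx, hT x hx⟩
  obtain ⟨δ, hδ, hball⟩ := Metric.continuousWithinAt_iff.1 hcx ε hε
  obtain ⟨δ', hδ', hball'⟩ := Metric.continuousWithinAt_iff.1 (hTc x hx) δ hδ
  have hη : 0 < min δ δ' := lt_min hδ hδ'
  have hmem : Metric.ball x (min δ δ') ∩ Icc a b ∈ nhdsWithin x (Icc a b) :=
    Filter.inter_mem (mem_nhdsWithin_of_mem_nhds (Metric.ball_mem_nhds x hη)) self_mem_nhdsWithin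
  filter_upwards [hmem] with y hy
  have hxS : x ∈ Metric.ball x (min δ δ') ∩ Icc a b := ⟨Metric.mem_ball_self hη, hx⟩
  have hest : ∀ w ∈ Metric.ball x (min δ δ') ∩ Icc a b,
      |v y (T w) - v x (T w) - A * (y - x)| ≤ ε * |y - x| := by
    intro w hw
    have hTw := hT w hw.2
    have hderiv : ∀ s ∈ Metric.ball x (min δ δ') ∩ Icc a b, HasDerivWithinAt
        (fun s => v s (T w) - A * s) (partialX (Icc a b) v s (T w) - A * 1)
        (Metric.ball x (min δ δ') ∩ Icc a b) s := fun s hs =>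
      ((hv.hasDerivWithinAt_fst hs.2 hTw).mono inter_subset_right).sub
        ((hasDerivWithinAt_id s _).const_mul A)
    have hbd : ∀ s ∈ Metric.ball x (min δ δ') ∩ Icc a b,
        ‖partialX (Icc a b) v s (T w) - A * 1‖ ≤ ε := by
      intro s hs
      have h1 : dist s x < δ := lt_of_lt_of_le hs.1 (min_le_left _ _)
      have h2 : dist (T w) (T x) < δ := hball' hw.2 (lt_of_lt_of_le hw.1 (min_le_right _ _))
      have h3 := hball (x := (s, T w)) ⟨hs.2, hTw⟩ (max_lt h1 h2)
      rw [mul_one, ← dist_eq_norm]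
      exact h3.le
    have h := ((convex_ball x _).inter (convex_Icc a b)).norm_image_sub_le_of_norm_hasDerivWithin_le
      hderiv hbd hxS hy
    rw [Real.norm_eq_abs, Real.norm_eq_abs] at h
    convert h using 2
    ring
  -- Feasibility sandwiches p(y) - p(x) between v(y, ·) - v(x, ·) evaluated at T(x) and at T(y);
  -- both differ from A(y - x) by at most ε|y - x|.
  have h1 := abs_le.1 (hest x hxS)
  have h2 := abs_le.1 (hest y hy)
  have h3 := hf y hy.2 _ (hT x hx)
  have h4 := hf x hx _ (hT y hy.2)
  have h5 := heq x hx
  have h6 := heq y hy.2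
  rw [smul_eq_mul, Real.norm_eq_abs, Real.norm_eq_abs, abs_le]
  constructor <;> linarith

theorem IsCompetitiveEquilibrium.snd_eq_of_mem_support
    (hv : IsProductionFunction (Icc a b) (Icc c d) v)
    (hE : IsCompetitiveEquilibrium a b c d v F G J p q)
    (hT : IsDemand (Icc a b) (Icc c d) v q T) {w : ℝ × ℝ} (hw : w ∈ J.support) :
    w.1 ∈ Icc a b ∧ w.2 = T w.1 := by
  have hwb := hE.isAssignment.support_subset hw
  refine ⟨hwb.1, hv.eq_of_isMaxOn hE.convex_q hwb.1 hwb.2 (hT _ hwb.1).1 (fun s hs => ?_)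
    (hT _ hwb.1).2⟩
  have h1 := hE.eq_on_support w hw
  have h2 := hE.no_entry _ hwb.1 s hs
  linarith

theorem IsAssignment.exists_mem_support_of_pos {P : ℝ → Prop} (hm : MeasurableSet {z | P z})
    (hpos : 0 < J.snd {z | P z}) : ∃ w ∈ J.support, P w.2 := by
  rw [Measure.snd_apply hm] at hpos
  by_contra hcon
  push Not at hcon
  refine hpos.ne' (measure_mono_null (t := J.supportᶜ) (fun w hw hw' => hcon w hw' hw)
    Measure.measure_compl_support)

theorem IsTypeDistribution.eq_zero_of_integral_nonpos (hcd : c < d)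
    (hG : IsTypeDistribution (Icc c d) G) {g : ℝ → ℝ} (hg : ContinuousOn g (Icc c d))
    (h0 : ∀ z ∈ Icc c d, 0 ≤ g z) (hint : ∫ z, g z ∂G ≤ 0) : ∀ z ∈ Icc c d, g z = 0 := by
  have := hG.isProbabilityMeasure
  have hnn : 0 ≤ᵐ[G] g := by
    filter_upwards [ae_mem_Icc hG.measure_compl] with z hz using h0 z hz
  have hae := (integral_eq_zero_iff_of_nonneg_ae hnn
    (integrable_of_continuousOn_Icc hG.measure_compl hg)).1
    (le_antisymm hint (integral_nonneg_of_ae hnn))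
  intro z hz
  by_contra hne
  have hpos := hG.measure_pos hcd hz
    (hg z hz (Ioi_mem_nhds (lt_of_le_of_ne (h0 z hz) (Ne.symm hne))))
  refine hpos.ne' (measure_mono_null (fun y hy => ?_) (ae_iff.1 hae))
  exact ne_of_gt hy

theorem IsCompetitiveEquilibrium.integral_wage_le (hcd : c < d)
    (hG : IsTypeDistribution (Icc c d) G) (hE : IsCompetitiveEquilibrium a b c d v F G J p q)
    (hρ : Monotone ρ) :
    ∫ z, (∫ t in c..z, ρ t) ∂J.snd ≤ ∫ z, (∫ t in c..z, ρ t) ∂G := by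
  have := hE.isAssignment.isProbabilityMeasure_snd
  have := hG.isProbabilityMeasure
  obtain ⟨K, hK⟩ := monotone_exists_lipschitzOn_integral hρ c d
  exact integral_le_of_majorizes hcd hE.isAssignment.snd_compl hG.measure_compl
    hE.isAssignment.snd_majorizes (monotone_convexOn_integral hρ c d) hK

/-- At a kink of the wage function, the majorization constraint binds. -/
theorem IsCompetitiveEquilibrium.integral_cdf_le_of_kink (hcd : c < d)
    (hG : IsTypeDistribution (Icc c d) G) (hE : IsCompetitiveEquilibrium a b c d v F G J p q)
    (hρ : Monotone ρ) (hq : ∀ z ∈ Icc c d, q z = q c + ∫ t in c..z, ρ t) {z₀ l r : ℝ}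
    (hz₀ : z₀ ∈ Ioo c d) (hlr : l < r) (hl : ∀ t < z₀, ρ t ≤ l) (hr : ∀ t, z₀ < t → r ≤ ρ t) :
    ∫ t in c..z₀, cdf G t ≤ ∫ t in c..z₀, cdf J.snd t := by
  have := hE.isAssignment.isProbabilityMeasure_snd
  have := hG.isProbabilityMeasure
  -- Raising the slope left of z₀ by the size of the jump keeps it monotone. The new wage is q - (r
  -- - l)(z₀ - z)⁺ up to a constant, so majorization tested on it reverses the inequality for the
  -- hinge at z₀.
  set σ : ℝ → ℝ := fun t => if t < z₀ then ρ t + (r - l) else max (ρ t) r with hσ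
  have hσm : Monotone σ := by
    intro s t hst
    simp only [hσ]
    split_ifs with h1 h2 h2
    · linarith [hρ hst]
    · exact le_max_of_le_right (by linarith [hl s h1])
    · exact absurd (hst.trans_lt h2) h1
    · exact max_le_max (hρ hst) le_rfl
  have hprim : ∀ z ∈ Icc c d, ∫ t in c..z, σ t =
      (∫ t in c..z, ρ t) - (r - l) * max (z₀ - z) 0 + (r - l) * (z₀ - c) := by
    have hleft : ∀ z ∈ Icc c z₀, ∫ t in c..z, σ t = (∫ t in c..z, ρ t) + (r - l) * (z - c) := by
      intro z hz
      rw [intervalIntegral.integral_congr_Ioo_of_le (g := fun t => ρ t + (r - l)) hz.1,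
        intervalIntegral.integral_add hρ.intervalIntegrable (intervalIntegrable_const)]
      · rw [intervalIntegral.integral_const, smul_eq_mul, mul_comm]
      · intro t ht
        simp only [hσ, if_pos (ht.2.trans_le hz.2)]
    intro z hz
    rcases le_total z z₀ with h | h
    · rw [hleft z ⟨hz.1, h⟩, max_eq_left (by linarith)]
      ring
    · have h1 : ∫ t in z₀..z, σ t = ∫ t in z₀..z, ρ t := by
        refine intervalIntegral.integral_congr_Ioo_of_le h fun t ht => ?_
        simp only [hσ, if_neg (not_lt.2 ht.1.le)]
        exact max_eq_left (hr t ht.1)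
      have h2 := monotone_integral_sub_integral hσm c z₀ z
      have h3 := monotone_integral_sub_integral hρ c z₀ z
      have h4 := hleft z₀ ⟨hz₀.1.le, le_rfl⟩
      rw [max_eq_right (by linarith)]
      linarith
  have hmc : Continuous fun z : ℝ => max (z₀ - z) 0 := by fun_prop
  obtain ⟨K, hK⟩ := hE.lipschitz_q
  have hint : ∀ (μ : Measure ℝ) [IsProbabilityMeasure μ], μ (Icc c d)ᶜ = 0 →
      ∫ z, (∫ t in c..z, σ t) ∂μ = ∫ z, q z ∂μ - (r - l) * (∫ t in c..z₀, cdf μ t) +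
        ((r - l) * (z₀ - c) - q c) := by
    intro μ _ hμ
    rw [integral_eq_add_const_of_eqOn hμ (f := fun z => ∫ t in c..z, σ t)
      (g := fun z => q z - (r - l) * max (z₀ - z) 0) (k := (r - l) * (z₀ - c) - q c)
      (hK.continuousOn.sub (continuousOn_const.mul hmc.continuousOn))
      (fun z hz => by rw [hprim z hz, hq z hz]; ring),
      integral_sub (integrable_of_continuousOn_Icc hμ hK.continuousOn)
        ((integrable_of_continuousOn_Icc hμ hmc.continuousOn).const_mul _),
      integral_const_mul, integral_posPart_sub hμ hz₀.1.le]
  have h := hE.integral_wage_le hcd hG hσm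
  rw [hint _ hE.isAssignment.snd_compl, hint _ hG.measure_compl, hE.wages_balance] at h
  exact le_of_mul_le_mul_left (by linarith) (sub_pos.2 hlr)

/-- Where the majorization constraint binds in the interior, the distribution of mean skills
has no atom and agrees with the distribution of worker types. -/
theorem cdf_eq_of_binding {H : Measure ℝ} [IsProbabilityMeasure H] (hcd : c < d)
    (hG : IsTypeDistribution (Icc c d) G) (hmaj : Majorizes c d H G) {z₀ : ℝ}
    (hz₀ : z₀ ∈ Ioo c d) (hb : ∫ t in c..z₀, cdf G t ≤ ∫ t in c..z₀, cdf H t) :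
    cdf H z₀ ≤ cdf G z₀ ∧ cdf G z₀ ≤ H.real (Iio z₀) := by
  have := hG.isProbabilityMeasure
  have hGi : ∀ s t, IntervalIntegrable (cdf G) volume s t := fun s t =>
    (monotone_cdf G).intervalIntegrable
  have hHi : ∀ s t, IntervalIntegrable (cdf H) volume s t := fun s t =>
    (monotone_cdf H).intervalIntegrable
  have hz₀' : z₀ ∈ Icc c d := Ioo_subset_Icc_self hz₀
  have hcont := hG.continuousOn_cdf hcd z₀ hz₀'
  constructor
  · have key : ∀ y ∈ Ioo z₀ d, cdf H z₀ ≤ cdf G y := by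
      intro y hy
      have h1 := hmaj.1 y ⟨hz₀.1.le.trans hy.1.le, hy.2.le⟩
      have h2 := intervalIntegral.integral_add_adjacent_intervals (hGi c z₀) (hGi z₀ y)
      have h3 := intervalIntegral.integral_add_adjacent_intervals (hHi c z₀) (hHi z₀ y)
      have h4 := monotone_mul_sub_le_integral (monotone_cdf H) z₀ y
      have h5 := monotone_mul_sub_le_integral (monotone_cdf G) y z₀
      rw [intervalIntegral.integral_symm] at h5
      exact le_of_mul_le_mul_right (by linarith) (sub_pos.2 hy.1)
    have hc' : Filter.Tendsto (cdf G) (nhdsWithin z₀ (Ioi z₀)) (nhds (cdf G z₀)) :=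
      (hcont.continuousAt (Icc_mem_nhds hz₀.1 hz₀.2)).continuousWithinAt
    refine ge_of_tendsto hc' ?_
    filter_upwards [Ioo_mem_nhdsGT hz₀.2] with y hy using key y hy
  -- On the left the same minimum controls only the left limit of the cdf of `H`, hence the open
  -- ray; together with the first half this leaves no room for an atom.
  · have key : ∀ y ∈ Ioo c z₀, cdf G y ≤ H.real (Iio z₀) := by
      intro y hy
      have h1 := hmaj.1 y ⟨hy.1.le, hy.2.le.trans hz₀.2.le⟩
      have h2 := intervalIntegral.integral_add_adjacent_intervals (hGi c y) (hGi y z₀)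
      have h3 := intervalIntegral.integral_add_adjacent_intervals (hHi c y) (hHi y z₀)
      have h4 := monotone_mul_sub_le_integral (monotone_cdf G) y z₀
      have h5 : ∫ t in y..z₀, cdf H t ≤ ∫ _t in y..z₀, H.real (Iio z₀) := by
        refine intervalIntegral.integral_mono_on_of_le_Ioo hy.2.le (hHi y z₀)
          intervalIntegrable_const fun t ht => ?_
        rw [cdf_eq_real]
        exact measureReal_mono (Iic_subset_Iio.2 ht.2)
      rw [intervalIntegral.integral_const, smul_eq_mul] at h5
      exact le_of_mul_le_mul_right (by linarith) (sub_pos.2 hy.2)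
    have hc' : Filter.Tendsto (cdf G) (nhdsWithin z₀ (Iio z₀)) (nhds (cdf G z₀)) :=
      (hcont.continuousAt (Icc_mem_nhds hz₀.1 hz₀.2)).continuousWithinAt
    refine le_of_tendsto hc' ?_
    filter_upwards [Ioo_mem_nhdsLT hz₀.1] with y hy using key y hy

/-- Equilibrium wages have no kink. -/
theorem IsCompetitiveEquilibrium.continuousAt_slope (hab : a < b) (hcd : c < d)
    (hv : IsProductionFunction (Icc a b) (Icc c d) v) (hF : IsTypeDistribution (Icc a b) F)
    (hG : IsTypeDistribution (Icc c d) G) (hE : IsCompetitiveEquilibrium a b c d v F G J p q)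
    (hT : IsDemand (Icc a b) (Icc c d) v q T) (hρ : Monotone ρ)
    (hq : ∀ z ∈ Icc c d, q z = q c + ∫ t in c..z, ρ t) {z₀ : ℝ} (hz₀ : z₀ ∈ Ioo c d) :
    ContinuousAt ρ z₀ := by
  have hJ := hE.isAssignment
  have := hJ.isProbabilityMeasure_snd
  have := hG.isProbabilityMeasure
  have hz₀' : z₀ ∈ Icc c d := Ioo_subset_Icc_self hz₀
  rw [hρ.continuousAt_iff_leftLim_eq_rightLim]
  by_contra hne
  set l := Function.leftLim ρ z₀ with hl
  set r := Function.rightLim ρ z₀ with hr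
  have hlr : l < r := lt_of_le_of_ne (hρ.leftLim_le_rightLim le_rfl) hne
  have hρl : ∀ t < z₀, ρ t ≤ l := fun t ht => hρ.le_leftLim ht
  have hρr : ∀ t, z₀ < t → r ≤ ρ t := fun t ht => hρ.rightLim_le ht
  have hb := hE.integral_cdf_le_of_kink hcd hG hρ hq hz₀ hlr hρl hρr
  obtain ⟨h1, h2⟩ := cdf_eq_of_binding hcd hG hJ.snd_majorizes hz₀ hb
  have hG0 : 0 < cdf G z₀ := by
    have := hG.strictMonoOn_cdf hcd (left_mem_Icc.2 hcd.le) hz₀' hz₀.1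
    rwa [hG.cdf_left] at this
  have hG1 : cdf G z₀ < 1 := by
    have := hG.strictMonoOn_cdf hcd hz₀' (right_mem_Icc.2 hcd.le) hz₀.2
    rwa [hG.cdf_right] at this
  have hqle : ∀ z ∈ Icc c z₀, q z₀ - q z ≤ l * (z₀ - z) := by
    intro z hz
    have h3 := monotone_integral_sub_integral hρ c z z₀
    have h4 : ∫ t in z..z₀, ρ t ≤ ∫ _t in z..z₀, l :=
      intervalIntegral.integral_mono_on_of_le_Ioo hz.2 hρ.intervalIntegrable
        intervalIntegrable_const fun t ht => hρl t ht.2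
    rw [intervalIntegral.integral_const, smul_eq_mul] at h4
    rw [hq z₀ hz₀', hq z ⟨hz.1, hz.2.trans hz₀.2.le⟩]
    linarith
  have hqge : ∀ z ∈ Icc z₀ d, r * (z - z₀) ≤ q z - q z₀ := by
    intro z hz
    have h3 := monotone_integral_sub_integral hρ c z₀ z
    have h4 : ∫ _t in z₀..z, r ≤ ∫ t in z₀..z, ρ t :=
      intervalIntegral.integral_mono_on_of_le_Ioo hz.1 intervalIntegrable_const
        hρ.intervalIntegrable fun t ht => hρr t ht.1
    rw [intervalIntegral.integral_const, smul_eq_mul] at h4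
    rw [hq z₀ hz₀', hq z ⟨hz₀.1.le.trans hz.1, hz.2⟩]
    linarith
  -- Some firms hire strictly below z₀ and some strictly above, since 0 < G(z₀) < 1. Their marginal
  -- products at z₀ are at most l and at least r respectively.
  obtain ⟨w, hw, hwz⟩ : ∃ w ∈ J.support, w.2 < z₀ := by
    refine IsAssignment.exists_mem_support_of_pos (P := fun z => z < z₀) measurableSet_Iio ?_
    exact ENNReal.toReal_pos_iff.1 (hG0.trans_le h2) |>.1
  obtain ⟨w', hw', hwz'⟩ : ∃ w ∈ J.support, z₀ < w.2 := by
    refine IsAssignment.exists_mem_support_of_pos (P := fun z => z₀ < z) measurableSet_Ioi ?_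
    rw [cdf_eq_real] at h1
    rw [pos_iff_ne_zero]
    intro h0
    have h3 := probReal_compl_eq_one_sub (μ := J.snd) (measurableSet_Iic (a := z₀))
    have h4 : J.snd.real (Iic z₀)ᶜ = 0 := by
      rw [compl_Iic, measureReal_def]
      exact (ENNReal.toReal_eq_zero_iff _).2 (Or.inl h0)
    linarith
  obtain ⟨hwX, hwT⟩ := hE.snd_eq_of_mem_support hv hT hw
  obtain ⟨hwX', hwT'⟩ := hE.snd_eq_of_mem_support hv hT hw'
  rw [hwT] at hwz
  rw [hwT'] at hwz'
  have hVl : partialZ (Icc c d) v w.1 z₀ ≤ l := by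
    have h3 := (hT _ hwX).2 z₀ hz₀'
    have h4 := hv.tangent_inequality hwX hz₀' (hT _ hwX).1
    have h5 := hqle _ ⟨(hT _ hwX).1.1, hwz.le⟩
    exact le_of_mul_le_mul_right (by linarith) (sub_pos.2 hwz)
  have hVr : r ≤ partialZ (Icc c d) v w'.1 z₀ := by
    have h3 := (hT _ hwX').2 z₀ hz₀'
    have h4 := hv.tangent_inequality hwX' hz₀' (hT _ hwX').1
    have h5 := hqge _ ⟨hwz'.le, (hT _ hwX').1.2⟩
    exact le_of_mul_le_mul_right (by linarith) (sub_pos.2 hwz')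
  have hVc : ContinuousOn (fun x => partialZ (Icc c d) v x z₀) (Icc a b) :=
    continuousOn_slice_fst (hv.continuousOn_partialZ hab hcd) hz₀'
  -- Continuity in the firm type gives a type whose marginal product at z₀ is midway between the two
  -- slopes; all nearby types lie strictly between them and demand exactly z₀.
  obtain ⟨x₁, hx₁, hx₁V⟩ := isPreconnected_Icc.intermediate_value hwX hwX' hVc
    (show (l + r) / 2 ∈ Icc _ _ from ⟨by linarith, by linarith⟩)
  simp only at hx₁V
  have hU := hVc x₁ hx₁ (Ioo_mem_nhds (a := l) (b := r) (by simp only [hx₁V]; linarith)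
    (by simp only [hx₁V]; linarith))
  obtain ⟨O, hO, hx₁O, hOsub⟩ := mem_nhdsWithin.1 hU
  have hpos : 0 < F O := hF.measure_pos hab hx₁ (mem_nhdsWithin_of_mem_nhds (hO.mem_nhds hx₁O))
  have hTz : ∀ x ∈ O, x ∈ Icc a b → T x = z₀ := by
    intro x hxO hx
    obtain ⟨hxl, hxr⟩ : partialZ (Icc c d) v x z₀ ∈ Ioo l r := hOsub ⟨hxO, hx⟩
    refine hv.eq_of_isMaxOn hE.convex_q hx (hT x hx).1 hz₀' (hT x hx).2 fun s hs => ?_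
    have h4 := hv.tangent_inequality hx hz₀' hs
    rcases le_total s z₀ with h | h
    · have h5 := hqle s ⟨hs.1, h⟩
      have h6 := mul_le_mul_of_nonneg_right hxl.le (sub_nonneg.2 h)
      linarith
    · have h5 := hqge s ⟨h, hs.2⟩
      have h6 := mul_le_mul_of_nonneg_right hxr.le (sub_nonneg.2 h)
      linarith
  have hatom : J.snd {z₀} = 0 := by
    have h3 : J.snd.real (Iic z₀ \ Iio z₀) = J.snd.real (Iic z₀) - J.snd.real (Iio z₀) :=
      measureReal_sdiff Iio_subset_Iic_self measurableSet_Iio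
    rw [Iic_sdiff_Iio_same, ← cdf_eq_real] at h3
    have h4 : J.snd.real {z₀} = 0 := le_antisymm (by linarith) measureReal_nonneg
    exact (measureReal_eq_zero_iff (measure_ne_top _ _)).1 h4
  rw [← hJ.fst_eq, Measure.fst_apply hO.measurableSet] at hpos
  rw [Measure.snd_apply (measurableSet_singleton z₀)] at hatom
  refine hpos.ne' (measure_mono_null (t := Prod.snd ⁻¹' {z₀} ∪ J.supportᶜ) (fun u hu => ?_)
    (measure_union_null hatom Measure.measure_compl_support))
  by_cases hus : u ∈ J.support
  · obtain ⟨huX, huT⟩ := hE.snd_eq_of_mem_support hv hT hus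
    exact Or.inl (huT.trans (hTz _ hu huX))
  · exact Or.inr hus

/-- Only the endpoints can still be bad. Replacing the values there by one-sided limits and
extending by constants does not change integrals over [c, z]. -/
theorem exists_continuous_slope (hcd : c < d) (hρ : Monotone ρ)
    (hρc : ∀ z ∈ Ioo c d, ContinuousAt ρ z) :
    ∃ σ : ℝ → ℝ, Monotone σ ∧ Continuous σ ∧
      ∀ z ∈ Icc c d, ∫ t in c..z, σ t = ∫ t in c..z, ρ t := by
  set f : ℝ → ℝ := extendFrom (Ioo c d) ρ with hf
  have hc := hρ.tendsto_rightLim c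
  have hd := hρ.tendsto_leftLim d
  have hcon : ContinuousOn ρ (Ioo c d) := fun z hz => (hρc z hz).continuousWithinAt
  have hfc : ContinuousOn f (Icc c d) := continuousOn_Icc_extendFrom_Ioo hcon hc hd
  have hfin : ∀ z ∈ Ioo c d, f z = ρ z := extendFrom_extends hcon
  have hfl : f c = Function.rightLim ρ c := eq_lim_at_left_extendFrom_Ioo hcd hc
  have hfr : f d = Function.leftLim ρ d := eq_lim_at_right_extendFrom_Ioo hcd hd
  have hfm : MonotoneOn f (Icc c d) := by
    intro x hx y hy hxy
    rcases hxy.eq_or_lt with rfl | hxy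
    · exact le_rfl
    rcases hx.1.eq_or_lt with rfl | hcx <;> rcases hy.2.eq_or_lt with rfl | hyd
    · rw [hfl, hfr]; exact hρ.rightLim_le_leftLim hxy
    · rw [hfl, hfin y ⟨hxy, hyd⟩]; exact hρ.rightLim_le hxy
    · rw [hfr, hfin x ⟨hcx, hxy⟩]; exact hρ.le_leftLim hxy
    · rw [hfin x ⟨hcx, hxy.trans hyd⟩, hfin y ⟨hcx.trans hxy, hyd⟩]; exact hρ hxy.le
  refine ⟨fun t => f (projIcc c d hcd.le t), fun s t hst => hfm (projIcc c d hcd.le s).2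
    (projIcc c d hcd.le t).2 (monotone_projIcc hcd.le hst),
    hfc.comp_continuous (by fun_prop) fun x => (projIcc c d hcd.le x).2, fun z hz => ?_⟩
  refine intervalIntegral.integral_congr_Ioo_of_le hz.1 fun t ht => ?_
  have ht' : t ∈ Ioo c d := ⟨ht.1, ht.2.trans_le hz.2⟩
  simp only [projIcc_of_mem hcd.le (Ioo_subset_Icc_self ht'), hfin t ht']

end Prices
end ManyToOne

namespace ManyToOne

variable {a b c d : ℝ} {v : ℝ → ℝ → ℝ} {F G : Measure ℝ} {J : Measure (ℝ × ℝ)} {p q T ρ : ℝ → ℝ}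

/-! ### Wage slopes on and off the range of the matching. -/

section Slopes

/-- Away from the upper corner, every upward deviation is unprofitable, so the marginal product at
each z > T(x) is at most ρ(z); continuity lets z descend to T(x). -/
theorem IsDemand.partialZ_le_slope (hab : a < b) (hcd : c < d)
    (hv : IsProductionFunction (Icc a b) (Icc c d) v) (hT : IsDemand (Icc a b) (Icc c d) v q T)
    (hρ : Monotone ρ) (hρc : Continuous ρ)
    (hq : ∀ z ∈ Icc c d, q z = q c + ∫ t in c..z, ρ t) {x : ℝ} (hx : x ∈ Icc a b)
    (hlt : T x < d) : partialZ (Icc c d) v x (T x) ≤ ρ (T x) := by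
  have hTx := (hT x hx).1
  have hsub : Ioc (T x) d ⊆ Icc c d := fun z hz => ⟨hTx.1.trans hz.1.le, hz.2⟩
  have hc : ContinuousOn (partialZ (Icc c d) v x) (Icc c d) :=
    continuousOn_slice_snd (hv.continuousOn_partialZ hab hcd) hx
  refine ContinuousWithinAt.closure_le (s := Ioc (T x) d) ?_ ((hc _ hTx).mono hsub)
    hρc.continuousWithinAt fun z hz => ?_
  · rw [closure_Ioc hlt.ne]
    exact left_mem_Icc.2 hlt.le
  · have h1 := (hT x hx).2 z (hsub hz)
    have h2 := hv.tangent_inequality hx (hsub hz) hTx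
    have h3 := monotone_mul_sub_le_integral hρ z (T x)
    have h4 := monotone_integral_sub_integral hρ c z (T x)
    rw [hq z (hsub hz), hq _ hTx] at h1
    exact le_of_mul_le_mul_right (by linarith) (sub_pos.2 hz.1)

theorem IsDemand.slope_le_partialZ (hab : a < b) (hcd : c < d)
    (hv : IsProductionFunction (Icc a b) (Icc c d) v) (hT : IsDemand (Icc a b) (Icc c d) v q T)
    (hρ : Monotone ρ) (hρc : Continuous ρ)
    (hq : ∀ z ∈ Icc c d, q z = q c + ∫ t in c..z, ρ t) {x : ℝ} (hx : x ∈ Icc a b)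
    (hlt : c < T x) : ρ (T x) ≤ partialZ (Icc c d) v x (T x) := by
  have hTx := (hT x hx).1
  have hsub : Ico c (T x) ⊆ Icc c d := fun z hz => ⟨hz.1, hz.2.le.trans hTx.2⟩
  have hc : ContinuousOn (partialZ (Icc c d) v x) (Icc c d) :=
    continuousOn_slice_snd (hv.continuousOn_partialZ hab hcd) hx
  refine ContinuousWithinAt.closure_le (s := Ico c (T x)) ?_ hρc.continuousWithinAt
    ((hc _ hTx).mono hsub) fun z hz => ?_
  · rw [closure_Ico hlt.ne]
    exact right_mem_Icc.2 hlt.le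
  · have h1 := (hT x hx).2 z (hsub hz)
    have h2 := hv.tangent_inequality hx (hsub hz) hTx
    have h3 := monotone_mul_sub_le_integral hρ z (T x)
    have h4 := monotone_integral_sub_integral hρ c z (T x)
    rw [hq z (hsub hz), hq _ hTx] at h1
    exact le_of_mul_le_mul_right (by linarith) (sub_pos.2 hz.2)

theorem IsCompetitiveEquilibrium.integral_snd_congr
    (hv : IsProductionFunction (Icc a b) (Icc c d) v)
    (hE : IsCompetitiveEquilibrium a b c d v F G J p q)
    (hT : IsDemand (Icc a b) (Icc c d) v q T) {f g : ℝ → ℝ} (hf : ContinuousOn f (Icc c d))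
    (hg : ContinuousOn g (Icc c d)) (hfg : ∀ x ∈ Icc a b, f (T x) = g (T x)) :
    ∫ z, f z ∂J.snd = ∫ z, g z ∂J.snd := by
  have hJ := hE.isAssignment
  have := hJ.isProbabilityMeasure_snd
  rw [Measure.snd, integral_map measurable_snd.aemeasurable
      (integrable_of_continuousOn_Icc hJ.snd_compl hf).1,
    integral_map measurable_snd.aemeasurable
      (integrable_of_continuousOn_Icc hJ.snd_compl hg).1]
  refine integral_congr_ae ?_
  filter_upwards [Measure.support_mem_ae (μ := J)] with w hw
  obtain ⟨h1, h2⟩ := hE.snd_eq_of_mem_support hv hT hw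
  rw [h2]
  exact hfg _ h1

/-- A convex function below the wage function that agrees with it on the range of the matching
equals the wage function. -/
theorem IsCompetitiveEquilibrium.eq_wage (hcd : c < d)
    (hv : IsProductionFunction (Icc a b) (Icc c d) v)
    (hG : IsTypeDistribution (Icc c d) G) (hE : IsCompetitiveEquilibrium a b c d v F G J p q)
    (hT : IsDemand (Icc a b) (Icc c d) v q T) (hρ : Monotone ρ) {k : ℝ}
    (hle : ∀ z ∈ Icc c d, k + ∫ t in c..z, ρ t ≤ q z)
    (heq : ∀ x ∈ Icc a b, k + ∫ t in c..T x, ρ t = q (T x)) :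
    ∀ z ∈ Icc c d, q z = k + ∫ t in c..z, ρ t := by
  have := hG.isProbabilityMeasure
  have := hE.isAssignment.isProbabilityMeasure_snd
  obtain ⟨K, hK⟩ := hE.lipschitz_q
  obtain ⟨K', hK'⟩ := monotone_exists_lipschitzOn_integral hρ c d
  have hc : ContinuousOn (fun z => k + ∫ t in c..z, ρ t) (Icc c d) :=
    continuousOn_const.add hK'.continuousOn
  have h1 := hE.integral_snd_congr hv hT hc hK.continuousOn heq
  have h2 := hE.integral_wage_le hcd hG hρ
  have h3 : ∀ (μ : Measure ℝ) [IsProbabilityMeasure μ], μ (Icc c d)ᶜ = 0 →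
      ∫ z, (k + ∫ t in c..z, ρ t) ∂μ = ∫ z, (∫ t in c..z, ρ t) ∂μ + k := fun μ _ hμ =>
    integral_eq_add_const_of_eqOn hμ hK'.continuousOn fun z _ => add_comm _ _
  rw [h3 _ hE.isAssignment.snd_compl, hE.wages_balance] at h1
  have h4 := hG.eq_zero_of_integral_nonpos hcd (hK.continuousOn.sub hc)
    (fun z hz => sub_nonneg.2 (hle z hz)) (by
      simp only [Pi.sub_apply]
      rw [integral_sub (integrable_of_continuousOn_Icc hG.measure_compl hK.continuousOn)
        (integrable_of_continuousOn_Icc hG.measure_compl hc), h3 _ hG.measure_compl]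
      linarith)
  intro z hz
  exact sub_eq_zero.1 (h4 z hz)

/-- No firm hires below T(a). Continuing `q` there along its tangent of slope ρ(T(a)) gives a
smaller convex wage with the same values on the range of `T`, so it must equal `q`. -/
theorem IsCompetitiveEquilibrium.slope_eq_left (hab : a < b) (hcd : c < d)
    (hv : IsProductionFunction (Icc a b) (Icc c d) v)
    (hG : IsTypeDistribution (Icc c d) G) (hE : IsCompetitiveEquilibrium a b c d v F G J p q)
    (hT : IsDemand (Icc a b) (Icc c d) v q T) (hρ : Monotone ρ)
    (hq : ∀ z ∈ Icc c d, q z = q c + ∫ t in c..z, ρ t) {y : ℝ} (hcy : c < y) :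
    ρ (T a) ≤ ρ y := by
  have ha : a ∈ Icc a b := left_mem_Icc.2 hab.le
  have hTa := (hT a ha).1
  set z₀ := T a with hz₀
  set σ : ℝ → ℝ := fun t => max (ρ t) (ρ z₀) with hσ
  have hσm : Monotone σ := fun s t hst => max_le_max (hρ hst) le_rfl
  have hσr : ∀ z ∈ Icc z₀ d, ∫ t in z₀..z, σ t = ∫ t in z₀..z, ρ t := fun z hz =>
    intervalIntegral.integral_congr_Ioo_of_le hz.1 fun t ht => max_eq_left (hρ ht.1.le)
  have hσc : ∫ t in c..z₀, σ t = ρ z₀ * (z₀ - c) := by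
    rw [intervalIntegral.integral_congr_Ioo_of_le (g := fun _ => ρ z₀) hTa.1
      fun t ht => max_eq_right (hρ ht.2.le), intervalIntegral.integral_const, smul_eq_mul, mul_comm]
  set k : ℝ := q z₀ - ∫ t in c..z₀, σ t with hk
  have heq : ∀ z ∈ Icc z₀ d, k + ∫ t in c..z, σ t = q z := by
    intro z hz
    have h1 := monotone_integral_sub_integral hσm c z₀ z
    have h2 := monotone_integral_sub_integral hρ c z₀ z
    have h3 := hσr z hz
    rw [hk, hq z₀ hTa, hq z ⟨hTa.1.trans hz.1, hz.2⟩]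
    linarith
  have hle : ∀ z ∈ Icc c d, k + ∫ t in c..z, σ t ≤ q z := by
    intro z hz
    rcases le_total z z₀ with h | h
    · have h1 := monotone_integral_sub_integral hσm c z z₀
      have h2 := monotone_integral_sub_integral hρ c z z₀
      have h3 := intervalIntegral.integral_mono_on h (μ := volume) hρ.intervalIntegrable
        hσm.intervalIntegrable fun t _ => le_max_left _ _
      rw [hk, hq z₀ hTa, hq z hz]
      linarith
    · exact (heq z ⟨h, hz.2⟩).le
  have h := hE.eq_wage hcd hv hG hT hσm hle fun x hx =>
    heq _ ⟨hT.monotoneOn hab hv ha hx hx.1, (hT x hx).1.2⟩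
  have h1 := h c (left_mem_Icc.2 hcd.le)
  rw [intervalIntegral.integral_same, hk, hσc, hq z₀ hTa] at h1
  have h2 := intervalIntegral.integral_add_adjacent_intervals (a := c) (b := y) (c := z₀)
    (μ := volume) hρ.intervalIntegrable hρ.intervalIntegrable
  have h3 := monotone_mul_sub_le_integral hρ y c
  rw [intervalIntegral.integral_symm] at h3
  have h4 := monotone_mul_sub_le_integral hρ z₀ y
  rw [intervalIntegral.integral_symm] at h4
  exact le_of_mul_le_mul_right (by linarith) (sub_pos.2 hcy)

/-- The mirror image above T(b): truncating the slope at ρ(T(b)) leaves the wages of hired skills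
unchanged, so it changes nothing. -/
theorem IsCompetitiveEquilibrium.slope_eq_right (hab : a < b) (hcd : c < d)
    (hv : IsProductionFunction (Icc a b) (Icc c d) v)
    (hG : IsTypeDistribution (Icc c d) G) (hE : IsCompetitiveEquilibrium a b c d v F G J p q)
    (hT : IsDemand (Icc a b) (Icc c d) v q T) (hρ : Monotone ρ)
    (hq : ∀ z ∈ Icc c d, q z = q c + ∫ t in c..z, ρ t) {y : ℝ} (hyd : y < d) :
    ρ y ≤ ρ (T b) := by
  have hb : b ∈ Icc a b := right_mem_Icc.2 hab.le
  have hTb := (hT b hb).1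
  have hd : d ∈ Icc c d := right_mem_Icc.2 hcd.le
  set z₀ := T b with hz₀
  set σ : ℝ → ℝ := fun t => min (ρ t) (ρ z₀) with hσ
  have hσm : Monotone σ := fun s t hst => min_le_min (hρ hst) le_rfl
  have hσd : ∫ t in z₀..d, σ t = ρ z₀ * (d - z₀) := by
    rw [intervalIntegral.integral_congr_Ioo_of_le (g := fun _ => ρ z₀) hTb.2
      fun t ht => min_eq_right (hρ ht.1.le), intervalIntegral.integral_const, smul_eq_mul, mul_comm]
  have heq : ∀ z ∈ Icc c z₀, q c + ∫ t in c..z, σ t = q z := by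
    intro z hz
    rw [hq z ⟨hz.1, hz.2.trans hTb.2⟩]
    congr 1
    exact intervalIntegral.integral_congr_Ioo_of_le hz.1
      fun t ht => min_eq_left (hρ (ht.2.le.trans hz.2))
  have hle : ∀ z ∈ Icc c d, q c + ∫ t in c..z, σ t ≤ q z := by
    intro z hz
    have h3 := intervalIntegral.integral_mono_on hz.1 (μ := volume) hσm.intervalIntegrable
      hρ.intervalIntegrable fun t _ => min_le_left _ _
    rw [hq z hz]
    linarith
  have h := hE.eq_wage hcd hv hG hT hσm hle fun x hx =>
    heq _ ⟨(hT x hx).1.1, hT.monotoneOn hab hv hx hb hx.2⟩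
  have h1 := h d hd
  have h2 := heq z₀ ⟨hTb.1, le_rfl⟩
  have h3 := monotone_integral_sub_integral hσm c z₀ d
  have h4 := monotone_integral_sub_integral hρ c z₀ d
  have h5 := intervalIntegral.integral_add_adjacent_intervals (a := z₀) (b := y) (c := d)
    (μ := volume) hρ.intervalIntegrable hρ.intervalIntegrable
  have h6 := monotone_mul_sub_le_integral hρ z₀ y
  have h7 := monotone_mul_sub_le_integral hρ y d
  rw [hq d hd] at h1
  rw [hq z₀ hTb] at h2
  exact le_of_mul_le_mul_right (by linarith) (sub_pos.2 hyd)

theorem IsCompetitiveEquilibrium.integral_sub_eq (hcd : c < d)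
    (hG : IsTypeDistribution (Icc c d) G) (hE : IsCompetitiveEquilibrium a b c d v F G J p q) :
    ∫ z, max (d - z) 0 ∂J.snd = ∫ z, max (d - z) 0 ∂G := by
  have := hG.isProbabilityMeasure
  have := hE.isAssignment.isProbabilityMeasure_snd
  rw [integral_posPart_sub hE.isAssignment.snd_compl hcd.le,
    integral_posPart_sub hG.measure_compl hcd.le]
  exact hE.isAssignment.snd_majorizes.2

/-- Otherwise all workforces would have mean skill `d`, which contradicts equality of means since
`G` has full support. The first-order condition at T(a) thus holds as an inequality from above. -/
theorem IsCompetitiveEquilibrium.demand_left_lt (hab : a < b) (hcd : c < d)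
    (hv : IsProductionFunction (Icc a b) (Icc c d) v)
    (hG : IsTypeDistribution (Icc c d) G) (hE : IsCompetitiveEquilibrium a b c d v F G J p q)
    (hT : IsDemand (Icc a b) (Icc c d) v q T) : T a < d := by
  have ha : a ∈ Icc a b := left_mem_Icc.2 hab.le
  by_contra hcon
  have h1 := hE.integral_snd_congr hv hT (f := fun z => max (d - z) 0) (g := fun _ => 0)
    (by fun_prop) continuousOn_const fun x hx => by
      have h2 := hT.monotoneOn hab hv ha hx hx.1
      exact max_eq_right (by linarith [not_lt.1 hcon])
  rw [hE.integral_sub_eq hcd hG, integral_zero] at h1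
  have h2 := hG.eq_zero_of_integral_nonpos hcd (by fun_prop) (fun z _ => le_max_right _ _) h1.le c
    (left_mem_Icc.2 hcd.le)
  rw [max_eq_left (by linarith)] at h2
  linarith

theorem IsCompetitiveEquilibrium.lt_demand_right (hab : a < b) (hcd : c < d)
    (hv : IsProductionFunction (Icc a b) (Icc c d) v)
    (hG : IsTypeDistribution (Icc c d) G) (hE : IsCompetitiveEquilibrium a b c d v F G J p q)
    (hT : IsDemand (Icc a b) (Icc c d) v q T) : c < T b := by
  have := hG.isProbabilityMeasure
  have := hE.isAssignment.isProbabilityMeasure_snd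
  have hb : b ∈ Icc a b := right_mem_Icc.2 hab.le
  by_contra hcon
  have h1 := hE.integral_snd_congr hv hT (f := fun z => max (d - z) 0) (g := fun _ => d - c)
    (by fun_prop) continuousOn_const fun x hx => by
      have h2 := hT.monotoneOn hab hv hx hb hx.2
      have h3 : T x = c := le_antisymm (h2.trans (not_lt.1 hcon)) (hT x hx).1.1
      simp only [h3]
      exact max_eq_left (by linarith)
  rw [hE.integral_sub_eq hcd hG, integral_const, probReal_univ, one_smul] at h1
  have hc1 : Continuous fun z : ℝ => max (d - z) 0 := by fun_prop
  have h2 := hG.eq_zero_of_integral_nonpos hcd (g := fun z => (d - c) - max (d - z) 0)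
    (by fun_prop) (fun z hz => sub_nonneg.2 (max_le (by linarith [hz.1]) (by linarith))) (by
      rw [integral_sub (integrable_const _)
        (integrable_of_continuousOn_Icc hG.measure_compl hc1.continuousOn), h1, integral_const,
        probReal_univ, one_smul, sub_self]) d (right_mem_Icc.2 hcd.le)
  simp only [sub_self, max_self] at h2
  linarith

/-- The slope of the wage function at an interior skill level. -/
theorem IsCompetitiveEquilibrium.slope_cases (hab : a < b) (hcd : c < d)
    (hv : IsProductionFunction (Icc a b) (Icc c d) v)
    (hG : IsTypeDistribution (Icc c d) G) (hE : IsCompetitiveEquilibrium a b c d v F G J p q)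
    (hT : IsDemand (Icc a b) (Icc c d) v q T) (hρ : Monotone ρ) (hρc : Continuous ρ)
    (hq : ∀ z ∈ Icc c d, q z = q c + ∫ t in c..z, ρ t) {y : ℝ} (hy : y ∈ Ioo c d) :
    (∃ x ∈ Icc a b, T x = y) ∨ (y < T a ∧ ρ y = partialZ (Icc c d) v a (T a)) ∨
      (T b < y ∧ ρ y = partialZ (Icc c d) v b (T b)) := by
  have ha : a ∈ Icc a b := left_mem_Icc.2 hab.le
  have hb : b ∈ Icc a b := right_mem_Icc.2 hab.le
  obtain ⟨K, hK⟩ := hE.lipschitz_q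
  rcases lt_or_ge y (T a) with h1 | h1
  · refine Or.inr (Or.inl ⟨h1, le_antisymm ?_ ?_⟩)
    · exact (hρ h1.le).trans (hT.slope_le_partialZ hab hcd hv hρ hρc hq ha (hy.1.trans h1))
    · exact (hT.partialZ_le_slope hab hcd hv hρ hρc hq ha
        (hE.demand_left_lt hab hcd hv hG hT)).trans
        (hE.slope_eq_left hab hcd hv hG hT hρ hq hy.1)
  rcases lt_or_ge (T b) y with h2 | h2
  · refine Or.inr (Or.inr ⟨h2, le_antisymm ?_ ?_⟩)
    · exact (hE.slope_eq_right hab hcd hv hG hT hρ hq hy.2).trans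
        (hT.slope_le_partialZ hab hcd hv hρ hρc hq hb (hE.lt_demand_right hab hcd hv hG hT))
    · exact (hT.partialZ_le_slope hab hcd hv hρ hρc hq hb (h2.trans hy.2)).trans (hρ h2.le)
  · obtain ⟨x, hx, hxy⟩ := intermediate_value_Icc hab.le
      (hT.continuousOn hv hE.convex_q hK.continuousOn) ⟨h1, h2⟩
    exact Or.inl ⟨x, hx, hxy⟩

/-- A higher matching goes with a flatter wage function. -/
theorem slope_le_slope_of_demand_le (hab : a < b) (hcd : c < d)
    (hv : IsProductionFunction (Icc a b) (Icc c d) v) {Fh Gh : Measure ℝ}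
    {Jh : Measure (ℝ × ℝ)} {ph qh Th ρh : ℝ → ℝ}
    (hG : IsTypeDistribution (Icc c d) G) (hGh : IsTypeDistribution (Icc c d) Gh)
    (hE : IsCompetitiveEquilibrium a b c d v F G J p q)
    (hEh : IsCompetitiveEquilibrium a b c d v Fh Gh Jh ph qh)
    (hT : IsDemand (Icc a b) (Icc c d) v q T) (hTh : IsDemand (Icc a b) (Icc c d) v qh Th)
    (hρ : Monotone ρ) (hρc : Continuous ρ) (hρh : Monotone ρh) (hρhc : Continuous ρh)
    (hq : ∀ z ∈ Icc c d, q z = q c + ∫ t in c..z, ρ t)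
    (hqh : ∀ z ∈ Icc c d, qh z = qh c + ∫ t in c..z, ρh t)
    (hle : ∀ x ∈ Icc a b, T x ≤ Th x) : ∀ y ∈ Icc c d, ρh y ≤ ρ y := by
  have ha : a ∈ Icc a b := left_mem_Icc.2 hab.le
  have hb : b ∈ Icc a b := right_mem_Icc.2 hab.le
  have hfoc : ∀ x ∈ Icc a b, T x ∈ Ioo c d → ρ (T x) = partialZ (Icc c d) v x (T x) :=
    fun x hx h => le_antisymm (hT.slope_le_partialZ hab hcd hv hρ hρc hq hx h.1)
      (hT.partialZ_le_slope hab hcd hv hρ hρc hq hx h.2)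
  have hfoch : ∀ x ∈ Icc a b, Th x ∈ Ioo c d → ρh (Th x) = partialZ (Icc c d) v x (Th x) :=
    fun x hx h => le_antisymm (hTh.slope_le_partialZ hab hcd hv hρh hρhc hqh hx h.1)
      (hTh.partialZ_le_slope hab hcd hv hρh hρhc hqh hx h.2)
  have hmx : ∀ {z x x' : ℝ}, z ∈ Icc c d → x ∈ Icc a b → x' ∈ Icc a b → x ≤ x' →
      partialZ (Icc c d) v x z ≤ partialZ (Icc c d) v x' z := fun hz hx hx' h =>
    hv.monotoneOn_partialZ hab hcd hz hx hx' h
  have hmz : ∀ {x z z' : ℝ}, x ∈ Icc a b → z ∈ Icc c d → z' ∈ Icc c d → z ≤ z' →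
      partialZ (Icc c d) v x z' ≤ partialZ (Icc c d) v x z := fun hx hz hz' h =>
    (hv.strictAntiOn_partialZ hx).antitoneOn hz hz' h
  have hTm := hT.monotoneOn hab hv
  have hThm := hTh.monotoneOn hab hv
  have hint : ∀ y ∈ Ioo c d, ρh y ≤ ρ y := by
    intro y hy
    have hy' := Ioo_subset_Icc_self hy
    -- Each skill is hired, below the range, or above it, in each economy. Three of the nine
    -- combinations contradict T ≤ Th; the rest follow from v_z increasing in x and decreasing in z.
    rcases hE.slope_cases hab hcd hv hG hT hρ hρc hq hy with ⟨x, hx, hxy⟩ | ⟨h1, h2⟩ | ⟨h1, h2⟩ <;>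
    rcases hEh.slope_cases hab hcd hv hGh hTh hρh hρhc hqh hy with
      ⟨x', hx', hxy'⟩ | ⟨h3, h4⟩ | ⟨h3, h4⟩
    · have e1 := hfoc x hx (hxy ▸ hy)
      rw [hxy] at e1
      rcases le_total x' x with h | h
      · have e2 := hfoch x' hx' (hxy' ▸ hy)
        rw [hxy'] at e2
        rw [e1, e2]
        exact hmx hy' hx' hx h
      -- If x ≤ x', then y = T(x) ≤ Th(x) ≤ Th(x') = y, so type x hires y in both economies and the
      -- slopes agree.
      · have h5 : Th x = y :=
          le_antisymm ((hThm hx hx' h).trans hxy'.le) (hxy.symm.le.trans (hle x hx))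
        have e2 := hfoch x hx (h5 ▸ hy)
        rw [h5] at e2
        rw [e1, e2]
    · have e1 := hfoc x hx (hxy ▸ hy)
      rw [hxy] at e1
      rw [e1, h4]
      exact (hmz ha hy' (hTh a ha).1 h3.le).trans (hmx hy' ha hx hx.1)
    · have := hThm hx hb hx.2
      have := hle x hx
      linarith
    · have := hThm ha hx' hx'.1
      have := hle a ha
      linarith
    · rw [h2, h4]
      exact hmz ha (hT a ha).1 (hTh a ha).1 (hle a ha)
    · have := hThm ha hb hab.le
      have := hle a ha
      linarith
    · have e2 := hfoch x' hx' (hxy' ▸ hy)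
      rw [hxy'] at e2
      rw [h2, e2]
      exact (hmx hy' hx' hb hx'.2).trans (hmz hb (hT b hb).1 hy' h1.le)
    · rw [h2, h4]
      exact (hmx (hTh a ha).1 ha hb hab.le).trans
        (hmz hb (hT b hb).1 (hTh a ha).1 (h1.trans h3).le)
    · rw [h2, h4]
      exact hmz hb (hT b hb).1 (hTh b hb).1 (hle b hb)
  have hcl : closure (Ioo c d) ⊆ {y | ρh y ≤ ρ y} :=
    (isClosed_le hρhc hρc).closure_subset_iff.2 hint
  rw [closure_Ioo hcd.ne] at hcl
  exact hcl

theorem hasDerivWithinAt_of_slope (hρc : Continuous ρ)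
    (hq : ∀ z ∈ Icc c d, q z = q c + ∫ t in c..z, ρ t) {z : ℝ} (hz : z ∈ Icc c d) :
    HasDerivWithinAt q (ρ z) (Icc c d) z :=
  ((hρc.integral_hasStrictDerivAt c z).hasDerivAt.const_add (q c)).hasDerivWithinAt.congr hq
    (hq z hz)

theorem IsEquilibriumMatching.exists_continuous_slope (hab : a < b) (hcd : c < d)
    (hv : IsProductionFunction (Icc a b) (Icc c d) v) (hF : IsTypeDistribution (Icc a b) F)
    (hG : IsTypeDistribution (Icc c d) G) (hT : IsEquilibriumMatching a b c d v F G T)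
    (hpq : IsEquilibriumPrices a b c d v F G p q) :
    ∃ ρ : ℝ → ℝ, Monotone ρ ∧ Continuous ρ ∧ ∀ z ∈ Icc c d, q z = q c + ∫ t in c..z, ρ t := by
  obtain ⟨ρ, hρ, hq, -⟩ := hT.exists_slope hab hcd hv hG hpq
  obtain ⟨J, hE⟩ := id hpq
  obtain ⟨σ, hσ, hσc, hσρ⟩ := ManyToOne.exists_continuous_slope hcd hρ fun z hz =>
    hE.continuousAt_slope hab hcd hv hF hG (hT.isDemand hcd hv hG hpq) hρ hq hz
  exact ⟨σ, hσ, hσc, fun z hz => by rw [hσρ z hz]; exact hq z hz⟩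

theorem IsEquilibriumMatching.hasDerivWithinAt_profit (hab : a < b) (hcd : c < d)
    (hv : IsProductionFunction (Icc a b) (Icc c d) v)
    (hG : IsTypeDistribution (Icc c d) G) (hT : IsEquilibriumMatching a b c d v F G T)
    (hpq : IsEquilibriumPrices a b c d v F G p q) {x : ℝ} (hx : x ∈ Icc a b) :
    HasDerivWithinAt p (partialX (Icc a b) v x (T x)) (Icc a b) x := by
  obtain ⟨J, hE⟩ := id hpq
  obtain ⟨K, hK⟩ := hE.lipschitz_q
  exact IsDemand.hasDerivWithinAt_profit hab hcd hv hT.mapsTo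
    ((hT.isDemand hcd hv hG hpq).continuousOn hv hE.convex_q hK.continuousOn) hE.no_entry
    (hT.eq_of_prices hcd hv hG hpq) hx

end Slopes
end ManyToOne

/-! ### Assembly of the theorem. -/

theorem mainTheorem7 {a b c d : ℝ} (hab : a < b) (hcd : c < d) :
    -- the equilibrium matching exists and is unique as a function on `[a, b]`
    (∀ (v : ℝ → ℝ → ℝ) (F G : Measure ℝ),
      ManyToOne.IsProductionFunction (Icc a b) (Icc c d) v →
      ManyToOne.IsTypeDistribution (Icc a b) F →
      ManyToOne.IsTypeDistribution (Icc c d) G →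
        ∃ T : ℝ → ℝ, ManyToOne.IsEquilibriumMatching a b c d v F G T ∧
          ∀ Th : ℝ → ℝ, ManyToOne.IsEquilibriumMatching a b c d v F G Th →
            EqOn Th T (Icc a b)) ∧
    -- worse firms (a trailing `h` marks the hatted object)
    (∀ F Fh : Measure ℝ,
      ManyToOne.IsTypeDistribution (Icc a b) F →
      ManyToOne.IsTypeDistribution (Icc a b) Fh →
        ((∀ (v : ℝ → ℝ → ℝ) (G : Measure ℝ) (T Th : ℝ → ℝ),
            ManyToOne.IsProductionFunction (Icc a b) (Icc c d) v →
            ManyToOne.IsTypeDistribution (Icc c d) G →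
            ManyToOne.IsEquilibriumMatching a b c d v F G T →
            ManyToOne.IsEquilibriumMatching a b c d v Fh G Th →
              ∀ x ∈ Icc a b, T x ≤ Th x) ↔
          ∀ x ∈ Icc a b, cdf F x ≤ cdf Fh x)) ∧
    -- better workers
    (∀ G Gh : Measure ℝ,
      ManyToOne.IsTypeDistribution (Icc c d) G →
      ManyToOne.IsTypeDistribution (Icc c d) Gh →
        ((∀ (v : ℝ → ℝ → ℝ) (F : Measure ℝ) (T Th : ℝ → ℝ),
            ManyToOne.IsProductionFunction (Icc a b) (Icc c d) v →
            ManyToOne.IsTypeDistribution (Icc a b) F →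
            ManyToOne.IsEquilibriumMatching a b c d v F G T →
            ManyToOne.IsEquilibriumMatching a b c d v F Gh Th →
              ∀ x ∈ Icc a b, T x ≤ Th x) ↔
          ∀ y ∈ Icc c d, cdf Gh y ≤ cdf G y)) ∧
    -- returns to productivity and to skill
    (∀ (v : ℝ → ℝ → ℝ) (F Fh G Gh : Measure ℝ) (T Th p ph q qh : ℝ → ℝ),
      ManyToOne.IsProductionFunction (Icc a b) (Icc c d) v →
      ManyToOne.IsTypeDistribution (Icc a b) F →
      ManyToOne.IsTypeDistribution (Icc a b) Fh →
      ManyToOne.IsTypeDistribution (Icc c d) G →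
      ManyToOne.IsTypeDistribution (Icc c d) Gh →
      ManyToOne.IsEquilibriumMatching a b c d v F G T →
      ManyToOne.IsEquilibriumMatching a b c d v Fh Gh Th →
      ManyToOne.IsEquilibriumPrices a b c d v F G p q →
      ManyToOne.IsEquilibriumPrices a b c d v Fh Gh ph qh →
        DifferentiableOn ℝ p (Icc a b) ∧ DifferentiableOn ℝ ph (Icc a b) ∧
        DifferentiableOn ℝ q (Icc c d) ∧ DifferentiableOn ℝ qh (Icc c d) ∧
        ((∀ x ∈ Icc a b, T x ≤ Th x) ↔
          ∀ x ∈ Icc a b, derivWithin p (Icc a b) x ≤ derivWithin ph (Icc a b) x) ∧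
        ((∀ x ∈ Icc a b, derivWithin p (Icc a b) x ≤ derivWithin ph (Icc a b) x) ↔
          ∀ y ∈ Icc c d, derivWithin qh (Icc c d) y ≤ derivWithin q (Icc c d) y)) := by
  open ManyToOne in
  refine ⟨fun v F G hv hF hG => ?_, fun F Fh hF hFh => ⟨fun h => ?_, fun h => ?_⟩,
    fun G Gh hG hGh => ⟨fun h => ?_, fun h => ?_⟩, ?_⟩
  · obtain ⟨T, hT⟩ := exists_isEquilibriumMatching hab hcd hv hF hG
    exact ⟨T, hT, fun Th hTh => hTh.eqOn hcd hv hG hT⟩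
  · exact cdf_le_of_forall_matching_le hab hcd hF hFh h
  · intro v G T Th hv hG hT hTh
    exact hT.le_of_dominance hab hcd hv hF hFh hG hG h (fun _ _ => le_rfl) hTh
  · exact cdf_ge_of_forall_matching_le hab hcd hG hGh h
  · intro v F T Th hv hF hT hTh
    exact hT.le_of_dominance hab hcd hv hF hF hG hGh (fun _ _ => le_rfl) h hTh
  intro v F Fh G Gh T Th p ph q qh hv hF hFh hG hGh hT hTh hpq hpqh
  obtain ⟨ρ, hρ, hρc, hq⟩ := hT.exists_continuous_slope hab hcd hv hF hG hpq
  obtain ⟨ρh, hρh, hρhc, hqh⟩ := hTh.exists_continuous_slope hab hcd hv hFh hGh hpqh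
  have hp' := fun x (hx : x ∈ Icc a b) => hT.hasDerivWithinAt_profit hab hcd hv hG hpq hx
  have hph' := fun x (hx : x ∈ Icc a b) => hTh.hasDerivWithinAt_profit hab hcd hv hGh hpqh hx
  have hq' := fun z (hz : z ∈ Icc c d) => hasDerivWithinAt_of_slope hρc hq hz
  have hqh' := fun z (hz : z ∈ Icc c d) => hasDerivWithinAt_of_slope hρhc hqh hz
  obtain ⟨J, hE⟩ := id hpq
  obtain ⟨Jh, hEh⟩ := id hpqh
  have hdem := hT.isDemand hcd hv hG hpq
  have hdemh := hTh.isDemand hcd hv hGh hpqh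
  have h1 : (∀ x ∈ Icc a b, T x ≤ Th x) ↔
      ∀ x ∈ Icc a b, derivWithin p (Icc a b) x ≤ derivWithin ph (Icc a b) x := by
    refine forall₂_congr fun x hx => ?_
    rw [(hp' x hx).derivWithin (uniqueDiffOn_Icc hab x hx),
      (hph' x hx).derivWithin (uniqueDiffOn_Icc hab x hx),
      (hv.strictMonoOn_partialX hx).le_iff_le (hT.mapsTo x hx) (hTh.mapsTo x hx)]
  have h2 : (∀ x ∈ Icc a b, T x ≤ Th x) ↔
      ∀ y ∈ Icc c d, derivWithin qh (Icc c d) y ≤ derivWithin q (Icc c d) y := by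
    have h3 : (∀ y ∈ Icc c d, derivWithin qh (Icc c d) y ≤ derivWithin q (Icc c d) y) ↔
        ∀ y ∈ Icc c d, ρh y ≤ ρ y := forall₂_congr fun y hy => by
      rw [(hq' y hy).derivWithin (uniqueDiffOn_Icc hcd y hy),
        (hqh' y hy).derivWithin (uniqueDiffOn_Icc hcd y hy)]
    rw [h3]
    -- For the converse, ρh ≤ ρ makes q - qh increasing, which raises demand.
    refine ⟨fun h => slope_le_slope_of_demand_le hab hcd hv hG hGh hE hEh hdem hdemh hρ hρc hρh
      hρhc hq hqh h, fun h => hdem.le_of_monotoneOn_sub hv hEh.convex_q hdemh ?_⟩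
    intro y hy z hz hyz
    have := monotoneOn_integral_sub hρ hρh h hy hz hyz
    simp only at this ⊢
    rw [hq y hy, hq z hz, hqh y hy, hqh z hz]
    linarith
  exact ⟨fun x hx => (hp' x hx).differentiableWithinAt,
    fun x hx => (hph' x hx).differentiableWithinAt,
    fun z hz => (hq' z hz).differentiableWithinAt,
    fun z hz => (hqh' z hz).differentiableWithinAt, h1, h1.symm.trans h2⟩
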